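/- Manifolds are smooth, finite dimensional, Hausdorff and second countable. Let $(G\rightrightarrows M,\omega)$ be a symplectic groupoid over a Poisson manifold $(M,\Pi)$: $G\rightrightarrows M$ is a Lie groupoid with source $s$ and target $t$, $\omega$ is a multiplicative symplectic form on $G$, and $t:(G,\omega)\to(M,\Pi)$ is a Poisson map. A *right Haar measure* on $G$ is a family $(\mu_m)_{m\in M}$, where $\mu_m$ is a measure given by a smooth positive density on $s^{-1}(m)$, which is invariant under right translation (for each $g\in G$, the map $h\mapsto hg$ from $s^{-1}(t(g))$ to $s^{-1}(s(g))$ takes $\mu_{t(g)}$ to $\mu_{s(g)}$) and smooth along the orbits of $G$ (for $f\in C_c^\infty(G)$, the function $m\mapsto\int f\,d\mu_m$ is smooth on each orbit). Left Haar measures are defined in the same way, with target fibers and left translations. No continuity in $m$ transversally to the orbits is required. For $m\in M$ let $\mathcal O_m=t(s^{-1}(m))$ be the orbit of $m$, whose connected components are symplectic leaves of $(M,\Pi)$ of one dimension $2r$, and let $\lambda_m$ be the measure on $\mathcal O_m$ given by the symplectic volume $|\omega_{\mathcal L}^{\,r}|$ of these leaves, where $\omega_{\mathcal L}(\Pi^\sharp\alpha,\Pi^\sharp\beta)=\Pi(\alpha,\beta)$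 and $\omega_{\mathcal L}^{\,r}$ is the $r$-th wedge power. **Lemma.** Assume that all isotropy groups $G_x=\{k\in G: s(k)=t(k)=x\}$ are compact. Then there is a canonical choice of a right and of a left Haar measure on $G$. Precisely, let $dk$ denote the normalized Haar measure (of total mass $1$) of each isotropy group. 1. For $m\in M$ and $x\in\mathcal O_m$, the image $\kappa_{m,x}$ of $dk$ under $G_x\to s^{-1}(m)\cap t^{-1}(x)$, $k\mapsto kg$, does not depend on the choice of $g\in s^{-1}(m)\cap t^{-1}(x)$, and the formula $$\mu_m(A)=\int_{\mathcal O_m}\kappa_{m,x}(A)\,d\lambda_m(x)\qquad (A\subseteq G\text{ Borel},\ m\in M)$$ determines a unique family $(\mu_m)_{m\in M}$ of measures; this family is a right Haar measure on $G$. 2. Likewise, for $m\in M$ and $x\in\mathcal O_m$, the image $\kappa'_{m,x}$ of $dk$ under $G_x\to t^{-1}(m)\cap s^{-1}(x)$, $k\mapsto gk$, does not depend on the choice of $g\in t^{-1}(m)\cap s^{-1}(x)$, and $\nu_m(A)=\int_{\mathcal O_m}\kappa'_{m,x}(A)\,d\lambda_m(x)$ determines a unique family of measures $(\nu_m)_{m\in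 M}$, which is a left Haar measure on $G$. -/

import Mathlib

open Set MeasureTheory
open scoped Manifold ContDiff Topology ENNReal

noncomputable section

namespace SymplecticGroupoid

/-- A (Hausdorff) Lie groupoid `G ⇉ M`. The product `mul g h` is the composite `g ∘ h`; it is
meaningful only if `src g = tgt h`, and all axioms are restricted to composable arrows. -/
structure LieGroupoid (E F G M : Type*)
    [NormedAddCommGroup E] [NormedSpace ℝ E] [NormedAddCommGroup F] [NormedSpace ℝ F]
    [TopologicalSpace M] [ChartedSpace E M] [TopologicalSpace G] [ChartedSpace F G] where
  src : G → M
  tgt : G → M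
  unit : M → G
  inv : G → G
  mul : G → G → G
  src_unit : ∀ x, src (unit x) = x
  tgt_unit : ∀ x, tgt (unit x) = x
  src_inv : ∀ g, src (inv g) = tgt g
  tgt_inv : ∀ g, tgt (inv g) = src g
  src_mul : ∀ g h, src g = tgt h → src (mul g h) = src h
  tgt_mul : ∀ g h, src g = tgt h → tgt (mul g h) = tgt g
  mul_assoc : ∀ g h k, src g = tgt h → src h = tgt k → mul (mul g h) k = mul g (mul h k)
  unit_mul : ∀ g, mul (unit (tgt g)) g = g
  mul_unit : ∀ g, mul g (unit (src g)) = g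
  inv_mul : ∀ g, mul (inv g) g = unit (src g)
  mul_inv : ∀ g, mul g (inv g) = unit (tgt g)
  isSubmersion_src : Manifold.IsSubmersion 𝓘(ℝ, F) 𝓘(ℝ, E) ∞ src
  isSubmersion_tgt : Manifold.IsSubmersion 𝓘(ℝ, F) 𝓘(ℝ, E) ∞ tgt
  contMDiff_unit : ContMDiff 𝓘(ℝ, E) 𝓘(ℝ, F) ∞ unit
  contMDiff_inv : ContMDiff 𝓘(ℝ, F) 𝓘(ℝ, F) ∞ inv
  contMDiffOn_mul : ContMDiffOn (𝓘(ℝ, F).prod 𝓘(ℝ, F)) 𝓘(ℝ, F) ∞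
    (fun p : G × G => mul p.1 p.2) {p | src p.1 = tgt p.2}

section Forms

variable {F G : Type*} [NormedAddCommGroup F] [NormedSpace ℝ F]
  [TopologicalSpace G] [ChartedSpace F G]

/-- The expression of a 2-form `Ω` in the chart at `x₀`, i.e. its pullback under the inverse of
this chart. -/
def chartForm (Ω : ∀ g : G, TangentSpace 𝓘(ℝ, F) g [⋀^Fin 2]→L[ℝ] ℝ) (x₀ : G) (y : F) :
    F [⋀^Fin 2]→L[ℝ] ℝ :=
  (Ω ((extChartAt 𝓘(ℝ, F) x₀).symm y)).compContinuousLinearMap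
    (mfderiv 𝓘(ℝ, F) 𝓘(ℝ, F) (extChartAt 𝓘(ℝ, F) x₀).symm y)

/-- `Ω` is a symplectic form: a smooth, closed, nondegenerate 2-form. -/
structure IsSymplectic (Ω : ∀ g : G, TangentSpace 𝓘(ℝ, F) g [⋀^Fin 2]→L[ℝ] ℝ) : Prop where
  smooth : ∀ x₀ : G, ContDiffOn ℝ ∞ (chartForm Ω x₀) (extChartAt 𝓘(ℝ, F) x₀).target
  closed : ∀ x₀ : G, ∀ y ∈ (extChartAt 𝓘(ℝ, F) x₀).target, extDeriv (chartForm Ω x₀) y = 0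
  nondegenerate : ∀ (g : G) (v : TangentSpace 𝓘(ℝ, F) g),
    (∀ w : TangentSpace 𝓘(ℝ, F) g, Ω g ![v, w] = 0) → v = 0

end Forms

section Poisson

variable {E M : Type*} [NormedAddCommGroup E] [NormedSpace ℝ E]
  [TopologicalSpace M] [ChartedSpace E M]

/-- The cotangent space of `M` at `x`. -/
abbrev Cotangent (E : Type*) {M : Type*} [NormedAddCommGroup E] [NormedSpace ℝ E]
    [TopologicalSpace M] [ChartedSpace E M] (x : M) : Type _ :=
  TangentSpace 𝓘(ℝ, E) x →L[ℝ] ℝ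

/-- The differential of a real function at `x`, as a covector. -/
def differential (E : Type*) {M : Type*} [NormedAddCommGroup E] [NormedSpace ℝ E]
    [TopologicalSpace M] [ChartedSpace E M] (f : M → ℝ) (x : M) : Cotangent E x :=
  mfderiv 𝓘(ℝ, E) 𝓘(ℝ, ℝ) f x

/-- The bracket `{f, h} = Π(df, dh)`. -/
def bracket (P : ∀ x : M, Cotangent E x →ₗ[ℝ] Cotangent E x →ₗ[ℝ] ℝ) (f h : M → ℝ) : M → ℝ :=
  fun x => P x (differential E f x) (differential E h x)

/-- `P` is a Poisson structure on `M`: a smooth bivector field whose bracket satisfies the Jacobi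
identity. -/
structure IsPoisson (P : ∀ x : M, Cotangent E x →ₗ[ℝ] Cotangent E x →ₗ[ℝ] ℝ) : Prop where
  skew : ∀ (x : M) (α β : Cotangent E x), P x α β = - P x β α
  smooth : ∀ f h : M → ℝ, ContMDiff 𝓘(ℝ, E) 𝓘(ℝ, ℝ) ∞ f → ContMDiff 𝓘(ℝ, E) 𝓘(ℝ, ℝ) ∞ h →
    ContMDiff 𝓘(ℝ, E) 𝓘(ℝ, ℝ) ∞ (bracket P f h)
  jacobi : ∀ f h k : M → ℝ, ContMDiff 𝓘(ℝ, E) 𝓘(ℝ, ℝ) ∞ f →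
    ContMDiff 𝓘(ℝ, E) 𝓘(ℝ, ℝ) ∞ h → ContMDiff 𝓘(ℝ, E) 𝓘(ℝ, ℝ) ∞ k → ∀ x,
    bracket P f (bracket P h k) x + bracket P h (bracket P k f) x
      + bracket P k (bracket P f h) x = 0

/-- `v = Π♯ α`, i.e. `β v = Π(α, β)` for all covectors `β`. The vectors of this form are the
tangent vectors of the symplectic leaf through `x`. -/
def IsSharp (P : ∀ x : M, Cotangent E x →ₗ[ℝ] Cotangent E x →ₗ[ℝ] ℝ) (x : M)
    (α : Cotangent E x) (v : TangentSpace 𝓘(ℝ, E) x) : Prop :=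
  ∀ β : Cotangent E x, P x α β = β v

open Classical in
/-- The symplectic form of the leaf through `x`, defined by `ω_L(Π♯ α, Π♯ β) = Π(α, β)`
(and `0` on vectors that are not tangent to the leaf). -/
def leafForm (P : ∀ x : M, Cotangent E x →ₗ[ℝ] Cotangent E x →ₗ[ℝ] ℝ) (x : M)
    (v w : TangentSpace 𝓘(ℝ, E) x) : ℝ :=
  if h : (∃ α, IsSharp P x α v) ∧ ∃ β, IsSharp P x β w then
    P x (Classical.choose h.1) (Classical.choose h.2)
  else 0

/-- Half of the dimension of the symplectic leaf through `x`, that is, half of the rank of `Π`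
at `x`. -/
def leafHalfDim (P : ∀ x : M, Cotangent E x →ₗ[ℝ] Cotangent E x →ₗ[ℝ] ℝ) (x : M) : ℕ :=
  Module.finrank ℝ (LinearMap.range (P x)) / 2

end Poisson

/-- The value of the `r`-fold wedge power `b ∧ ⋯ ∧ b` of a 2-form `b` on `2r` vectors. -/
def wedgePow {V : Type*} (r : ℕ) (b : V → V → ℝ) (v : Fin (2 * r) → V) : ℝ :=
  (1 / 2 ^ r : ℝ) * ∑ σ : Equiv.Perm (Fin (2 * r)), ((Equiv.Perm.sign σ : ℤ) : ℝ) *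
    ∏ i : Fin r, b (v (σ ⟨2 * i, by omega⟩)) (v (σ ⟨2 * i + 1, by omega⟩))

/-- `φ` is an injective smooth immersion of `U ⊆ ℝᵏ` into `X`. -/
structure IsParametrization {H X : Type*} [NormedAddCommGroup H] [NormedSpace ℝ H]
    [TopologicalSpace X] [ChartedSpace H X] {k : ℕ}
    (U : Set (EuclideanSpace ℝ (Fin k))) (φ : EuclideanSpace ℝ (Fin k) → X) : Prop where
  isOpen : IsOpen U
  smooth : ContMDiffOn 𝓘(ℝ, EuclideanSpace ℝ (Fin k)) 𝓘(ℝ, H) ∞ φ U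
  injOn : InjOn φ U
  immersion : ∀ u ∈ U,
    Function.Injective (mfderiv 𝓘(ℝ, EuclideanSpace ℝ (Fin k)) 𝓘(ℝ, H) φ u)

/-- `μ` is given by a smooth positive density on the `k`-dimensional submanifold `S` of `X`:
it is concentrated on `S`, and in each local parametrization of `S` it has a smooth positive
density with respect to Lebesgue measure. -/
structure IsSmoothMeasureOn (H : Type*) {X : Type*} [NormedAddCommGroup H] [NormedSpace ℝ H]
    [TopologicalSpace X] [ChartedSpace H X] [MeasurableSpace X]
    (k : ℕ) (S : Set X) (μ : Measure X) : Prop where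
  concentrated : μ Sᶜ = 0
  density : ∀ (U : Set (EuclideanSpace ℝ (Fin k))) (φ : EuclideanSpace ℝ (Fin k) → X),
    IsParametrization (H := H) U φ → MapsTo φ U S →
    ∃ ρ : EuclideanSpace ℝ (Fin k) → ℝ, ContDiffOn ℝ ∞ ρ U ∧ (∀ u ∈ U, 0 < ρ u) ∧
      ∀ A ⊆ U, MeasurableSet A → μ (φ '' A) = ∫⁻ u in A, ENNReal.ofReal (ρ u)

namespace LieGroupoid

variable {E F G M : Type*}
  [NormedAddCommGroup E] [NormedSpace ℝ E] [NormedAddCommGroup F] [NormedSpace ℝ F]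
  [TopologicalSpace M] [ChartedSpace E M] [TopologicalSpace G] [ChartedSpace F G]

section Structure

variable (Γ : LieGroupoid E F G M)

/-- `m^*Ω = pr₁^*Ω + pr₂^*Ω` on the manifold of composable pairs, whose tangent vectors at
`(g, h)` are the pairs `(v, w)` with `ds(v) = dt(w)`. -/
def IsMultiplicative (Ω : ∀ g : G, TangentSpace 𝓘(ℝ, F) g [⋀^Fin 2]→L[ℝ] ℝ) : Prop :=
  ∀ (g h : G), Γ.src g = Γ.tgt h →
  ∀ (v v' : TangentSpace 𝓘(ℝ, F) g) (w w' : TangentSpace 𝓘(ℝ, F) h),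
    (mfderiv 𝓘(ℝ, F) 𝓘(ℝ, E) Γ.src g v : E) = mfderiv 𝓘(ℝ, F) 𝓘(ℝ, E) Γ.tgt h w →
    (mfderiv 𝓘(ℝ, F) 𝓘(ℝ, E) Γ.src g v' : E) = mfderiv 𝓘(ℝ, F) 𝓘(ℝ, E) Γ.tgt h w' →
    let D : F × F →L[ℝ] F := mfderivWithin (𝓘(ℝ, F).prod 𝓘(ℝ, F)) 𝓘(ℝ, F)
      (fun p : G × G => Γ.mul p.1 p.2) {p | Γ.src p.1 = Γ.tgt p.2} (g, h)
    Ω (Γ.mul g h) ![D (v, w), D (v', w')] = Ω g ![v, v'] + Ω h ![w, w']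

/-- The target map is a Poisson map from `(G, Ω)` to `(M, Π)`: if `v`, `w` are the vectors with
`Ω(v, ·) = t^*α` and `Ω(w, ·) = t^*β`, then `Π(α, β) = Ω(v, w)`. -/
def TargetIsPoisson (Ω : ∀ g : G, TangentSpace 𝓘(ℝ, F) g [⋀^Fin 2]→L[ℝ] ℝ)
    (P : ∀ x : M, Cotangent E x →ₗ[ℝ] Cotangent E x →ₗ[ℝ] ℝ) : Prop :=
  ∀ (g : G) (α β : Cotangent E (Γ.tgt g)) (v w : TangentSpace 𝓘(ℝ, F) g),
    (∀ z, Ω g ![v, z] = α (mfderiv 𝓘(ℝ, F) 𝓘(ℝ, E) Γ.tgt g z)) →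
    (∀ z, Ω g ![w, z] = β (mfderiv 𝓘(ℝ, F) 𝓘(ℝ, E) Γ.tgt g z)) →
    P (Γ.tgt g) α β = Ω g ![v, w]

/-- `(Γ, Ω)` is a symplectic groupoid over the Poisson manifold `(M, Π)`. -/
structure IsSymplecticGroupoid (Ω : ∀ g : G, TangentSpace 𝓘(ℝ, F) g [⋀^Fin 2]→L[ℝ] ℝ)
    (P : ∀ x : M, Cotangent E x →ₗ[ℝ] Cotangent E x →ₗ[ℝ] ℝ) : Prop where
  isPoisson : IsPoisson P
  isSymplectic : IsSymplectic Ω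
  isMultiplicative : Γ.IsMultiplicative Ω
  targetIsPoisson : Γ.TargetIsPoisson Ω P

/-- The isotropy group of `x`. -/
def Isotropy (x : M) : Type _ := {g : G // Γ.src g = x ∧ Γ.tgt g = x}

instance (x : M) : TopologicalSpace (Γ.Isotropy x) :=
  inferInstanceAs (TopologicalSpace {g : G // Γ.src g = x ∧ Γ.tgt g = x})

instance [MeasurableSpace G] (x : M) : MeasurableSpace (Γ.Isotropy x) :=
  inferInstanceAs (MeasurableSpace {g : G // Γ.src g = x ∧ Γ.tgt g = x})

instance [MeasurableSpace G] [BorelSpace G] (x : M) : BorelSpace (Γ.Isotropy x) :=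
  inferInstanceAs (BorelSpace {g : G // Γ.src g = x ∧ Γ.tgt g = x})

instance (x : M) : Group (Γ.Isotropy x) where
  mul a b := ⟨Γ.mul a.1 b.1, by
    have h : Γ.src a.1 = Γ.tgt b.1 := a.2.1.trans b.2.2.symm
    exact ⟨(Γ.src_mul _ _ h).trans b.2.1, (Γ.tgt_mul _ _ h).trans a.2.2⟩⟩
  one := ⟨Γ.unit x, Γ.src_unit x, Γ.tgt_unit x⟩
  inv a := ⟨Γ.inv a.1, (Γ.src_inv _).trans a.2.2, (Γ.tgt_inv _).trans a.2.1⟩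
  mul_assoc a b c := Subtype.ext
    (Γ.mul_assoc _ _ _ (a.2.1.trans b.2.2.symm) (b.2.1.trans c.2.2.symm))
  one_mul a := Subtype.ext (by
    have h := Γ.unit_mul a.1
    rw [a.2.2] at h
    exact h)
  mul_one a := Subtype.ext (by
    have h := Γ.mul_unit a.1
    rw [a.2.1] at h
    exact h)
  inv_mul_cancel a := Subtype.ext (by
    have h := Γ.inv_mul a.1
    rw [a.2.1] at h
    exact h)

instance (x : M) : IsTopologicalGroup (Γ.Isotropy x) where
  continuous_mul := by
    refine Continuous.subtype_mk ?_ _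
    exact Γ.contMDiffOn_mul.continuousOn.comp_continuous
      (f := fun p : Γ.Isotropy x × Γ.Isotropy x => ((p.1.1, p.2.1) : G × G))
      ((continuous_subtype_val.comp continuous_fst).prodMk
        (continuous_subtype_val.comp continuous_snd))
      (fun p => p.1.2.1.trans p.2.2.2.symm)
  continuous_inv := by
    refine Continuous.subtype_mk ?_ _
    exact Γ.contMDiff_inv.continuous.comp continuous_subtype_val

/-- The normalized Haar measure of a compact isotropy group. -/
def normalizedHaar [MeasurableSpace G] [BorelSpace G] (x : M) [CompactSpace (Γ.Isotropy x)] :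
    Measure (Γ.Isotropy x) :=
  Measure.haarMeasure ⊤

end Structure

section Measures

variable (Γ : LieGroupoid E F G M) [MeasurableSpace G]

/-- A right Haar measure on the groupoid: a smooth positive measure `μ x` on each source fiber
`s⁻¹(x)`, such that right translation by `g`, which maps `s⁻¹(t g)` onto `s⁻¹(s g)`, takes
`μ (t g)` to `μ (s g)`, and such that `μ x` depends smoothly on `x` along each orbit: for test
functions `f`, the function `x ↦ ∫ f dμ x` on the orbit of `m` is smooth, i.e. its pullback
under the submersion `t` from `s⁻¹(m)` onto this orbit is. -/
structure IsRightHaar (μ : M → Measure G) : Prop where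
  smoothMeasure : ∀ x, IsSmoothMeasureOn F (Module.finrank ℝ F - Module.finrank ℝ E)
    (Γ.src ⁻¹' {x}) (μ x)
  invariant : ∀ (g : G) (A : Set G), MeasurableSet A →
    μ (Γ.tgt g) {h | Γ.src h = Γ.tgt g ∧ Γ.mul h g ∈ A} = μ (Γ.src g) A
  smoothAlongOrbits : ∀ f : G → ℝ, ContMDiff 𝓘(ℝ, F) 𝓘(ℝ, ℝ) ∞ f → HasCompactSupport f →
    ∀ m : M, ContMDiffOn 𝓘(ℝ, F) 𝓘(ℝ, ℝ) ∞ (fun g => ∫ h, f h ∂(μ (Γ.tgt g)))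
      (Γ.src ⁻¹' {m})

/-- A left Haar measure on the groupoid: as for `IsRightHaar`, with target fibers and left
translations. -/
structure IsLeftHaar (μ : M → Measure G) : Prop where
  smoothMeasure : ∀ x, IsSmoothMeasureOn F (Module.finrank ℝ F - Module.finrank ℝ E)
    (Γ.tgt ⁻¹' {x}) (μ x)
  invariant : ∀ (g : G) (A : Set G), MeasurableSet A →
    μ (Γ.src g) {h | Γ.tgt h = Γ.src g ∧ Γ.mul g h ∈ A} = μ (Γ.tgt g) A
  smoothAlongOrbits : ∀ f : G → ℝ, ContMDiff 𝓘(ℝ, F) 𝓘(ℝ, ℝ) ∞ f → HasCompactSupport f →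
    ∀ m : M, ContMDiffOn 𝓘(ℝ, F) 𝓘(ℝ, ℝ) ∞ (fun g => ∫ h, f h ∂(μ (Γ.src g)))
      (Γ.tgt ⁻¹' {m})

/-- `lam` is the measure defined by the symplectic volume `|ω_L^r|` on the orbit
`t(s⁻¹(m))` of `m`, whose connected components are symplectic leaves of dimension `2r`. The smooth
structure of the orbit is the one for which `t : s⁻¹(m) → t(s⁻¹(m))` is a submersion: its local
parametrizations are the injective immersions `t ∘ σ` with `σ` a smooth map into `s⁻¹(m)`. -/
structure IsLeafVolume [MeasurableSpace M]
    (P : ∀ x : M, Cotangent E x →ₗ[ℝ] Cotangent E x →ₗ[ℝ] ℝ) (m : M) (lam : Measure M) :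
    Prop where
  concentrated : lam (Γ.tgt '' (Γ.src ⁻¹' {m}))ᶜ = 0
  volume : ∀ (U : Set (EuclideanSpace ℝ (Fin (2 * leafHalfDim P m))))
    (σ : EuclideanSpace ℝ (Fin (2 * leafHalfDim P m)) → G),
    ContMDiffOn 𝓘(ℝ, EuclideanSpace ℝ (Fin (2 * leafHalfDim P m))) 𝓘(ℝ, F) ∞ σ U →
    MapsTo σ U (Γ.src ⁻¹' {m}) → IsParametrization (H := E) U (Γ.tgt ∘ σ) →
    ∀ A ⊆ U, MeasurableSet A → lam ((Γ.tgt ∘ σ) '' A) =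
      ∫⁻ u in A, ENNReal.ofReal |wedgePow (leafHalfDim P m) (leafForm P (Γ.tgt (σ u)))
        (fun i => mfderiv 𝓘(ℝ, EuclideanSpace ℝ (Fin (2 * leafHalfDim P m))) 𝓘(ℝ, E)
          (Γ.tgt ∘ σ) u (EuclideanSpace.single i (1 : ℝ)))|

variable [BorelSpace G] [MeasurableSpace M] [∀ x, CompactSpace (Γ.Isotropy x)]

/-- The measure `μ m` on `s⁻¹(m)` is, for each `m`, assembled from the symplectic volume of the
orbit of `m` and the normalized Haar measures: for `g ∈ s⁻¹(m)`, the fiber of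
`t : s⁻¹(m) → M` over `x = t g` carries the measure `κ x` which is the image of the normalized Haar
measure of the isotropy group of `x` under `k ↦ k g`, whichever `g` in the fiber is used. -/
def IsRightAssembled (P : ∀ x : M, Cotangent E x →ₗ[ℝ] Cotangent E x →ₗ[ℝ] ℝ)
    (μ : M → Measure G) : Prop :=
  ∀ m : M, ∃ (lam : Measure M) (κ : M → Measure G), Γ.IsLeafVolume P m lam ∧
    (∀ g : G, Γ.src g = m →
      κ (Γ.tgt g) = (Γ.normalizedHaar (Γ.tgt g)).map (fun k => Γ.mul k.1 g)) ∧
    ∀ A : Set G, MeasurableSet A →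
      AEMeasurable (fun x => κ x A) lam ∧ μ m A = ∫⁻ x, κ x A ∂lam

/-- The analogue of `IsRightAssembled` for target fibers: the fiber of `s : t⁻¹(m) → M` over
`x = s g` carries the image of the normalized Haar measure of the isotropy group of `x` under
`k ↦ g k`. -/
def IsLeftAssembled (P : ∀ x : M, Cotangent E x →ₗ[ℝ] Cotangent E x →ₗ[ℝ] ℝ)
    (μ : M → Measure G) : Prop :=
  ∀ m : M, ∃ (lam : Measure M) (κ : M → Measure G), Γ.IsLeafVolume P m lam ∧
    (∀ g : G, Γ.tgt g = m →
      κ (Γ.src g) = (Γ.normalizedHaar (Γ.src g)).map (fun k => Γ.mul g k.1)) ∧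
    ∀ A : Set G, MeasurableSet A →
      AEMeasurable (fun x => κ x A) lam ∧ μ m A = ∫⁻ x, κ x A ∂lam

end Measures

end LieGroupoid

end SymplecticGroupoid

end

/-! The target map t restricted to the source fiber of m is a principal bundle over the orbit of m,
with structure group the isotropy group of m acting on the right. The measure on the fiber is the
symplectic volume of the base combined with normalized Haar measure along the bundle fibers. The
proof shows that both ingredients are well defined, smooth and compatible with right translation.

Symplectic part. Multiplicativity of Ω applied to the factorization g = 1·g makes ker ds and ker dt
orthogonal (`twoFormBilin_kerTgt_kerSrc`). The units form an isotropic submanifold, so dim G = 2 dim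
M, and the two kernels are exactly each other's orthogonals (`orthogonal_kerTgt`,
`orthogonal_kerSrc`). As t is Poisson, it maps ker ds onto the tangent space of the leaf and pulls
the leaf form back to Ω (`IsSymplecticGroupoid.leafForm_apply`). Hence the leaf form, defined
pointwise by choice, has smooth and nondegenerate pullbacks, and its rank is even and constant along
orbits (`IsSymplecticGroupoid.leafHalfDim_tgt`).

Leaf volume. On a source fiber t has constant rank, so the constant rank theorem gives boxes in
which t forgets some of the coordinates (`IsSymplecticGroupoid.exists_leafBox`). From a box come
local sections over the orbit and a chart of the isotropy group. Densities in different sections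
differ by a Jacobian, so they glue to a unique measure (`exists_measure_of_compatible_densities`,
`measure_ext_of_parametrizations`). An orbit may be only immersed. It is therefore always
parametrized through the source fiber, and different sheets are compared by right translation with
an isotropy element (`OrbitSection.exists_nhds`).

Fiber measures. Since kg = g(g⁻¹kg) and conjugation preserves normalized Haar measure, the measure
over x is also the image of the Haar measure of the fixed group at m under k ↦ gk
(`map_normalizedHaar_tgt`). Left invariance gives independence of g (`map_normalizedHaar_congr`),
and a Borel section of t makes the family measurable in x
(`IsSymplecticGroupoid.exists_fiberMeasure`).

Haar properties. In the charts (a, v) ↦ sec(a)·k·c(v) the measure has the leaf density times the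
Haar density (`IsAssembledFrom.hasDensity`), hence it is smooth and positive. Right translation
preserves t, the orbit, its volume and the fiber measures, which gives invariance. Invariance turns
the integral of f against the measure at t(g) into an integral of f(hg⁻¹) over one fixed fiber, so
smoothness along orbits is differentiation under the integral sign (`contMDiffOn_integral_tgt`).
Inversion exchanges source and target and yields the left-handed half. -/

noncomputable section

namespace SymplecticGroupoid

/-! ### Derivatives between manifolds, read in the model spaces -/

section ModelDeriv

variable {E F H X Y : Type*} [NormedAddCommGroup E] [NormedSpace ℝ E]
  [NormedAddCommGroup F] [NormedSpace ℝ F] [NormedAddCommGroup H] [NormedSpace ℝ H]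
  [TopologicalSpace X] [ChartedSpace F X] [TopologicalSpace Y] [ChartedSpace E Y]

/-- The derivative of a map between manifolds, as a linear map between the model spaces. -/
def modelDeriv (F E : Type*) {X Y : Type*} [NormedAddCommGroup E] [NormedSpace ℝ E]
    [NormedAddCommGroup F] [NormedSpace ℝ F]
    [TopologicalSpace X] [ChartedSpace F X] [TopologicalSpace Y] [ChartedSpace E Y]
    (f : X → Y) (x : X) : F →L[ℝ] E :=
  mfderiv 𝓘(ℝ, F) 𝓘(ℝ, E) f x

theorem hasMFDerivAt_modelDeriv {f : X → Y} {x : X}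
    (h : MDifferentiableAt 𝓘(ℝ, F) 𝓘(ℝ, E) f x) :
    HasMFDerivAt 𝓘(ℝ, F) 𝓘(ℝ, E) f x (modelDeriv F E f x) :=
  h.hasMFDerivAt

theorem modelDeriv_eq_of_hasMFDerivAt {f : X → Y} {x : X} {L : F →L[ℝ] E}
    (h : HasMFDerivAt 𝓘(ℝ, F) 𝓘(ℝ, E) f x L) : modelDeriv F E f x = L :=
  h.mfderiv

theorem modelDeriv_eq_fderiv (f : F → E) (x : F) : modelDeriv F E f x = fderiv ℝ f x :=
  mfderiv_eq_fderiv

theorem modelDeriv_comp {Z : Type*} [TopologicalSpace Z] [ChartedSpace H Z] {f : X → Y} {g : Z → X}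
    {z : Z} (hf : MDifferentiableAt 𝓘(ℝ, F) 𝓘(ℝ, E) f (g z))
    (hg : MDifferentiableAt 𝓘(ℝ, H) 𝓘(ℝ, F) g z) :
    modelDeriv H E (f ∘ g) z = (modelDeriv F E f (g z)).comp (modelDeriv H F g z) :=
  mfderiv_comp z hf hg

theorem modelDeriv_congr {f g : X → Y} {x : X} (h : f =ᶠ[𝓝 x] g) :
    modelDeriv F E f x = modelDeriv F E g x :=
  h.mfderiv_eq

theorem modelDeriv_of_eqOn_id {f : X → X} {x : X} {s : Set X} (hs : IsOpen s) (hx : x ∈ s)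
    (h : ∀ y ∈ s, f y = y) : modelDeriv F F f x = ContinuousLinearMap.id ℝ F := by
  rw [modelDeriv_congr (g := id) (Filter.eventuallyEq_of_mem (hs.mem_nhds hx) h)]
  exact modelDeriv_eq_of_hasMFDerivAt (hasMFDerivAt_id x)

theorem modelDeriv_of_eqOn_const {f : X → Y} {x : X} {y : Y} {s : Set X} (hs : IsOpen s)
    (hx : x ∈ s) (h : ∀ z ∈ s, f z = y) : modelDeriv F E f x = 0 := by
  rw [modelDeriv_congr (g := fun _ => y) (Filter.eventuallyEq_of_mem (hs.mem_nhds hx) h)]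
  exact modelDeriv_eq_of_hasMFDerivAt (hasMFDerivAt_const y x)

theorem mdifferentiableAt_of_contMDiffOn {f : X → Y} {x : X} {s : Set X} (hs : IsOpen s)
    (hx : x ∈ s) (h : ContMDiffOn 𝓘(ℝ, F) 𝓘(ℝ, E) ∞ f s) :
    MDifferentiableAt 𝓘(ℝ, F) 𝓘(ℝ, E) f x :=
  ((h x hx).contMDiffAt (hs.mem_nhds hx)).mdifferentiableAt (by simp)

end ModelDeriv

/-! ### Charts of subsets of a manifold -/

/-- A local chart, with values in `H`, of the subset `S` of the manifold `X`. -/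
structure SliceChart (F H : Type*) {X : Type*} [NormedAddCommGroup F] [NormedSpace ℝ F]
    [NormedAddCommGroup H] [NormedSpace ℝ H] [TopologicalSpace X] [ChartedSpace F X]
    (S : Set X) where
  dom : Set H
  map : H → X
  nhd : Set X
  coord : X → H
  isOpen_dom : IsOpen dom
  isOpen_nhd : IsOpen nhd
  smooth_map : ContMDiffOn 𝓘(ℝ, H) 𝓘(ℝ, F) ∞ map dom
  smooth_coord : ContMDiffOn 𝓘(ℝ, F) 𝓘(ℝ, H) ∞ coord (S ∩ nhd)
  mapsTo_map : MapsTo map dom (S ∩ nhd)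
  mapsTo_coord : MapsTo coord (S ∩ nhd) dom
  coord_map : ∀ w ∈ dom, coord (map w) = w
  map_coord : ∀ g ∈ S ∩ nhd, map (coord g) = g

namespace SliceChart

variable {F H H' X : Type*} [NormedAddCommGroup F] [NormedSpace ℝ F]
  [NormedAddCommGroup H] [NormedSpace ℝ H] [NormedAddCommGroup H'] [NormedSpace ℝ H']
  [TopologicalSpace X] [ChartedSpace F X] {S : Set X}

/-- Composition of a chart with a change of coordinates. -/
def trans (c : SliceChart F H S) (e : OpenPartialHomeomorph H H') (hs : e.source ⊆ c.dom)
    (he : ContDiffOn ℝ ∞ e e.source) (hes : ContDiffOn ℝ ∞ e.symm e.target) (N : Set X)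
    (hN : IsOpen N) (h : ∀ g ∈ S ∩ c.nhd, g ∈ N ↔ c.coord g ∈ e.source) : SliceChart F H' S where
  dom := e.target
  map := c.map ∘ e.symm
  nhd := c.nhd ∩ N
  coord := e ∘ c.coord
  isOpen_dom := e.open_target
  isOpen_nhd := c.isOpen_nhd.inter hN
  smooth_map := (c.smooth_map.mono hs).comp hes.contMDiffOn (fun _ hw => e.map_target hw)
  smooth_coord := he.contMDiffOn.comp (c.smooth_coord.mono (by tauto_set))
    (fun g hg => (h g ⟨hg.1, hg.2.1⟩).1 hg.2.2)
  mapsTo_map := fun w hw => by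
    have h1 := e.map_target hw
    have := c.mapsTo_map (hs h1)
    refine ⟨this.1, this.2, (h _ this).2 ?_⟩
    rw [c.coord_map _ (hs h1)]; exact h1
  mapsTo_coord := fun g hg => e.map_source ((h g ⟨hg.1, hg.2.1⟩).1 hg.2.2)
  coord_map := fun w hw => by
    simp only [Function.comp]
    rw [c.coord_map _ (hs (e.map_target hw)), e.right_inv hw]
  map_coord := fun g hg => by
    simp only [Function.comp]
    rw [e.left_inv ((h g ⟨hg.1, hg.2.1⟩).1 hg.2.2), c.map_coord g ⟨hg.1, hg.2.1⟩]

/-- Change of the model space of a chart by a linear equivalence. -/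
def congr (c : SliceChart F H S) (e : H' ≃L[ℝ] H) : SliceChart F H' S where
  dom := e ⁻¹' c.dom
  map := c.map ∘ e
  nhd := c.nhd
  coord := e.symm ∘ c.coord
  isOpen_dom := c.isOpen_dom.preimage e.continuous
  isOpen_nhd := c.isOpen_nhd
  smooth_map := c.smooth_map.comp e.contDiff.contMDiff.contMDiffOn (fun _ h => h)
  smooth_coord := e.symm.contDiff.contMDiff.comp_contMDiffOn c.smooth_coord
  mapsTo_map := fun _ hw => c.mapsTo_map hw
  mapsTo_coord := fun g hg => by simpa using c.mapsTo_coord hg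
  coord_map := fun w hw => by simp [c.coord_map _ hw]
  map_coord := fun g hg => by simp [c.map_coord g hg]

theorem injOn_map (c : SliceChart F H S) : InjOn c.map c.dom := fun a ha b hb h => by
  rw [← c.coord_map a ha, h, c.coord_map b hb]

theorem mdifferentiableAt_map (c : SliceChart F H S) {w : H} (hw : w ∈ c.dom) :
    MDifferentiableAt 𝓘(ℝ, H) 𝓘(ℝ, F) c.map w :=
  ((c.smooth_map w hw).contMDiffAt (c.isOpen_dom.mem_nhds hw)).mdifferentiableAt (by simp)

/-- The chain rule for `coord ∘ map = id`. As `coord` is smooth only along `S`, its derivative has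
to be taken within `S ∩ nhd`. -/
theorem exists_leftInverse_modelDeriv (c : SliceChart F H S) {w : H} (hw : w ∈ c.dom) :
    ∃ Q : F →L[ℝ] H, ∀ v : H, Q (modelDeriv H F c.map w v) = v := by
  have h1 : HasMFDerivWithinAt 𝓘(ℝ, F) 𝓘(ℝ, H) c.coord (S ∩ c.nhd) (c.map w)
      (mfderivWithin 𝓘(ℝ, F) 𝓘(ℝ, H) c.coord (S ∩ c.nhd) (c.map w) : F →L[ℝ] H) :=
    ((c.smooth_coord (c.map w) (c.mapsTo_map hw)).mdifferentiableWithinAt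
    (by simp)).hasMFDerivWithinAt
  have h2 := (hasMFDerivAt_modelDeriv (c.mdifferentiableAt_map hw)).hasMFDerivWithinAt (s := c.dom)
  have h3 := HasMFDerivWithinAt.comp w h1 h2 c.mapsTo_map
  have h4 := modelDeriv_eq_of_hasMFDerivAt (h3.hasMFDerivAt (c.isOpen_dom.mem_nhds hw))
  rw [modelDeriv_of_eqOn_id (f := c.coord ∘ c.map) c.isOpen_dom hw c.coord_map] at h4
  exact ⟨_, fun v => (DFunLike.congr_fun h4 v).symm⟩

theorem injective_modelDeriv_map (c : SliceChart F H S) {w : H} (hw : w ∈ c.dom) :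
    Function.Injective (modelDeriv H F c.map w) := by
  obtain ⟨Q, hQ⟩ := c.exists_leftInverse_modelDeriv hw
  exact Function.LeftInverse.injective (g := Q) hQ

omit [NormedSpace ℝ H'] in
theorem isOpen_preimage_nhd (c : SliceChart F H S) {U : Set H'} {φ : H' → X} (hU : IsOpen U)
    (hφ : ContinuousOn φ U) : IsOpen (U ∩ φ ⁻¹' c.nhd) :=
  hφ.isOpen_inter_preimage hU c.isOpen_nhd

theorem contDiffOn_coord_comp (c : SliceChart F H S) {U : Set H'} {φ : H' → X}
    (hφ : ContMDiffOn 𝓘(ℝ, H') 𝓘(ℝ, F) ∞ φ U) (hS : MapsTo φ U S) :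
    ContDiffOn ℝ ∞ (c.coord ∘ φ) (U ∩ φ ⁻¹' c.nhd) := by
  rw [← contMDiffOn_iff_contDiffOn]
  exact c.smooth_coord.comp (hφ.mono inter_subset_left) (fun u hu => ⟨hS hu.1, hu.2⟩)

end SliceChart

/-! ### Submersions, their sections and fibers, and maps of constant rank -/

section Submersion

variable {E F G M : Type*}
  [NormedAddCommGroup E] [NormedSpace ℝ E] [NormedAddCommGroup F] [NormedSpace ℝ F]
  [TopologicalSpace M] [ChartedSpace E M] [TopologicalSpace G] [ChartedSpace F G]
  {f : G → M} (hf : Manifold.IsSubmersion 𝓘(ℝ, F) 𝓘(ℝ, E) ∞ f)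
include hf

/-- In charts where the map is a linear projection, a section is obtained by freezing the
complementary coordinate at its value at `g₀`. -/
theorem exists_local_section_of_isSubmersion (g₀ : G) :
    ∃ (V : Set M) (s : M → G), IsOpen V ∧ f g₀ ∈ V ∧ ContMDiffOn 𝓘(ℝ, E) 𝓘(ℝ, F) ∞ s V ∧
      s (f g₀) = g₀ ∧ ∀ x ∈ V, f (s x) = x := by
  have h := hf.isSubmersionAt g₀
  set φ := h.domChart with hφ'
  set ψ := h.codChart with hψ'
  have hφ := h.domChart_mem_maximalAtlas
  have hψ := h.codChart_mem_maximalAtlas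
  have key : ∀ y ∈ φ.target, ψ (f (φ.symm y)) = (h.equiv y).1 := fun y hy => by
    have h1 := h.writtenInCharts
    simp only [mfld_simps] at h1
    exact h1 hy
  set j : M → F := fun x => h.equiv.symm (ψ x, (h.equiv (φ g₀)).2) with hj
  have hjsm : ContMDiffOn 𝓘(ℝ, E) 𝓘(ℝ, F) ∞ j ψ.source := by
    have h1 : ContDiff ℝ ∞ (fun e : E => h.equiv.symm (e, (h.equiv (φ g₀)).2)) := by fun_prop
    exact h1.contMDiff.comp_contMDiffOn (contMDiffOn_of_mem_maximalAtlas hψ)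
  have hj0 : j (f g₀) = φ g₀ := by
    rw [hj]
    have := key (φ g₀) (φ.map_source h.mem_domChart_source)
    rw [φ.left_inv h.mem_domChart_source] at this
    simp only [this]
    exact h.equiv.symm_apply_apply _
  refine ⟨ψ.source ∩ j ⁻¹' φ.target, φ.symm ∘ j,
    hjsm.continuousOn.isOpen_inter_preimage ψ.open_source φ.open_target,
    ⟨h.mem_codChart_source, by rw [mem_preimage, hj0]; exact φ.map_source h.mem_domChart_source⟩,
    (contMDiffOn_symm_of_mem_maximalAtlas hφ).comp (hjsm.mono inter_subset_left)
      (fun x hx => hx.2), ?_, ?_⟩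
  · rw [Function.comp_apply, hj0]; exact φ.left_inv h.mem_domChart_source
  · intro x hx
    refine ψ.injOn (h.source_subset_preimage_source (φ.map_target hx.2)) hx.1 ?_
    have := key _ hx.2
    change ψ (f (φ.symm (j x))) = ψ x
    rw [this]; simp [hj]

theorem mdifferentiableAt_of_isSubmersion (g : G) :
    MDifferentiableAt 𝓘(ℝ, F) 𝓘(ℝ, E) f g :=
  hf.contMDiff.mdifferentiable (by simp) _

theorem surjective_modelDeriv_of_isSubmersion (g : G) :
    Function.Surjective (modelDeriv F E f g) := by
  obtain ⟨V, s, hV, hgV, hs, hsg, hfs⟩ := exists_local_section_of_isSubmersion hf g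
  have h3 := modelDeriv_comp (mdifferentiableAt_of_isSubmersion hf _)
    (mdifferentiableAt_of_contMDiffOn hV hgV hs)
  rw [modelDeriv_of_eqOn_id (f := f ∘ s) hV hgV hfs, hsg] at h3
  exact fun v => ⟨_, (DFunLike.congr_fun h3 v).symm⟩

/-- In the normal form of a submersion the fiber is the slice on which the first component is
constant; the complementary component is the coordinate. -/
theorem exists_sliceChart_of_isSubmersion [FiniteDimensional ℝ E] [FiniteDimensional ℝ F] (g₀ : G) :
    ∃ c : SliceChart F (EuclideanSpace ℝ (Fin (Module.finrank ℝ F - Module.finrank ℝ E)))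
      (f ⁻¹' {f g₀}), g₀ ∈ c.nhd := by
  have h := hf.isSubmersionAt g₀
  set φ := h.domChart with hφ'
  set ψ := h.codChart with hψ'
  have hφ := h.domChart_mem_maximalAtlas
  have hψ := h.codChart_mem_maximalAtlas
  have key : ∀ y ∈ φ.target, ψ (f (φ.symm y)) = (h.equiv y).1 := fun y hy => by
    have h1 := h.writtenInCharts
    simp only [mfld_simps] at h1
    exact h1 hy
  have key' : ∀ g ∈ φ.source, (h.equiv (φ g)).1 = ψ (f g) := fun g hg => by
    rw [← key _ (φ.map_source hg), φ.left_inv hg]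
  have : FiniteDimensional ℝ (E × h.complement) :=
    LinearEquiv.finiteDimensional h.equiv.toLinearEquiv
  have : FiniteDimensional ℝ h.complement :=
    FiniteDimensional.of_surjective (LinearMap.snd ℝ E h.complement) LinearMap.snd_surjective
  have hdim : Module.finrank ℝ (EuclideanSpace ℝ (Fin (Module.finrank ℝ F - Module.finrank ℝ E)))
      = Module.finrank ℝ h.complement := by
    have := h.equiv.toLinearEquiv.finrank_eq
    rw [Module.finrank_prod] at this
    simp; omega
  set j : h.complement → F := fun c => h.equiv.symm (ψ (f g₀), c) with hj
  have hjs : ContDiff ℝ ∞ j := by fun_prop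
  let c : SliceChart F h.complement (f ⁻¹' {f g₀}) :=
    { dom := j ⁻¹' φ.target
      map := φ.symm ∘ j
      nhd := φ.source
      coord := fun g => (h.equiv (φ g)).2
      isOpen_dom := φ.open_target.preimage hjs.continuous
      isOpen_nhd := φ.open_source
      smooth_map := (contMDiffOn_symm_of_mem_maximalAtlas hφ).comp hjs.contMDiff.contMDiffOn
        (fun _ h => h)
      smooth_coord := by
        have h1 : ContDiff ℝ ∞ (fun e : F => (h.equiv e).2) := by fun_prop
        exact (h1.contMDiff.comp_contMDiffOn (contMDiffOn_of_mem_maximalAtlas hφ)).mono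
          inter_subset_right
      mapsTo_map := fun w hw => by
        have hs := φ.map_target hw
        refine ⟨ψ.injOn (h.source_subset_preimage_source hs) h.mem_codChart_source ?_, hs⟩
        rw [key _ hw]; simp [hj]
      mapsTo_coord := fun g hg => by
        have h1 := key' g hg.2
        have h2 : f g = f g₀ := hg.1
        rw [h2] at h1
        simp only [mem_preimage, hj]
        rw [← h1]
        simpa using φ.map_source hg.2
      coord_map := fun w hw => by
        change (h.equiv (φ (φ.symm (j w)))).2 = w
        rw [φ.right_inv hw]; simp [hj]
      map_coord := fun g hg => by
        have h1 := key' g hg.2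
        have h2 : f g = f g₀ := hg.1
        rw [h2] at h1
        change φ.symm (h.equiv.symm (ψ (f g₀), (h.equiv (φ g)).2)) = g
        rw [← h1]
        simpa using φ.left_inv hg.2 }
  exact ⟨c.congr (ContinuousLinearEquiv.ofFinrankEq hdim), h.mem_domChart_source⟩

theorem finrank_ker_of_isSubmersion [FiniteDimensional ℝ F] (g : G) :
    Module.finrank ℝ (LinearMap.ker (modelDeriv F E f g).toLinearMap)
      + Module.finrank ℝ E = Module.finrank ℝ F := by
  have h1 := LinearMap.finrank_range_add_finrank_ker (modelDeriv F E f g).toLinearMap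
  have h2 : LinearMap.range (modelDeriv F E f g).toLinearMap = ⊤ :=
    LinearMap.range_eq_top.2 (surjective_modelDeriv_of_isSubmersion hf g)
  rw [h2, finrank_top] at h1
  omega

theorem modelDeriv_apply_of_mapsTo_fiber {H : Type*} [NormedAddCommGroup H] [NormedSpace ℝ H]
    {m : M}
    {U : Set H} (hU : IsOpen U) {φ : H → G} (hφ : ContMDiffOn 𝓘(ℝ, H) 𝓘(ℝ, F) ∞ φ U)
    (hm : MapsTo φ U (f ⁻¹' {m})) {w : H} (hw : w ∈ U) (v : H) :
    modelDeriv F E f (φ w) (modelDeriv H F φ w v) = 0 := by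
  have h3 := modelDeriv_comp (mdifferentiableAt_of_isSubmersion hf _)
    (mdifferentiableAt_of_contMDiffOn hU hw hφ)
  rw [modelDeriv_of_eqOn_const (f := f ∘ φ) hU hw hm] at h3
  exact (DFunLike.congr_fun h3 v).symm

/-- A chart of a fiber has velocities in the kernel because the map is constant on the fiber;
equality is a dimension count. -/
theorem SliceChart.range_modelDeriv_map [FiniteDimensional ℝ F] {H : Type*}
    [NormedAddCommGroup H] [NormedSpace ℝ H] {m : M}
    (hH : Module.finrank ℝ H = Module.finrank ℝ F - Module.finrank ℝ E)
    (c : SliceChart F H (f ⁻¹' {m})) {w : H} (hw : w ∈ c.dom) :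
    LinearMap.range (modelDeriv H F c.map w).toLinearMap =
      LinearMap.ker (modelDeriv F E f (c.map w)).toLinearMap := by
  refine Submodule.eq_of_le_of_finrank_eq ?_ ?_
  · rintro _ ⟨v, rfl⟩
    exact modelDeriv_apply_of_mapsTo_fiber hf c.isOpen_dom c.smooth_map
      (fun w hw => (c.mapsTo_map hw).1) hw v
  · rw [LinearMap.finrank_range_of_inj (c.injective_modelDeriv_map hw), hH]
    have := finrank_ker_of_isSubmersion hf (c.map w)
    omega

end Submersion

/-- The constant rank theorem: near each point of its domain, a smooth map of constant rank depends
in suitable coordinates `(a, b)` only on `a`, and `a` is a linear function of its value. -/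
theorem exists_coordinates_of_constant_rank {E H : Type*}
    [NormedAddCommGroup E] [NormedSpace ℝ E] [FiniteDimensional ℝ E]
    [NormedAddCommGroup H] [NormedSpace ℝ H] [FiniteDimensional ℝ H]
    {W : Set H} (hW : IsOpen W) {w₀ : H} (hw₀ : w₀ ∈ W) {f : H → E} (hf : ContDiffOn ℝ ∞ f W)
    {ρ n : ℕ} (hn : Module.finrank ℝ H = ρ + n)
    (hρ : ∀ w ∈ W, Module.finrank ℝ (LinearMap.range (fderiv ℝ f w).toLinearMap) = ρ) :
    ∃ (p : E →L[ℝ] EuclideanSpace ℝ (Fin ρ))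
      (e : OpenPartialHomeomorph H
        (EuclideanSpace ℝ (Fin ρ) × EuclideanSpace ℝ (Fin (n))))
      (U₁ : Set (EuclideanSpace ℝ (Fin ρ)))
      (U₂ : Set (EuclideanSpace ℝ (Fin (n)))),
      IsOpen U₁ ∧ IsOpen U₂ ∧ e.source ⊆ W ∧ w₀ ∈ e.source ∧ e.target = U₁ ×ˢ U₂ ∧
      ContDiffOn ℝ ∞ e e.source ∧ ContDiffOn ℝ ∞ e.symm e.target ∧
      (∀ w ∈ e.source, (e w).1 = p (f w)) ∧
      ∀ a ∈ U₁, ∀ b ∈ U₂, ∀ b' ∈ U₂, f (e.symm (a, b)) = f (e.symm (a, b')) := by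
  set A := EuclideanSpace ℝ (Fin ρ)
  set B := EuclideanSpace ℝ (Fin (n))
  set L := (fderiv ℝ f w₀).toLinearMap with hL
  have hrk := LinearMap.finrank_range_add_finrank_ker L
  rw [hρ w₀ hw₀] at hrk
  obtain ⟨g, hg⟩ := (LinearMap.range L).subtype.exists_leftInverse_of_injective
    (Submodule.ker_subtype _)
  obtain ⟨k, hk⟩ := (LinearMap.ker L).subtype.exists_leftInverse_of_injective
    (Submodule.ker_subtype _)
  have φ : LinearMap.range L ≃ₗ[ℝ] A :=
    LinearEquiv.ofFinrankEq _ _ (by rw [hρ w₀ hw₀]; simp [A])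
  have ψ : LinearMap.ker L ≃ₗ[ℝ] B := LinearEquiv.ofFinrankEq _ _ (by simp [B]; omega)
  -- `p` projects onto the range of the derivative at `w₀` and `π` onto its kernel, so the pair (p ∘
  -- f, π) is a local diffeomorphism at `w₀`.
  set p : E →L[ℝ] A := (φ.toLinearMap ∘ₗ g).toContinuousLinearMap with hp
  set π : H →L[ℝ] B := (ψ.toLinearMap ∘ₗ k).toContinuousLinearMap with hπ
  set h : H → A × B := fun w => (p (f w), π w) with hh
  have hhs : ContDiffOn ℝ ∞ h W := (p.contDiff.comp_contDiffOn hf).prodMk π.contDiff.contDiffOn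
  have hfd : ∀ w ∈ W, HasFDerivAt f (fderiv ℝ f w) w := fun w hw =>
    ((hf.contDiffAt (hW.mem_nhds hw)).differentiableAt (by simp)).hasFDerivAt
  have hhd : ∀ w ∈ W, HasFDerivAt h ((p.comp (fderiv ℝ f w)).prod π) w := fun w hw =>
    (p.hasFDerivAt.comp w (hfd w hw)).prodMk π.hasFDerivAt
  have hinj : Function.Injective ((p.comp (fderiv ℝ f w₀)).prod π).toLinearMap := by
    rw [← LinearMap.ker_eq_bot, LinearMap.ker_eq_bot']
    intro v hv
    have hv1 : φ (g (L v)) = 0 := congrArg Prod.fst hv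
    have hv2 : ψ (k v) = 0 := congrArg Prod.snd hv
    have h1 : g (L v) = ⟨L v, LinearMap.mem_range_self L v⟩ :=
      LinearMap.congr_fun hg ⟨L v, LinearMap.mem_range_self L v⟩
    rw [LinearEquiv.map_eq_zero_iff, h1] at hv1
    have hLv : L v = 0 := congrArg Subtype.val hv1
    have h2 : k v = ⟨v, hLv⟩ := LinearMap.congr_fun hk ⟨v, hLv⟩
    rw [LinearEquiv.map_eq_zero_iff, h2] at hv2
    exact congrArg Subtype.val hv2
  have hdim : Module.finrank ℝ H = Module.finrank ℝ (A × B) := by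
    rw [Module.finrank_prod]; simp [A, B]; omega
  set Λ : H ≃L[ℝ] A × B :=
    (LinearMap.linearEquivOfInjective _ hinj hdim).toContinuousLinearEquiv with hΛ
  have hΛ' : (Λ : H →L[ℝ] A × B) = (p.comp (fderiv ℝ f w₀)).prod π := by
    ext v <;> rfl
  have hw₀d : HasFDerivAt h (Λ : H →L[ℝ] A × B) w₀ := by rw [hΛ']; exact hhd w₀ hw₀
  have hc : ContDiffAt ℝ ∞ h w₀ := hhs.contDiffAt (hW.mem_nhds hw₀)
  set e₀ := hc.toOpenPartialHomeomorph h hw₀d (by simp) with he₀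
  have he₀c : ∀ w, e₀ w = h w := fun w => rfl
  -- The open set where the derivative of `h` stays invertible. There the inverse is smooth and `p ∘
  -- f'` is onto.
  set V := W ∩ (fun w => (p.comp (fderiv ℝ f w)).prod π) ⁻¹'
    (Set.range ((↑) : (H ≃L[ℝ] A × B) → H →L[ℝ] A × B)) with hV
  have hVo : IsOpen V := by
    refine ContinuousOn.isOpen_inter_preimage ?_ hW ContinuousLinearEquiv.isOpen
    have h1 : ContinuousOn (fderiv ℝ f) W := hf.continuousOn_fderiv_of_isOpen hW (by simp)
    have h2 : ContinuousOn (fun w => p.comp (fderiv ℝ f w)) W :=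
      (ContinuousLinearMap.compL ℝ H E A p).continuous.comp_continuousOn h1
    have h3 : Continuous (fun q : (H →L[ℝ] A) × (H →L[ℝ] B) => q.1.prod q.2) :=
      (ContinuousLinearMap.prodₗᵢ (𝕜 := ℝ) (E := H) (F := A) (G := B) ℝ).continuous
    exact h3.comp_continuousOn (h2.prodMk (continuousOn_const (c := π)))
  have hw₀V : w₀ ∈ V := ⟨hw₀, ⟨Λ, hΛ'⟩⟩
  set e₁ := e₀.restrOpen V hVo with he₁
  have hw₀1 : w₀ ∈ e₁.source := ⟨hc.mem_toOpenPartialHomeomorph_source hw₀d (by simp), hw₀V⟩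
  obtain ⟨ε, hε, hball⟩ := Metric.isOpen_iff.1 e₁.open_target (h w₀) (e₁.map_source hw₀1)
  -- A ball in the sup norm of the product is a product of balls, so the slices with constant `a`
  -- are convex.
  set e := (e₁.symm.restrOpen (Metric.ball (h w₀) ε) Metric.isOpen_ball).symm with he
  have het : e.target = Metric.ball (h w₀) ε := inter_eq_right.2 hball
  have hes : e.source ⊆ V := by
    intro w hw
    have h1 : w ∈ e₁.source := e.symm.map_target hw |> fun _ => by
      have := hw
      simp only [he, OpenPartialHomeomorph.symm_source] at this
      simp at this
      exact this.1
    exact h1.2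
  have hec : ∀ w, e w = h w := fun w => rfl
  have hesm : ContDiffOn ℝ ∞ e.symm e.target := by
    intro y hy
    have hys := hes (e.map_target hy)
    obtain ⟨Λ', hΛ''⟩ := hys.2
    refine (e.contDiffAt_symm hy (f₀' := Λ') ?_
      (hhs.contDiffAt (hW.mem_nhds hys.1))).contDiffWithinAt
    rw [hΛ'']
    exact hhd _ hys.1
  refine ⟨p, e, Metric.ball (h w₀).1 ε, Metric.ball (h w₀).2 ε, Metric.isOpen_ball,
    Metric.isOpen_ball, fun w hw => (hes hw).1, ?_, ?_, hhs.mono (fun w hw => (hes hw).1), hesm,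
    fun w _ => rfl, ?_⟩
  · have : e.symm (h w₀) ∈ e.source := e.map_target (by rw [het]; exact Metric.mem_ball_self hε)
    have h2 : e.symm (h w₀) = w₀ := e₁.left_inv hw₀1
    rwa [h2] at this
  · rw [het, ball_prod_same]
  · intro a ha b hb b' hb'
    have hmem : ∀ b ∈ Metric.ball (h w₀).2 ε, (a, b) ∈ e.target := fun b hb => by
      rw [het, ← ball_prod_same]; exact ⟨ha, hb⟩
    have hder : ∀ b ∈ Metric.ball (h w₀).2 ε,
        HasFDerivAt (fun b => f (e.symm (a, b))) (0 : B →L[ℝ] E) b := by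
      intro b hb
      have hs := hes (e.map_target (hmem b hb))
      have h1 : HasFDerivAt e.symm (fderiv ℝ e.symm (a, b)) (a, b) :=
        ((hesm.contDiffAt (e.open_target.mem_nhds (hmem b hb))).differentiableAt
          (by simp)).hasFDerivAt
      have h2 : HasFDerivAt (fun b : B => (a, b)) (ContinuousLinearMap.inr ℝ A B) b :=
        hasFDerivAt_prodMk_right a b
      have h3 := h1.comp b h2
      have h4 := (hfd _ hs.1).comp b h3
      have h5 := (hhd _ hs.1).comp b h3
      have h6 : HasFDerivAt (fun b : B => (a, b))
          (((p.comp (fderiv ℝ f (e.symm (a, b)))).prod π).comp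
        ((fderiv ℝ e.symm (a, b)).comp (ContinuousLinearMap.inr ℝ A B))) b := by
        refine h5.congr_of_eventuallyEq
          (Filter.eventuallyEq_of_mem (Metric.isOpen_ball.mem_nhds hb) fun b' hb' => ?_)
        exact (e.right_inv (hmem b' hb')).symm
      have h7 := h6.unique h2
      -- Constancy of the rank enters here: `f'` has rank ρ and `p ∘ f'` is onto a space of
      -- dimension ρ, so the two kernels have equal dimension. A direction that keeps `a` fixed is
      -- then killed by `f'` itself.
      have hker : LinearMap.ker (fderiv ℝ f (e.symm (a, b))).toLinearMap =
          LinearMap.ker (p.toLinearMap ∘ₗ (fderiv ℝ f (e.symm (a, b))).toLinearMap) := by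
        refine Submodule.eq_of_le_of_finrank_eq (LinearMap.ker_le_ker_comp _ _) ?_
        have r1 := LinearMap.finrank_range_add_finrank_ker
          (fderiv ℝ f (e.symm (a, b))).toLinearMap
        have r2 := LinearMap.finrank_range_add_finrank_ker
          (p.toLinearMap ∘ₗ (fderiv ℝ f (e.symm (a, b))).toLinearMap)
        have r3 : LinearMap.range (p.toLinearMap ∘ₗ (fderiv ℝ f (e.symm (a, b))).toLinearMap)
            = ⊤ := by
          rw [LinearMap.range_eq_top]
          obtain ⟨Λ', hΛ''⟩ := hs.2
          intro x
          obtain ⟨v, hv⟩ := Λ'.surjective (x, 0)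
          refine ⟨v, ?_⟩
          have := DFunLike.congr_fun hΛ'' v
          exact congrArg Prod.fst (this.symm.trans hv)
        rw [r3, finrank_top] at r2
        rw [hρ _ hs.1] at r1
        have : Module.finrank ℝ A = ρ := by simp [A]
        omega
      have h9 : (fderiv ℝ f (e.symm (a, b))).comp
          ((fderiv ℝ e.symm (a, b)).comp (ContinuousLinearMap.inr ℝ A B)) = 0 := by
        refine ContinuousLinearMap.ext fun v => ?_
        have h8 : fderiv ℝ e.symm (a, b) (0, v) ∈
            LinearMap.ker (fderiv ℝ f (e.symm (a, b))).toLinearMap := by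
          rw [hker]
          exact congrArg Prod.fst (DFunLike.congr_fun h7 v)
        exact LinearMap.mem_ker.1 h8
      rw [h9] at h4
      exact h4
    refine (convex_ball _ _).is_const_of_fderivWithin_eq_zero (𝕜 := ℝ)
      (f := fun b => f (e.symm (a, b)))
      (fun b hb => (hder b hb).differentiableAt.differentiableWithinAt) (fun b hb => ?_) hb hb'
    rw [fderivWithin_of_isOpen Metric.isOpen_ball hb, (hder b hb).fderiv]
universe u

/-! ### Linear symplectic algebra and top wedge powers -/

section Wedge

variable {V : Type*} [AddCommGroup V] [Module ℝ V]

/-- `v ↦ ∏ b(v₂ᵢ, v₂ᵢ₊₁)` as a multilinear map. -/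
def pairProd (r : ℕ) (b : V →ₗ[ℝ] V →ₗ[ℝ] ℝ) : MultilinearMap ℝ (fun _ : Fin (2 * r) => V) ℝ where
  toFun v := ∏ i : Fin r, b (v ⟨2 * i, by omega⟩) (v ⟨2 * i + 1, by omega⟩)
  map_update_add' := by
    intro inst v j x y
    obtain rfl : inst = instDecidableEqFin _ := Subsingleton.elim _ _
    have hj : (j : ℕ) / 2 < r := by omega
    set k : Fin r := ⟨j / 2, hj⟩ with hk
    have hne : ∀ z, ∏ i ∈ Finset.univ.erase k, b (Function.update v j z ⟨2 * i, by omega⟩)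
        (Function.update v j z ⟨2 * i + 1, by omega⟩) =
        ∏ i ∈ Finset.univ.erase k, b (v ⟨2 * i, by omega⟩) (v ⟨2 * i + 1, by omega⟩) := by
      intro z
      refine Finset.prod_congr rfl fun i hi => ?_
      have hi' : (i : ℕ) ≠ j / 2 := fun h => (Finset.mem_erase.1 hi).1 (Fin.ext h)
      rw [Function.update_of_ne (by rw [Ne, Fin.ext_iff]; simp; omega),
        Function.update_of_ne (by rw [Ne, Fin.ext_iff]; simp; omega)]
    simp only [← Finset.mul_prod_erase Finset.univ _ (Finset.mem_univ k), hne, ← add_mul]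
    congr 1
    rcases Nat.mod_two_eq_zero_or_one j with h | h
    · have h1 : (⟨2 * (k : ℕ), by omega⟩ : Fin (2 * r)) = j := by ext; simp [hk]; omega
      have h2 : (⟨2 * (k : ℕ) + 1, by omega⟩ : Fin (2 * r)) ≠ j := by
        rw [Ne, Fin.ext_iff]; simp [hk]; omega
      simp only [h1, Function.update_self, Function.update_of_ne h2, map_add, LinearMap.add_apply]
    · have h1 : (⟨2 * (k : ℕ) + 1, by omega⟩ : Fin (2 * r)) = j := by ext; simp [hk]; omega
      have h2 : (⟨2 * (k : ℕ), by omega⟩ : Fin (2 * r)) ≠ j := by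
        rw [Ne, Fin.ext_iff]; simp [hk]; omega
      simp only [h1, Function.update_self, Function.update_of_ne h2, map_add]
  map_update_smul' := by
    intro inst v j c x
    obtain rfl : inst = instDecidableEqFin _ := Subsingleton.elim _ _
    have hj : (j : ℕ) / 2 < r := by omega
    set k : Fin r := ⟨j / 2, hj⟩ with hk
    have hne : ∀ z, ∏ i ∈ Finset.univ.erase k, b (Function.update v j z ⟨2 * i, by omega⟩)
        (Function.update v j z ⟨2 * i + 1, by omega⟩) =
        ∏ i ∈ Finset.univ.erase k, b (v ⟨2 * i, by omega⟩) (v ⟨2 * i + 1, by omega⟩) := by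
      intro z
      refine Finset.prod_congr rfl fun i hi => ?_
      have hi' : (i : ℕ) ≠ j / 2 := fun h => (Finset.mem_erase.1 hi).1 (Fin.ext h)
      rw [Function.update_of_ne (by rw [Ne, Fin.ext_iff]; simp; omega),
        Function.update_of_ne (by rw [Ne, Fin.ext_iff]; simp; omega)]
    simp only [← Finset.mul_prod_erase Finset.univ _ (Finset.mem_univ k), hne, smul_eq_mul,
      ← mul_assoc]
    congr 1
    rcases Nat.mod_two_eq_zero_or_one j with h | h
    · have h1 : (⟨2 * (k : ℕ), by omega⟩ : Fin (2 * r)) = j := by ext; simp [hk]; omega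
      have h2 : (⟨2 * (k : ℕ) + 1, by omega⟩ : Fin (2 * r)) ≠ j := by
        rw [Ne, Fin.ext_iff]; simp [hk]; omega
      simp only [h1, Function.update_self, Function.update_of_ne h2, map_smul,
        LinearMap.smul_apply, smul_eq_mul]
    · have h1 : (⟨2 * (k : ℕ) + 1, by omega⟩ : Fin (2 * r)) = j := by ext; simp [hk]; omega
      have h2 : (⟨2 * (k : ℕ), by omega⟩ : Fin (2 * r)) ≠ j := by
        rw [Ne, Fin.ext_iff]; simp [hk]; omega
      simp only [h1, Function.update_self, Function.update_of_ne h2, map_smul, smul_eq_mul]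

theorem wedgePow_eq_alternatization (r : ℕ) (b : V →ₗ[ℝ] V →ₗ[ℝ] ℝ) (v : Fin (2 * r) → V) :
    wedgePow r (fun x y => b x y) v =
      (1 / 2 ^ r : ℝ) * MultilinearMap.alternatization (pairProd r b) v := by
  rw [MultilinearMap.alternatization_apply, wedgePow]
  congr 1
  refine Finset.sum_congr rfl fun σ _ => ?_
  rw [Units.smul_def, zsmul_eq_mul]
  rfl

/-- The wedge power is an alternating form of top degree, hence a multiple of the determinant of the
standard basis. -/
theorem wedgePow_map (r : ℕ)
    (b : EuclideanSpace ℝ (Fin (2 * r)) →ₗ[ℝ] EuclideanSpace ℝ (Fin (2 * r)) →ₗ[ℝ] ℝ)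
    (T : EuclideanSpace ℝ (Fin (2 * r)) →ₗ[ℝ] EuclideanSpace ℝ (Fin (2 * r))) :
    wedgePow r (fun x y => b x y) (fun i => T (EuclideanSpace.single i 1)) =
      LinearMap.det T * wedgePow r (fun x y => b x y) (fun i => EuclideanSpace.single i 1) := by
  rw [wedgePow_eq_alternatization, wedgePow_eq_alternatization]
  set f := MultilinearMap.alternatization (pairProd r b)
  set e := (EuclideanSpace.basisFun (Fin (2 * r)) ℝ).toBasis with he
  have he' : ∀ i, EuclideanSpace.single i (1 : ℝ) = e i := fun i => by simp [he]
  simp only [he']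
  have h1 := f.eq_smul_basis_det e
  have h2 : e.det (fun i => T (e i)) = LinearMap.det T := by
    rw [Module.Basis.det_apply, ← LinearMap.det_toMatrix e]
    congr 1
    ext i j
    rw [LinearMap.toMatrix_apply, Module.Basis.toMatrix_apply]
  have h3 : f (fun i => T (e i)) = f e * LinearMap.det T := by
    conv_lhs => rw [h1]
    rw [AlternatingMap.smul_apply, h2, smul_eq_mul]
  rw [h3]
  change _ = _ * (_ * f e)
  ring

/-- A nondegenerate skew-symmetric form has a symplectic basis; in particular the dimension is
even. -/
theorem exists_symplectic_family : ∀ (n : ℕ) (V : Type u) [AddCommGroup V] [Module ℝ V]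
    [FiniteDimensional ℝ V] (b : V →ₗ[ℝ] V →ₗ[ℝ] ℝ), (∀ v w, b v w = - b w v) →
    (∀ v, (∀ w, b v w = 0) → v = 0) → Module.finrank ℝ V = n →
    ∃ (r : ℕ) (s t : Fin r → V), n = 2 * r ∧ (∀ i j, b (s i) (s j) = 0) ∧
      (∀ i j, b (t i) (t j) = 0) ∧ ∀ i j, b (s i) (t j) = if i = j then 1 else 0 := by
  intro n
  induction n using Nat.strong_induction_on with
  | _ n ih =>
    intro V _ _ _ b hskew hnd hn
    rcases Nat.eq_zero_or_pos n with h0 | hpos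
    · exact ⟨0, Fin.elim0, Fin.elim0, by omega, fun i => i.elim0, fun i => i.elim0,
        fun i => i.elim0⟩
    have : Nontrivial V := Module.finrank_pos_iff.1 (hn ▸ hpos)
    obtain ⟨v, hv⟩ := exists_ne (0 : V)
    obtain ⟨w₀, hw₀⟩ : ∃ w, b v w ≠ 0 := by
      by_contra! h
      exact hv (hnd v h)
    set w := (b v w₀)⁻¹ • w₀ with hw
    have hvw : b v w = 1 := by simp [hw, hw₀]
    have hself : ∀ x, b x x = 0 := fun x => by have := hskew x x; linarith
    have hwv : b w v = -1 := by rw [hskew, hvw]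
    -- The kernel of `L` is the orthogonal of the hyperbolic plane spanned by `v` and `w`. It has
    -- codimension 2, and the induction continues inside it.
    set L : V →ₗ[ℝ] ℝ × ℝ := (b v).prod (b w) with hL
    have hLs : LinearMap.range L = ⊤ := by
      rw [LinearMap.range_eq_top]
      intro ⟨x, y⟩
      refine ⟨x • w - y • v, ?_⟩
      simp [hL, hvw, hwv, hself]
    have hrk := LinearMap.finrank_range_add_finrank_ker L
    rw [hLs, finrank_top, Module.finrank_prod, Module.finrank_self, hn] at hrk
    obtain ⟨r, s, t, hr, hs, ht, hst⟩ := ih (Module.finrank ℝ (LinearMap.ker L)) (by omega)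
      (LinearMap.ker L) (b.domRestrict₁₂ (LinearMap.ker L) (LinearMap.ker L))
      (fun x y => hskew x y) (fun x hx => by
        have hx1 : b v x = 0 := congrArg Prod.fst x.2
        have hx2 : b w x = 0 := congrArg Prod.snd x.2
        refine Subtype.ext (hnd x fun y => ?_)
        -- The component of `y` orthogonal to the plane. A vector of the kernel is orthogonal to the
        -- plane, so pairing with all such components tests it against all of `V`.
        have hmem : y - (b v y) • w + (b w y) • v ∈ LinearMap.ker L := by
          rw [LinearMap.mem_ker]
          simp [hL, hvw, hwv, hself]
        have h1 : b x (y - (b v y) • w + (b w y) • v) = 0 := hx ⟨_, hmem⟩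
        have h2 : b x w = 0 := by rw [hskew, hx2, neg_zero]
        have h3 : b x v = 0 := by rw [hskew, hx1, neg_zero]
        simpa [h2, h3] using h1) rfl
    have m1 : ∀ x : LinearMap.ker L, b v x = 0 := fun x => congrArg Prod.fst x.2
    have m2 : ∀ x : LinearMap.ker L, b w x = 0 := fun x => congrArg Prod.snd x.2
    have m3 : ∀ x : LinearMap.ker L, b x v = 0 := fun x => by rw [hskew, m1, neg_zero]
    have m4 : ∀ x : LinearMap.ker L, b x w = 0 := fun x => by rw [hskew, m2, neg_zero]
    have hs' : ∀ i j, b (s i) (s j) = 0 := hs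
    have ht' : ∀ i j, b (t i) (t j) = 0 := ht
    have hst' : ∀ i j, b (s i) (t j) = if i = j then 1 else 0 := hst
    refine ⟨r + 1, Fin.cons v (fun i => (s i : V)), Fin.cons w (fun i => (t i : V)), by omega,
      ?_, ?_, ?_⟩
    · intro i j
      refine Fin.cases ?_ (fun i => ?_) i <;> refine Fin.cases ?_ (fun j => ?_) j <;>
        simp [hself, m1, m3, hs']
    · intro i j
      refine Fin.cases ?_ (fun i => ?_) i <;> refine Fin.cases ?_ (fun j => ?_) j <;>
        simp [hself, m2, m4, ht']
    · intro i j
      refine Fin.cases ?_ (fun i => ?_) i <;> refine Fin.cases ?_ (fun j => ?_) j <;>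
        simp [hvw, m1, m4, hst', (Fin.succ_ne_zero _).symm]

/-- The pairing of the standard symplectic basis. -/
def stdPairing {r : ℕ} (p q : Fin r × Bool) : ℝ :=
  if p.1 = q.1 then (if p.2 = q.2 then 0 else if p.2 then -1 else 1) else 0

/-- If the product does not vanish, the permutation carries each pair {(i, false), (i, true)} to
another such pair. It is then a permutation of the pairs, of even sign because every pair has two
elements, composed with flips inside pairs. The sign of the flips is also the value of the product,
so the term is a square. -/
theorem sign_mul_prod_stdPairing_nonneg {r : ℕ} (σ : Equiv.Perm (Fin r × Bool)) :
    0 ≤ ((Equiv.Perm.sign σ : ℤ) : ℝ) * ∏ i, stdPairing (σ (i, false)) (σ (i, true)) := by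
  by_cases h : ∀ i, (σ (i, false)).1 = (σ (i, true)).1
  swap
  · push Not at h
    obtain ⟨i, hi⟩ := h
    rw [Finset.prod_eq_zero (Finset.mem_univ i) (by simp [stdPairing, hi]), mul_zero]
  have h2 : ∀ i, (σ (i, false)).2 ≠ (σ (i, true)).2 := fun i h' => by
    have := σ.injective (Prod.ext (h i) h')
    simp at this
  have h1 : ∀ i x, (σ (i, x)).1 = (σ (i, false)).1 := fun i x => by
    cases x
    · rfl
    · exact (h i).symm
  have hπ : Function.Injective (fun i => (σ (i, false)).1) := by
    intro i j hij
    have hij' : (σ (i, false)).1 = (σ (j, false)).1 := hij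
    by_cases hx : (σ (i, false)).2 = (σ (j, false)).2
    · exact congrArg Prod.fst (σ.injective (Prod.ext hij' hx))
    · have hx' : (σ (i, false)).2 = (σ (j, true)).2 := by
        have := h2 j
        revert hx this
        cases (σ (i, false)).2 <;> cases (σ (j, false)).2 <;> cases (σ (j, true)).2 <;> simp
      exact congrArg Prod.fst (σ.injective (Prod.ext (hij'.trans (h j)) hx'))
  set π : Equiv.Perm (Fin r) := Equiv.ofBijective _ (Finite.injective_iff_bijective.1 hπ) with hπd
  set τ : Fin r → Equiv.Perm Bool := fun i =>
    if (σ (i, false)).2 then Equiv.swap false true else 1 with hτ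
  have hτ' : ∀ i x, τ i x = (σ (i, x)).2 := fun i x => by
    have := h2 i
    simp only [hτ]
    cases hh : (σ (i, false)).2 <;> cases hh' : (σ (i, true)).2 <;> cases x <;> simp_all
  have hσ : σ = (Equiv.prodCongrLeft fun _ => π) * (Equiv.prodCongrRight τ) := by
    ext1 ⟨i, x⟩
    refine Prod.ext ?_ ?_
    · exact h1 i x
    · exact (hτ' i x).symm
  have hsign : Equiv.Perm.sign σ = ∏ i, Equiv.Perm.sign (τ i) := by
    conv_lhs => rw [hσ]
    rw [Equiv.Perm.sign_mul, Equiv.Perm.sign_prodCongrLeft, Equiv.Perm.sign_prodCongrRight]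
    simp
  have hJ : ∀ i, stdPairing (σ (i, false)) (σ (i, true)) = ((Equiv.Perm.sign (τ i) : ℤ) : ℝ) := by
    intro i
    simp only [stdPairing, h i, if_true, h2 i, if_false, hτ]
    split_ifs <;> simp
  rw [hsign]
  simp only [hJ]
  push_cast
  exact mul_self_nonneg _

/-- On a symplectic family no cancellation occurs: all terms of the sum are nonnegative and the
identity permutation contributes 1. -/
theorem wedgePow_symplectic_family_pos {r : ℕ} (b : V →ₗ[ℝ] V →ₗ[ℝ] ℝ)
    (hskew : ∀ v w, b v w = - b w v)
    (s t : Fin r → V) (hs : ∀ i j, b (s i) (s j) = 0) (ht : ∀ i j, b (t i) (t j) = 0)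
    (hst : ∀ i j, b (s i) (t j) = if i = j then 1 else 0) :
    ∃ v : Fin (2 * r) → V, 0 < wedgePow r (fun x y => b x y) v := by
  let ε : Fin r × Bool ≃ Fin (2 * r) :=
    { toFun := fun p => ⟨2 * p.1 + (if p.2 then 1 else 0), by split_ifs <;> omega⟩
      invFun := fun j => (⟨j / 2, by omega⟩, decide ((j : ℕ) % 2 = 1))
      left_inv := by
        rintro ⟨i, x⟩
        cases x
        · simp
        · refine Prod.ext (Fin.ext ?_) ?_
          · simp; omega
          · simp
      right_inv := by
        intro j
        ext
        rcases Nat.mod_two_eq_zero_or_one j with h | h <;> simp [h] <;> omega }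
  let u : Fin r × Bool → V := fun p => if p.2 then t p.1 else s p.1
  have hts : ∀ i j, b (t i) (s j) = if i = j then -1 else 0 := fun i j => by
    rw [hskew, hst]; rcases eq_or_ne i j with rfl | h
    · simp
    · simp [h, h.symm]
  have hu : ∀ p q, b (u p) (u q) = stdPairing p q := by
    rintro ⟨i, x⟩ ⟨j, y⟩
    cases x <;> cases y <;> simp [u, stdPairing, hs, ht, hst, hts]
  refine ⟨u ∘ ε.symm, mul_pos (by positivity) ?_⟩
  have key : ∀ σ : Equiv.Perm (Fin (2 * r)), ((Equiv.Perm.sign σ : ℤ) : ℝ) *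
      ∏ i : Fin r, b ((u ∘ ε.symm) (σ ⟨2 * i, by omega⟩)) ((u ∘ ε.symm) (σ ⟨2 * i + 1, by omega⟩)) =
      ((Equiv.Perm.sign (ε.symm.permCongr σ) : ℤ) : ℝ) * ∏ i,
        stdPairing (ε.symm.permCongr σ (i, false)) (ε.symm.permCongr σ (i, true)) := by
    intro σ
    rw [Equiv.Perm.sign_permCongr]
    congr 1
    refine Finset.prod_congr rfl fun i _ => ?_
    simp only [Function.comp, hu, Equiv.permCongr_apply, Equiv.symm_symm]
    rfl
  refine Finset.sum_pos' (fun σ _ => ?_) ⟨1, Finset.mem_univ _, ?_⟩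
  · rw [key]; exact sign_mul_prod_stdPairing_nonneg _
  · rw [key]
    have : ε.symm.permCongr 1 = 1 := by ext1 x; simp [Equiv.permCongr_apply]
    rw [this]
    simp [stdPairing]

/-- Otherwise the determinant formula would make the wedge power vanish on every family, including a
symplectic one. This is what makes the leaf density positive. -/
theorem wedgePow_ne_zero {r : ℕ}
    (b : EuclideanSpace ℝ (Fin (2 * r)) →ₗ[ℝ] EuclideanSpace ℝ (Fin (2 * r)) →ₗ[ℝ] ℝ)
    (hskew : ∀ v w, b v w = - b w v) (hnd : ∀ v, (∀ w, b v w = 0) → v = 0) :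
    wedgePow r (fun x y => b x y) (fun i => EuclideanSpace.single i (1 : ℝ)) ≠ 0 := by
  intro h0
  obtain ⟨r', s, t, hr, hs, ht, hst⟩ := exists_symplectic_family (2 * r) _ b hskew hnd (by simp)
  obtain rfl : r = r' := by omega
  obtain ⟨v, hv⟩ := wedgePow_symplectic_family_pos b hskew s t hs ht hst
  set T : EuclideanSpace ℝ (Fin (2 * r)) →ₗ[ℝ] EuclideanSpace ℝ (Fin (2 * r)) :=
    (EuclideanSpace.basisFun (Fin (2 * r)) ℝ).toBasis.constr ℝ v with hT
  have h1 := wedgePow_map r b T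
  have h2 : (fun i => T (EuclideanSpace.single i (1 : ℝ))) = v := by
    ext1 i
    have := (EuclideanSpace.basisFun (Fin (2 * r)) ℝ).toBasis.constr_basis ℝ v i
    rwa [OrthonormalBasis.coe_toBasis, EuclideanSpace.basisFun_apply] at this
  rw [h2, h0, mul_zero] at h1
  exact hv.ne' h1

end Wedge

/-! ### Two-forms as bilinear forms on the model space -/

/-- A 2-form at a point, as a bilinear form on the model space. -/
def twoFormBilin {F G : Type*} [NormedAddCommGroup F] [NormedSpace ℝ F]
    [TopologicalSpace G] [ChartedSpace F G]
    (Ω : ∀ g : G, TangentSpace 𝓘(ℝ, F) g [⋀^Fin 2]→L[ℝ] ℝ) (g : G) : F →ₗ[ℝ] F →ₗ[ℝ] ℝ :=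
  let B : F [⋀^Fin 2]→L[ℝ] ℝ := Ω g
  LinearMap.mk₂ ℝ (fun v w => B ![v, w])
    (fun v₁ v₂ w => by
      have := B.map_update_add ![v₁, w] 0 v₁ v₂
      have h : ∀ x, Function.update ![v₁, w] 0 x = ![x, w] := fun x => by
        ext i; fin_cases i <;> rfl
      simpa only [h] using this)
    (fun c v w => by
      have := B.map_update_smul ![v, w] 0 c v
      have h : ∀ x, Function.update ![v, w] 0 x = ![x, w] := fun x => by
        ext i; fin_cases i <;> rfl
      simpa only [h] using this)
    (fun v w₁ w₂ => by
      have := B.map_update_add ![v, w₁] 1 w₁ w₂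
      have h : ∀ x, Function.update ![v, w₁] 1 x = ![v, x] := fun x => by
        ext i; fin_cases i <;> rfl
      simpa only [h] using this)
    (fun c v w => by
      have := B.map_update_smul ![v, w] 1 c w
      have h : ∀ x, Function.update ![v, w] 1 x = ![v, x] := fun x => by
        ext i; fin_cases i <;> rfl
      simpa only [h] using this)

section TwoForm

variable {F G : Type*} [NormedAddCommGroup F] [NormedSpace ℝ F]
  [TopologicalSpace G] [ChartedSpace F G]
  (Ω : ∀ g : G, TangentSpace 𝓘(ℝ, F) g [⋀^Fin 2]→L[ℝ] ℝ)

theorem twoFormBilin_apply (g : G) (v w : F) : twoFormBilin Ω g v w = Ω g ![v, w] := rfl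

theorem twoFormBilin_self (g : G) (v : F) : twoFormBilin Ω g v v = 0 :=
  (Ω g).map_eq_zero_of_eq ![v, v] (i := 0) (j := 1) rfl (by decide)

theorem twoFormBilin_skew (g : G) (v w : F) : twoFormBilin Ω g v w = - twoFormBilin Ω g w v := by
  have h := twoFormBilin_self Ω g (v + w)
  simp only [map_add, LinearMap.add_apply, twoFormBilin_self] at h
  linarith

theorem twoFormBilin_nondegenerate (hΩ : IsSymplectic Ω) (g : G) :
    (twoFormBilin Ω g).Nondegenerate := by
  have h : (twoFormBilin Ω g).SeparatingLeft := fun v hv => hΩ.nondegenerate g v hv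
  refine ⟨h, fun v hv => h v fun w => ?_⟩
  rw [twoFormBilin_skew, hv w, neg_zero]

end TwoForm

namespace LieGroupoid

/-! ### Groupoid algebra and the derivative of the product -/

section Algebra

variable {E F G M : Type*}
  [NormedAddCommGroup E] [NormedSpace ℝ E] [NormedAddCommGroup F] [NormedSpace ℝ F]
  [TopologicalSpace M] [ChartedSpace E M] [TopologicalSpace G] [ChartedSpace F G]
  (Γ : LieGroupoid E F G M)

theorem mul_inv_mul_cancel {g h : G} (hgh : Γ.src g = Γ.src h) :
    Γ.mul (Γ.mul g (Γ.inv h)) h = g := by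
  rw [Γ.mul_assoc _ _ _ (hgh.trans (Γ.tgt_inv h).symm) (Γ.src_inv h), Γ.inv_mul, ← hgh, Γ.mul_unit]

theorem mul_mul_inv_cancel {g h : G} (hgh : Γ.src g = Γ.tgt h) :
    Γ.mul (Γ.mul g h) (Γ.inv h) = g := by
  rw [Γ.mul_assoc _ _ _ hgh (Γ.tgt_inv h).symm, Γ.mul_inv, ← hgh, Γ.mul_unit]

theorem inv_mul_mul_cancel {g h : G} (hgh : Γ.src g = Γ.tgt h) :
    Γ.mul (Γ.inv g) (Γ.mul g h) = h := by
  rw [← Γ.mul_assoc _ _ _ (Γ.src_inv g) hgh, Γ.inv_mul, hgh, Γ.unit_mul]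

theorem mul_inv_mul_cancel' {g h : G} (hgh : Γ.tgt g = Γ.tgt h) :
    Γ.mul g (Γ.mul (Γ.inv g) h) = h := by
  rw [← Γ.mul_assoc _ _ _ (Γ.tgt_inv g).symm ((Γ.src_inv g).trans hgh), Γ.mul_inv, hgh, Γ.unit_mul]

theorem mul_right_cancel {g h k : G} (hg : Γ.src g = Γ.tgt k) (hh : Γ.src h = Γ.tgt k)
    (e : Γ.mul g k = Γ.mul h k) : g = h := by
  rw [← Γ.mul_mul_inv_cancel hg, e, Γ.mul_mul_inv_cancel hh]

theorem mul_left_cancel {g h k : G} (hg : Γ.src k = Γ.tgt g) (hh : Γ.src k = Γ.tgt h)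
    (e : Γ.mul k g = Γ.mul k h) : g = h := by
  rw [← Γ.inv_mul_mul_cancel hg, e, Γ.inv_mul_mul_cancel hh]

theorem inv_inv (g : G) : Γ.inv (Γ.inv g) = g := by
  refine Γ.mul_right_cancel (k := Γ.inv g) ?_ (Γ.tgt_inv g).symm ?_
  · rw [Γ.src_inv]
  · rw [Γ.inv_mul, Γ.mul_inv, Γ.src_inv]

theorem inv_mul_rev {g h : G} (hgh : Γ.src g = Γ.tgt h) :
    Γ.inv (Γ.mul g h) = Γ.mul (Γ.inv h) (Γ.inv g) := by
  have hc : Γ.src (Γ.inv h) = Γ.tgt (Γ.inv g) := by rw [Γ.src_inv, Γ.tgt_inv, hgh]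
  refine Γ.mul_right_cancel (k := Γ.mul g h) (Γ.src_inv _) ?_ ?_
  · rw [Γ.src_mul _ _ hc, Γ.src_inv, Γ.tgt_mul _ _ hgh]
  · rw [Γ.inv_mul, Γ.src_mul _ _ hgh, Γ.mul_assoc _ _ _ hc (by rw [Γ.src_inv, Γ.tgt_mul _ _ hgh]),
      Γ.inv_mul_mul_cancel hgh, Γ.inv_mul]

theorem unit_mul_unit (x : M) : Γ.mul (Γ.unit x) (Γ.unit x) = Γ.unit x := by
  have := Γ.unit_mul (Γ.unit x)
  rwa [Γ.tgt_unit] at this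

theorem contMDiffOn_mul_comp {H X : Type*} [NormedAddCommGroup H] [NormedSpace ℝ H]
    [TopologicalSpace X] [ChartedSpace H X] {U : Set X} {c₁ c₂ : X → G}
    (h₁ : ContMDiffOn 𝓘(ℝ, H) 𝓘(ℝ, F) ∞ c₁ U) (h₂ : ContMDiffOn 𝓘(ℝ, H) 𝓘(ℝ, F) ∞ c₂ U)
    (h : ∀ u ∈ U, Γ.src (c₁ u) = Γ.tgt (c₂ u)) :
    ContMDiffOn 𝓘(ℝ, H) 𝓘(ℝ, F) ∞ (fun u => Γ.mul (c₁ u) (c₂ u)) U :=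
  Γ.contMDiffOn_mul.comp (h₁.prodMk h₂) h

/-- The derivative of the multiplication within the composable pairs. -/
def mulDeriv (p : G × G) : F × F →L[ℝ] F :=
  mfderivWithin (𝓘(ℝ, F).prod 𝓘(ℝ, F)) 𝓘(ℝ, F)
    (fun p : G × G => Γ.mul p.1 p.2) {p | Γ.src p.1 = Γ.tgt p.2} p

/-- The derivative of the product is known only within the composable pairs, so it is computed on
velocities of maps into this set. This converts identities between arrows into vectors to which
multiplicativity of the form applies. -/
theorem mulDeriv_apply_modelDeriv {H X : Type*} [NormedAddCommGroup H] [NormedSpace ℝ H]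
    [TopologicalSpace X] [ChartedSpace H X] {U : Set X} (hU : IsOpen U) {c₁ c₂ : X → G}
    (h₁ : ContMDiffOn 𝓘(ℝ, H) 𝓘(ℝ, F) ∞ c₁ U) (h₂ : ContMDiffOn 𝓘(ℝ, H) 𝓘(ℝ, F) ∞ c₂ U)
    (h : ∀ u ∈ U, Γ.src (c₁ u) = Γ.tgt (c₂ u)) {u : X} (hu : u ∈ U) (v : H) :
    Γ.mulDeriv (c₁ u, c₂ u) (modelDeriv H F c₁ u v, modelDeriv H F c₂ u v) =
      modelDeriv H F (fun u => Γ.mul (c₁ u) (c₂ u)) u v := by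
  have hm : HasMFDerivWithinAt (𝓘(ℝ, F).prod 𝓘(ℝ, F)) 𝓘(ℝ, F)
      (fun p : G × G => Γ.mul p.1 p.2) {p | Γ.src p.1 = Γ.tgt p.2} (c₁ u, c₂ u)
      (Γ.mulDeriv (c₁ u, c₂ u)) :=
    ((Γ.contMDiffOn_mul (c₁ u, c₂ u) (h u hu)).mdifferentiableWithinAt
      (by simp)).hasMFDerivWithinAt
  have hd := ((hasMFDerivAt_modelDeriv (mdifferentiableAt_of_contMDiffOn hU hu h₁)).prodMk
    (hasMFDerivAt_modelDeriv (mdifferentiableAt_of_contMDiffOn hU hu h₂))).hasMFDerivWithinAt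
    (s := U)
  have h3 := HasMFDerivWithinAt.comp (f := fun u => (c₁ u, c₂ u)) u hm hd (fun u hu => h u hu)
  exact (DFunLike.congr_fun
    (modelDeriv_eq_of_hasMFDerivAt (h3.hasMFDerivAt (hU.mem_nhds hu))) v).symm

end Algebra

/-! ### Infinitesimal geometry of a multiplicative symplectic form -/

section Symplectic

variable {E F G M : Type*}
  [NormedAddCommGroup E] [NormedSpace ℝ E] [NormedAddCommGroup F] [NormedSpace ℝ F]
  [FiniteDimensional ℝ E] [FiniteDimensional ℝ F]
  [TopologicalSpace M] [ChartedSpace E M] [TopologicalSpace G] [ChartedSpace F G]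
  (Γ : LieGroupoid E F G M) {Ω : ∀ g : G, TangentSpace 𝓘(ℝ, F) g [⋀^Fin 2]→L[ℝ] ℝ}

/-- The kernel of the derivative of the source map. -/
def kerSrc (g : G) : Submodule ℝ F := LinearMap.ker (modelDeriv F E Γ.src g).toLinearMap

/-- The kernel of the derivative of the target map. -/
def kerTgt (g : G) : Submodule ℝ F := LinearMap.ker (modelDeriv F E Γ.tgt g).toLinearMap

omit [FiniteDimensional ℝ E] [FiniteDimensional ℝ F] in
theorem twoFormBilin_mul (hΩ : Γ.IsMultiplicative Ω) {g h : G} (hgh : Γ.src g = Γ.tgt h)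
    {v v' w w' : F} (h₁ : modelDeriv F E Γ.src g v = modelDeriv F E Γ.tgt h w)
    (h₂ : modelDeriv F E Γ.src g v' = modelDeriv F E Γ.tgt h w') :
    twoFormBilin Ω (Γ.mul g h) (Γ.mulDeriv (g, h) (v, w)) (Γ.mulDeriv (g, h) (v', w')) =
      twoFormBilin Ω g v v' + twoFormBilin Ω h w w' :=
  hΩ g h hgh v v' w w' h₁ h₂

/-- Factor g as 1·g. A vector in ker dt is the product of 0 and itself, and a vector `w` in ker ds
is the product of its right translate to the unit and 0. Multiplicativity then expresses the pairing
as a sum of two pairings with a zero argument. -/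
theorem twoFormBilin_kerTgt_kerSrc (hΩ : Γ.IsMultiplicative Ω) {g : G} {v w : F}
    (hv : v ∈ Γ.kerTgt g) (hw : w ∈ Γ.kerSrc g) : twoFormBilin Ω g v w = 0 := by
  let H := EuclideanSpace ℝ (Fin (Module.finrank ℝ F - Module.finrank ℝ E))
  obtain ⟨c, hc⟩ := exists_sliceChart_of_isSubmersion Γ.isSubmersion_src g
  obtain ⟨d, hd⟩ := exists_sliceChart_of_isSubmersion Γ.isSubmersion_tgt g
  have hcg := c.map_coord g ⟨rfl, hc⟩
  have hdg := d.map_coord g ⟨rfl, hd⟩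
  have hc0 := c.mapsTo_coord ⟨rfl, hc⟩
  have hd0 := d.mapsTo_coord ⟨rfl, hd⟩
  have hw' : w ∈ LinearMap.range (modelDeriv H F c.map (c.coord g)).toLinearMap := by
    rw [c.range_modelDeriv_map Γ.isSubmersion_src (by simp) hc0, hcg]; exact hw
  have hv' : v ∈ LinearMap.range (modelDeriv H F d.map (d.coord g)).toLinearMap := by
    rw [d.range_modelDeriv_map Γ.isSubmersion_tgt (by simp) hd0, hdg]; exact hv
  obtain ⟨a, ha⟩ := hw'
  obtain ⟨b, hb⟩ := hv'
  have hcs : ∀ u ∈ c.dom, Γ.src (c.map u) = Γ.src g := fun u hu => (c.mapsTo_map hu).1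
  have hdt : ∀ u ∈ d.dom, Γ.tgt (d.map u) = Γ.tgt g := fun u hu => (d.mapsTo_map hu).1
  have hcomp : ∀ u ∈ c.dom, Γ.src (c.map u) = Γ.tgt (Γ.inv g) := fun u hu => by
    rw [hcs u hu, Γ.tgt_inv]
  have hsm := Γ.contMDiffOn_mul_comp c.smooth_map (contMDiffOn_const (c := Γ.inv g)) hcomp
  have hsrc1 : ∀ u ∈ c.dom, Γ.src (Γ.mul (c.map u) (Γ.inv g)) = Γ.tgt g := fun u hu => by
    rw [Γ.src_mul _ _ (hcomp u hu), Γ.src_inv]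
  have e1 := Γ.mulDeriv_apply_modelDeriv c.isOpen_dom hsm (contMDiffOn_const (c := g)) hsrc1 hc0 a
  have e2 := Γ.mulDeriv_apply_modelDeriv d.isOpen_dom
    (contMDiffOn_const (c := Γ.unit (Γ.tgt g))) d.smooth_map
    (fun u hu => by rw [Γ.src_unit, hdt u hu]) hd0 b
  rw [modelDeriv_of_eqOn_const (f := fun _ => g) c.isOpen_dom hc0 (fun _ _ => rfl),
    modelDeriv_congr (g := c.map) (Filter.eventuallyEq_of_mem (c.isOpen_dom.mem_nhds hc0)
      (fun u hu => Γ.mul_inv_mul_cancel (hcs u hu))), hcg, Γ.mul_inv] at e1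
  rw [modelDeriv_of_eqOn_const (f := fun _ => Γ.unit (Γ.tgt g)) d.isOpen_dom hd0 (fun _ _ => rfl),
    modelDeriv_congr (f := fun u => Γ.mul (Γ.unit (Γ.tgt g)) (d.map u)) (g := d.map)
      (Filter.eventuallyEq_of_mem (d.isOpen_dom.mem_nhds hd0)
      (fun u hu => by
        have := Γ.unit_mul (d.map u)
        rwa [hdt u hu] at this)), hdg] at e2
  change modelDeriv H F c.map (c.coord g) a = w at ha
  change modelDeriv H F d.map (d.coord g) b = v at hb
  rw [ha] at e1
  rw [hb] at e2
  have hker := modelDeriv_apply_of_mapsTo_fiber Γ.isSubmersion_src c.isOpen_dom hsm hsrc1 hc0 a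
  simp only [hcg, Γ.mul_inv] at hker
  have e3 := Γ.twoFormBilin_mul hΩ (g := Γ.unit (Γ.tgt g)) (h := g) (Γ.src_unit _)
    (v := 0) (w := v) (v' := modelDeriv H F (fun u => Γ.mul (c.map u) (Γ.inv g)) (c.coord g) a)
    (w' := 0) (by rw [map_zero]; exact hv.symm) (by rw [map_zero]; exact hker)
  simp only [zero_apply] at e1 e2
  rw [e2, e1, Γ.unit_mul] at e3
  simpa using e3

omit [FiniteDimensional ℝ E] [FiniteDimensional ℝ F] in
-- Differentiating 1·1 = 1 along the units, multiplicativity gives that the pairing equals twice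
-- itself.
theorem isotropic_unit (hΩ : Γ.IsMultiplicative Ω) (x : M) (v w : E) :
    twoFormBilin Ω (Γ.unit x) (modelDeriv E F Γ.unit x v) (modelDeriv E F Γ.unit x w) = 0 := by
  have hu : ContMDiffOn 𝓘(ℝ, E) 𝓘(ℝ, F) ∞ Γ.unit univ := Γ.contMDiff_unit.contMDiffOn
  have e := Γ.mulDeriv_apply_modelDeriv isOpen_univ hu hu
    (fun x _ => by rw [Γ.src_unit, Γ.tgt_unit]) (mem_univ x)
  rw [show (fun u => Γ.mul (Γ.unit u) (Γ.unit u)) = Γ.unit from funext Γ.unit_mul_unit] at e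
  have hud := mdifferentiableAt_of_contMDiffOn isOpen_univ (mem_univ x) hu
  have hs := modelDeriv_comp (mdifferentiableAt_of_isSubmersion Γ.isSubmersion_src (Γ.unit x)) hud
  have ht := modelDeriv_comp (mdifferentiableAt_of_isSubmersion Γ.isSubmersion_tgt (Γ.unit x)) hud
  rw [modelDeriv_of_eqOn_id (f := Γ.src ∘ Γ.unit) isOpen_univ (mem_univ x)
    (fun y _ => Γ.src_unit y)] at hs
  rw [modelDeriv_of_eqOn_id (f := Γ.tgt ∘ Γ.unit) isOpen_univ (mem_univ x)
    (fun y _ => Γ.tgt_unit y)] at ht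
  have hst : ∀ v, modelDeriv F E Γ.src (Γ.unit x) (modelDeriv E F Γ.unit x v) =
      modelDeriv F E Γ.tgt (Γ.unit x) (modelDeriv E F Γ.unit x v) := fun v =>
    (DFunLike.congr_fun hs v).symm.trans (DFunLike.congr_fun ht v)
  have e3 := Γ.twoFormBilin_mul hΩ (g := Γ.unit x) (h := Γ.unit x)
    (by rw [Γ.src_unit, Γ.tgt_unit]) (hst v) (hst w)
  rw [e v, e w, Γ.unit_mul_unit] at e3
  linarith

omit [FiniteDimensional ℝ E] [FiniteDimensional ℝ F] in
theorem injective_modelDeriv_unit (x : M) : Function.Injective (modelDeriv E F Γ.unit x) := by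
  have hs := modelDeriv_comp (mdifferentiableAt_of_isSubmersion Γ.isSubmersion_src (Γ.unit x))
    (mdifferentiableAt_of_contMDiffOn isOpen_univ (mem_univ x) Γ.contMDiff_unit.contMDiffOn)
  rw [modelDeriv_of_eqOn_id (f := Γ.src ∘ Γ.unit) isOpen_univ (mem_univ x)
    (fun y _ => Γ.src_unit y)] at hs
  exact Function.LeftInverse.injective (g := modelDeriv F E Γ.src (Γ.unit x))
    (fun v => (DFunLike.congr_fun hs v).symm)

omit [FiniteDimensional ℝ E] in
theorem finrank_kerSrc_add (g : G) :
    Module.finrank ℝ (Γ.kerSrc g) + Module.finrank ℝ E = Module.finrank ℝ F :=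
  finrank_ker_of_isSubmersion Γ.isSubmersion_src g

omit [FiniteDimensional ℝ E] in
theorem finrank_kerTgt_add (g : G) :
    Module.finrank ℝ (Γ.kerTgt g) + Module.finrank ℝ E = Module.finrank ℝ F :=
  finrank_ker_of_isSubmersion Γ.isSubmersion_tgt g

/-- Isotropy of the units gives one inequality. Orthogonality of ker ds and ker dt, both of
dimension dim G − dim M, gives the other. -/
theorem finrank_eq_two_mul (hΩ : Γ.IsMultiplicative Ω) (hs : IsSymplectic Ω) (g : G) :
    Module.finrank ℝ F = 2 * Module.finrank ℝ E := by
  have h1 : 2 * Module.finrank ℝ E ≤ Module.finrank ℝ F := by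
    set x := Γ.src g
    set W := LinearMap.range (modelDeriv E F Γ.unit x).toLinearMap
    have hW : Module.finrank ℝ W = Module.finrank ℝ E :=
      LinearMap.finrank_range_of_inj (Γ.injective_modelDeriv_unit x)
    have h2 := LinearMap.BilinForm.finrank_orthogonal
      (twoFormBilin_nondegenerate Ω hs (Γ.unit x)) W
    have h3 : W ≤ LinearMap.BilinForm.orthogonal (twoFormBilin Ω (Γ.unit x)) W := by
      rintro _ ⟨v, rfl⟩ _ ⟨w, rfl⟩
      exact Γ.isotropic_unit hΩ x w v
    have h4 := Submodule.finrank_mono h3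
    have h5 := Submodule.finrank_le W
    omega
  have h2 := LinearMap.BilinForm.finrank_orthogonal
    (twoFormBilin_nondegenerate Ω hs g) (Γ.kerTgt g)
  have h3 : Γ.kerSrc g ≤ LinearMap.BilinForm.orthogonal (twoFormBilin Ω g) (Γ.kerTgt g) :=
    fun w hw v hv => Γ.twoFormBilin_kerTgt_kerSrc hΩ hv hw
  have h4 := Submodule.finrank_mono h3
  have h5 := Γ.finrank_kerSrc_add g
  have h6 := Γ.finrank_kerTgt_add g
  omega

/-- One inclusion is already known, and dim G = 2 dim M makes the dimensions agree. -/
theorem orthogonal_kerTgt (hΩ : Γ.IsMultiplicative Ω) (hs : IsSymplectic Ω) (g : G) :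
    LinearMap.BilinForm.orthogonal (twoFormBilin Ω g) (Γ.kerTgt g) = Γ.kerSrc g := by
  have h1 : Γ.kerSrc g ≤ LinearMap.BilinForm.orthogonal (twoFormBilin Ω g) (Γ.kerTgt g) :=
    fun w hw v hv => Γ.twoFormBilin_kerTgt_kerSrc hΩ hv hw
  refine (Submodule.eq_of_le_of_finrank_eq h1 ?_).symm
  have h2 := LinearMap.BilinForm.finrank_orthogonal
    (twoFormBilin_nondegenerate Ω hs g) (Γ.kerTgt g)
  have h5 := Γ.finrank_kerSrc_add g
  have h6 := Γ.finrank_kerTgt_add g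
  have h7 := Γ.finrank_eq_two_mul hΩ hs g
  omega

theorem orthogonal_kerSrc (hΩ : Γ.IsMultiplicative Ω) (hs : IsSymplectic Ω) (g : G) :
    LinearMap.BilinForm.orthogonal (twoFormBilin Ω g) (Γ.kerSrc g) = Γ.kerTgt g := by
  refine (Submodule.eq_of_le_of_finrank_eq (fun v hv => fun w hw => ?_) ?_).symm
  · change twoFormBilin Ω g w v = 0
    rw [twoFormBilin_skew, Γ.twoFormBilin_kerTgt_kerSrc hΩ hv hw, neg_zero]
  · have h2 := LinearMap.BilinForm.finrank_orthogonal
      (twoFormBilin_nondegenerate Ω hs g) (Γ.kerSrc g)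
    have h5 := Γ.finrank_kerSrc_add g
    have h6 := Γ.finrank_kerTgt_add g
    have h7 := Γ.finrank_eq_two_mul hΩ hs g
    omega

/-- The form Ω(v, ·) vanishes on ker dt, so it factors through the surjection dt. -/
theorem exists_covector (hΩ : Γ.IsMultiplicative Ω) {g : G} {v : F}
    (hv : v ∈ Γ.kerSrc g) :
    ∃ α : E →L[ℝ] ℝ, ∀ z, twoFormBilin Ω g v z = α (modelDeriv F E Γ.tgt g z) := by
  obtain ⟨r, hr⟩ := (modelDeriv F E Γ.tgt g).toLinearMap.exists_rightInverse_of_surjective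
    (LinearMap.range_eq_top.2 (surjective_modelDeriv_of_isSubmersion Γ.isSubmersion_tgt g))
  refine ⟨(twoFormBilin Ω g v ∘ₗ r).toContinuousLinearMap, fun z => ?_⟩
  set y := modelDeriv F E Γ.tgt g z with hy
  have h1 : z - r y ∈ Γ.kerTgt g := by
    have h2 : modelDeriv F E Γ.tgt g (r y) = y := LinearMap.congr_fun hr y
    rw [kerTgt, LinearMap.mem_ker, map_sub]
    change modelDeriv F E Γ.tgt g z - modelDeriv F E Γ.tgt g (r y) = 0
    rw [h2, ← hy, sub_self]
  have h3 := Γ.twoFormBilin_kerTgt_kerSrc hΩ h1 hv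
  rw [twoFormBilin_skew, map_sub] at h3
  change _ = twoFormBilin Ω g v (r y)
  linarith

/-- Nondegeneracy provides the vector. It lies in ker ds because it is orthogonal to ker dt. -/
theorem exists_vector (hΩ : Γ.IsMultiplicative Ω) (hs : IsSymplectic Ω) (g : G) (α : E →L[ℝ] ℝ) :
    ∃ v ∈ Γ.kerSrc g, ∀ z, twoFormBilin Ω g v z = α (modelDeriv F E Γ.tgt g z) := by
  have hnd := twoFormBilin_nondegenerate Ω hs g
  set e := LinearMap.BilinForm.toDual (twoFormBilin Ω g) hnd
  refine ⟨e.symm ((α.comp (modelDeriv F E Γ.tgt g)).toLinearMap), ?_, fun z => ?_⟩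
  · rw [← Γ.orthogonal_kerTgt hΩ hs]
    intro w hw
    change twoFormBilin Ω g w _ = 0
    rw [twoFormBilin_skew]
    erw [LinearMap.BilinForm.apply_toDual_symm_apply]
    have : modelDeriv F E Γ.tgt g w = 0 := hw
    change - α (modelDeriv F E Γ.tgt g w) = 0
    rw [this, map_zero, neg_zero]
  · erw [LinearMap.BilinForm.apply_toDual_symm_apply]
    rfl

variable {Γ} {P : ∀ x : M, Cotangent E x →ₗ[ℝ] Cotangent E x →ₗ[ℝ] ℝ}
  (hΓ : Γ.IsSymplecticGroupoid Ω P)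
include hΓ

/-- The Poisson condition on t, made explicit: dt(v) = −Π♯α whenever Ω(v, ·) = t^*α. The sign comes
from the convention Ω(v, ·) for Hamiltonian vectors. -/
theorem IsSymplecticGroupoid.poisson_apply {g : G} {v : F} {α : E →L[ℝ] ℝ}
    (hα : ∀ z, twoFormBilin Ω g v z = α (modelDeriv F E Γ.tgt g z)) (β : E →L[ℝ] ℝ) :
    P (Γ.tgt g) α β = - β (modelDeriv F E Γ.tgt g v) := by
  obtain ⟨w, -, hw⟩ := Γ.exists_vector hΓ.isMultiplicative hΓ.isSymplectic g β
  have h1 : P (Γ.tgt g) α β = twoFormBilin Ω g v w := hΓ.targetIsPoisson g α β v w hα hw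
  rw [h1, twoFormBilin_skew, hw]

theorem IsSymplecticGroupoid.isSharp {g : G} {v : F} {α : E →L[ℝ] ℝ}
    (hα : ∀ z, twoFormBilin Ω g v z = α (modelDeriv F E Γ.tgt g z)) :
    IsSharp P (Γ.tgt g) (-α : E →L[ℝ] ℝ) (modelDeriv F E Γ.tgt g v : E) := by
  intro β
  have h := hΓ.poisson_apply hα β
  have h2 : P (Γ.tgt g) (-α : E →L[ℝ] ℝ) β = - P (Γ.tgt g) α β := by
    have := (P (Γ.tgt g)).map_neg α
    exact LinearMap.congr_fun this β
  rw [h2, h, neg_neg]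
  rfl

/-- The two signs in dt(v) = −Π♯α and dt(w) = −Π♯β cancel. The covectors chosen in `leafForm` do not
matter: skewness and the defining property of Π♯ allow each to be replaced by any other covector
with the same sharp. -/
theorem IsSymplecticGroupoid.leafForm_apply {g : G} {v w : F} (hv : v ∈ Γ.kerSrc g)
    (hw : w ∈ Γ.kerSrc g) :
    leafForm P (Γ.tgt g) (modelDeriv F E Γ.tgt g v : E) (modelDeriv F E Γ.tgt g w : E) =
      twoFormBilin Ω g v w := by
  obtain ⟨α, hα⟩ := Γ.exists_covector hΓ.isMultiplicative hv
  obtain ⟨β, hβ⟩ := Γ.exists_covector hΓ.isMultiplicative hw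
  have hv' := hΓ.isSharp hα
  have hw' := hΓ.isSharp hβ
  have h : (∃ α, IsSharp P (Γ.tgt g) α (modelDeriv F E Γ.tgt g v : E)) ∧
    ∃ β, IsSharp P (Γ.tgt g) β (modelDeriv F E Γ.tgt g w : E) := ⟨⟨_, hv'⟩, ⟨_, hw'⟩⟩
  refine (dif_pos h).trans ?_
  have hs := hΓ.isPoisson.skew (Γ.tgt g)
  have h1 := Classical.choose_spec h.1 (Classical.choose h.2)
  have h2 := hv' (Classical.choose h.2)
  have h3 := Classical.choose_spec h.2 (-α : E →L[ℝ] ℝ)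
  refine h1.trans (h2.symm.trans ((hs _ _).trans ((congrArg Neg.neg h3).trans ?_)))
  rw [hα]
  exact neg_neg _

/-- The tangent space of the leaf at the target of `g`. -/
theorem IsSymplecticGroupoid.finrank_range_poisson (g : G) :
    Module.finrank ℝ (LinearMap.range (P (Γ.tgt g))) =
      Module.finrank ℝ ((Γ.kerSrc g).map (modelDeriv F E Γ.tgt g).toLinearMap) := by
  -- `P` takes values in linear forms on covectors, so tangent vectors are compared with its range
  -- through evaluation, which is injective because covectors separate points.
  set ev : E →ₗ[ℝ] (E →L[ℝ] ℝ) →ₗ[ℝ] ℝ :=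
    { toFun := fun v =>
        { toFun := fun β => β v
          map_add' := fun _ _ => rfl
          map_smul' := fun _ _ => rfl }
      map_add' := fun v w => by ext β; exact map_add β v w
      map_smul' := fun c v => by ext β; exact map_smul β c v } with hev
  have hinj : Function.Injective ev := by
    intro v w h
    rw [← sub_eq_zero]
    by_contra hne
    obtain ⟨β, -, hβ⟩ := exists_dual_vector ℝ (v - w) (norm_ne_zero_iff.2 hne)
    have h2 : β v = β w := LinearMap.congr_fun h β
    have h3 : β (v - w) = ‖v - w‖ := hβ
    rw [map_sub, h2, sub_self] at h3
    exact (norm_pos_iff.2 hne).ne h3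
  have hr : LinearMap.range (P (Γ.tgt g)) =
      ((Γ.kerSrc g).map (modelDeriv F E Γ.tgt g).toLinearMap).map ev := by
    ext x
    constructor
    · rintro ⟨α, rfl⟩
      obtain ⟨v, hv, hα⟩ := Γ.exists_vector hΓ.isMultiplicative hΓ.isSymplectic g α
      refine ⟨_, ⟨-v, neg_mem hv, rfl⟩, ?_⟩
      refine LinearMap.ext fun β => ?_
      have := hΓ.poisson_apply hα β
      change β (modelDeriv F E Γ.tgt g (-v)) = _
      rw [map_neg, map_neg]
      exact this.symm
    · rintro ⟨_, ⟨v, hv, rfl⟩, rfl⟩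
      obtain ⟨α, hα⟩ := Γ.exists_covector hΓ.isMultiplicative hv
      exact ⟨(-α : E →L[ℝ] ℝ), LinearMap.ext fun β => hΓ.isSharp hα β⟩
  have h1 := LinearEquiv.finrank_eq (Submodule.equivMapOfInjective ev hinj
    ((Γ.kerSrc g).map (modelDeriv F E Γ.tgt g).toLinearMap))
  rw [← hr] at h1
  exact h1.symm

omit [FiniteDimensional ℝ E] hΓ in
theorem finrank_map_add_finrank_inf (g : G) :
    Module.finrank ℝ ((Γ.kerSrc g).map (modelDeriv F E Γ.tgt g).toLinearMap) +
      Module.finrank ℝ (Γ.kerSrc g ⊓ Γ.kerTgt g : Submodule ℝ F) =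
      Module.finrank ℝ (Γ.kerSrc g) := by
  have h := LinearMap.finrank_range_add_finrank_ker
    ((modelDeriv F E Γ.tgt g).toLinearMap.domRestrict (Γ.kerSrc g))
  rw [LinearMap.range_domRestrict] at h
  rw [← h]
  congr 1
  have e := Submodule.equivMapOfInjective (Γ.kerSrc g).subtype (Submodule.subtype_injective _)
    (LinearMap.ker ((modelDeriv F E Γ.tgt g).toLinearMap.domRestrict (Γ.kerSrc g)))
  have he : (Γ.kerSrc g ⊓ Γ.kerTgt g : Submodule ℝ F) = Submodule.map (Γ.kerSrc g).subtype
      (LinearMap.ker ((modelDeriv F E Γ.tgt g).toLinearMap.domRestrict (Γ.kerSrc g))) := by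
    ext x
    constructor
    · exact fun ⟨h1, h2⟩ => ⟨⟨x, h1⟩, h2, rfl⟩
    · rintro ⟨y, hy, rfl⟩
      exact ⟨y.2, hy⟩
  rw [e.finrank_eq, he]

/-- Shows that the halving in `leafHalfDim` loses nothing. On a complement of ker ds ∩ ker dt in ker
ds the form Ω is nondegenerate, because the orthogonal of ker ds is ker dt. Such a complement has
even dimension, equal to that of dt(ker ds). -/
theorem IsSymplecticGroupoid.finrank_leaf (g : G) :
    Module.finrank ℝ ((Γ.kerSrc g).map (modelDeriv F E Γ.tgt g).toLinearMap) =
      2 * leafHalfDim P (Γ.tgt g) := by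
  obtain ⟨W, hW⟩ := (Submodule.comap (Γ.kerSrc g).subtype
    (Γ.kerSrc g ⊓ Γ.kerTgt g)).exists_isCompl
  have hkey : ∀ v ∈ Γ.kerSrc g, (∀ w : W, twoFormBilin Ω g v w = 0) → v ∈ Γ.kerTgt g := by
    intro v hv h
    rw [← Γ.orthogonal_kerSrc hΓ.isMultiplicative hΓ.isSymplectic]
    intro z hz
    change twoFormBilin Ω g z v = 0
    have h1 : (⟨z, hz⟩ : Γ.kerSrc g) ∈ Submodule.comap (Γ.kerSrc g).subtype
        (Γ.kerSrc g ⊓ Γ.kerTgt g) ⊔ W := by rw [hW.sup_eq_top]; trivial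
    obtain ⟨a, ha, b, hb, hab⟩ := Submodule.mem_sup.1 h1
    have hz' : z = (a : F) + b := congrArg Subtype.val hab.symm
    rw [twoFormBilin_skew, hz', map_add, h ⟨b, hb⟩, add_zero, twoFormBilin_skew, neg_neg]
    exact Γ.twoFormBilin_kerTgt_kerSrc hΓ.isMultiplicative ha.2 hv
  obtain ⟨r, s, t, hr, -⟩ := exists_symplectic_family (Module.finrank ℝ W) W
    ((twoFormBilin Ω g).compl₁₂ ((Γ.kerSrc g).subtype ∘ₗ W.subtype)
      ((Γ.kerSrc g).subtype ∘ₗ W.subtype))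
    (fun v w => twoFormBilin_skew Ω g _ _)
    (fun v hv => by
      have h1 := hkey v v.1.2 hv
      have h2 : (v : Γ.kerSrc g) ∈ Submodule.comap (Γ.kerSrc g).subtype
        (Γ.kerSrc g ⊓ Γ.kerTgt g) ⊓ W := ⟨⟨v.1.2, h1⟩, v.2⟩
      rw [hW.inf_eq_bot] at h2
      exact Subtype.ext h2) rfl
  have h1 := Submodule.finrank_add_eq_of_isCompl hW
  have h2 : Module.finrank ℝ (Submodule.comap (Γ.kerSrc g).subtype (Γ.kerSrc g ⊓ Γ.kerTgt g)) =
      Module.finrank ℝ (Γ.kerSrc g ⊓ Γ.kerTgt g : Submodule ℝ F) :=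
    (Submodule.comapSubtypeEquivOfLe inf_le_left).finrank_eq
  have h3 := finrank_map_add_finrank_inf (Γ := Γ) g
  rw [leafHalfDim, hΓ.finrank_range_poisson g]
  omega

omit [FiniteDimensional ℝ E] hΓ in
-- Inversion exchanges source and target, and its derivative is injective because inversion is an
-- involution.
theorem finrank_inf_inv_le (g : G) :
    Module.finrank ℝ (Γ.kerSrc g ⊓ Γ.kerTgt g : Submodule ℝ F) ≤
      Module.finrank ℝ (Γ.kerSrc (Γ.inv g) ⊓ Γ.kerTgt (Γ.inv g) : Submodule ℝ F) := by
  have hd : ∀ g, MDifferentiableAt 𝓘(ℝ, F) 𝓘(ℝ, F) Γ.inv g := fun g =>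
    Γ.contMDiff_inv.mdifferentiable (by simp) g
  have h1 := modelDeriv_comp (hd (Γ.inv g)) (hd g)
  rw [modelDeriv_of_eqOn_id (f := Γ.inv ∘ Γ.inv) isOpen_univ (mem_univ g)
    (fun y _ => Γ.inv_inv y)] at h1
  have hinj : Function.Injective (modelDeriv F F Γ.inv g).toLinearMap :=
    Function.LeftInverse.injective (g := modelDeriv F F Γ.inv (Γ.inv g))
      (fun v => (DFunLike.congr_fun h1 v).symm)
  have h2 := modelDeriv_comp (mdifferentiableAt_of_isSubmersion Γ.isSubmersion_src (Γ.inv g)) (hd g)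
  have h3 := modelDeriv_comp (mdifferentiableAt_of_isSubmersion Γ.isSubmersion_tgt (Γ.inv g)) (hd g)
  rw [show Γ.src ∘ Γ.inv = Γ.tgt from funext Γ.src_inv] at h2
  rw [show Γ.tgt ∘ Γ.inv = Γ.src from funext Γ.tgt_inv] at h3
  rw [LinearEquiv.finrank_eq (Submodule.equivMapOfInjective (modelDeriv F F Γ.inv g).toLinearMap
    hinj (Γ.kerSrc g ⊓ Γ.kerTgt g))]
  refine Submodule.finrank_mono ?_
  rintro _ ⟨v, ⟨hv1, hv2⟩, rfl⟩
  exact ⟨(DFunLike.congr_fun h2 v).symm.trans hv2, (DFunLike.congr_fun h3 v).symm.trans hv1⟩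

/-- The leaf dimension at t(g) is read off from ker ds ∩ ker dt at g, the one at s(g) from the same
space at g⁻¹. -/
theorem IsSymplecticGroupoid.leafHalfDim_tgt (g : G) :
    leafHalfDim P (Γ.tgt g) = leafHalfDim P (Γ.src g) := by
  have h1 := hΓ.finrank_leaf g
  have h2 := hΓ.finrank_leaf (Γ.inv g)
  rw [Γ.tgt_inv] at h2
  have h3 := finrank_inf_inv_le (Γ := Γ) g
  have h4 := finrank_inf_inv_le (Γ := Γ) (Γ.inv g)
  rw [Γ.inv_inv] at h4
  have h5 := finrank_map_add_finrank_inf (Γ := Γ) g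
  have h6 := finrank_map_add_finrank_inf (Γ := Γ) (Γ.inv g)
  have h7 := Γ.finrank_kerSrc_add g
  have h8 := Γ.finrank_kerSrc_add (Γ.inv g)
  omega

end Symplectic

end LieGroupoid

namespace LieGroupoid

variable {E F G M : Type*}
  [NormedAddCommGroup E] [NormedSpace ℝ E] [NormedAddCommGroup F] [NormedSpace ℝ F]
  [FiniteDimensional ℝ E] [FiniteDimensional ℝ F]
  [TopologicalSpace M] [ChartedSpace E M]
  [TopologicalSpace G] [ChartedSpace F G]
  {Γ : LieGroupoid E F G M} {Ω : ∀ g : G, TangentSpace 𝓘(ℝ, F) g [⋀^Fin 2]→L[ℝ] ℝ}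
  {P : ∀ x : M, Cotangent E x →ₗ[ℝ] Cotangent E x →ₗ[ℝ] ℝ}

variable (Γ P) in
/-- The density of the symplectic volume of the leaves in the parametrization `t ∘ σ`. -/
def leafDensity (r : ℕ) (σ : EuclideanSpace ℝ (Fin (2 * r)) → G)
    (u : EuclideanSpace ℝ (Fin (2 * r))) : ℝ :=
  |wedgePow r (leafForm P (Γ.tgt (σ u))) (fun i =>
    mfderiv 𝓘(ℝ, EuclideanSpace ℝ (Fin (2 * r))) 𝓘(ℝ, E) (Γ.tgt ∘ σ) u
      (EuclideanSpace.single i (1 : ℝ)))|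

variable (Ω) in
/-- The pullback of the 2-form `Ω` under `σ`. -/
def pullbackForm {H : Type*} [NormedAddCommGroup H] [NormedSpace ℝ H] (σ : H → G) (u : H) :
    H →ₗ[ℝ] H →ₗ[ℝ] ℝ :=
  (twoFormBilin Ω (σ u)).compl₁₂ (modelDeriv H F σ u).toLinearMap (modelDeriv H F σ u).toLinearMap

/-! ### The density of the symplectic volume in a parametrization of the orbit -/

section Density

variable (hΓ : Γ.IsSymplecticGroupoid Ω P) {m : M}
include hΓ

/-- Replaces the leaf form, which is defined by choice, by the pullback of Ω, which is bilinear and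
smooth. -/
theorem IsSymplecticGroupoid.leafForm_pullback {H : Type*} [NormedAddCommGroup H] [NormedSpace ℝ H]
    {U : Set H} (hU : IsOpen U) {σ : H → G} (hσ : ContMDiffOn 𝓘(ℝ, H) 𝓘(ℝ, F) ∞ σ U)
    (hm : MapsTo σ U (Γ.src ⁻¹' {m})) {u : H} (hu : u ∈ U) (v w : H) :
    leafForm P (Γ.tgt (σ u)) (modelDeriv H E (Γ.tgt ∘ σ) u v : E)
      (modelDeriv H E (Γ.tgt ∘ σ) u w : E) = pullbackForm Ω σ u v w := by
  have hd := mdifferentiableAt_of_contMDiffOn hU hu hσ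
  rw [modelDeriv_comp (mdifferentiableAt_of_isSubmersion Γ.isSubmersion_tgt _) hd]
  exact hΓ.leafForm_apply
    (modelDeriv_apply_of_mapsTo_fiber Γ.isSubmersion_src hU hσ hm hu v)
    (modelDeriv_apply_of_mapsTo_fiber Γ.isSubmersion_src hU hσ hm hu w)

variable {r : ℕ} {U : Set (EuclideanSpace ℝ (Fin (2 * r)))} (hU : IsOpen U)
  {σ : EuclideanSpace ℝ (Fin (2 * r)) → G}
  (hσ : ContMDiffOn 𝓘(ℝ, EuclideanSpace ℝ (Fin (2 * r))) 𝓘(ℝ, F) ∞ σ U)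
  (hm : MapsTo σ U (Γ.src ⁻¹' {m}))

include hU hσ hm

theorem IsSymplecticGroupoid.leafDensity_eq {u} (hu : u ∈ U) :
    Γ.leafDensity P r σ u = |wedgePow r (fun x y => pullbackForm Ω σ u x y)
      (fun i => EuclideanSpace.single i (1 : ℝ))| := by
  rw [leafDensity]
  congr 1
  simp only [wedgePow]
  congr 1
  refine Finset.sum_congr rfl fun s _ => ?_
  congr 1
  refine Finset.prod_congr rfl fun i _ => ?_
  exact hΓ.leafForm_pullback hU hσ hm hu _ _

/-- The leaf form depends only on the point of the leaf, so the pullbacks by both parametrizations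
correspond under the derivative of the change of variables; the top wedge power then picks up its
determinant. -/
theorem IsSymplecticGroupoid.leafDensity_transition {U' : Set (EuclideanSpace ℝ (Fin (2 * r)))}
    (hU' : IsOpen U') {σ' : EuclideanSpace ℝ (Fin (2 * r)) → G}
    (hσ' : ContMDiffOn 𝓘(ℝ, EuclideanSpace ℝ (Fin (2 * r))) 𝓘(ℝ, F) ∞ σ' U')
    (hm' : MapsTo σ' U' (Γ.src ⁻¹' {m}))
    {T : EuclideanSpace ℝ (Fin (2 * r)) → EuclideanSpace ℝ (Fin (2 * r))} {u}
    (hu : u ∈ U) {T' : EuclideanSpace ℝ (Fin (2 * r)) →L[ℝ] EuclideanSpace ℝ (Fin (2 * r))}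
    (hT : HasFDerivAt T T' u) (hTu : T u ∈ U')
    (h : Γ.tgt ∘ σ =ᶠ[𝓝 u] (Γ.tgt ∘ σ') ∘ T) :
    Γ.leafDensity P r σ u = |T'.det| * Γ.leafDensity P r σ' (T u) := by
  have h1 : modelDeriv (EuclideanSpace ℝ (Fin (2 * r))) E (Γ.tgt ∘ σ) u =
      (modelDeriv (EuclideanSpace ℝ (Fin (2 * r))) E (Γ.tgt ∘ σ') (T u)).comp T' := by
    have hd : MDifferentiableAt 𝓘(ℝ, EuclideanSpace ℝ (Fin (2 * r))) 𝓘(ℝ, E) (Γ.tgt ∘ σ') (T u) :=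
      (mdifferentiableAt_of_isSubmersion Γ.isSubmersion_tgt _).comp _
        (mdifferentiableAt_of_contMDiffOn hU' hTu hσ')
    rw [modelDeriv_congr h, modelDeriv_comp hd hT.hasMFDerivAt.mdifferentiableAt,
      modelDeriv_eq_of_hasMFDerivAt hT.hasMFDerivAt]
  have h2 : ∀ x y : M, x = y → ∀ v w : E, leafForm P x v w = leafForm P y v w := by
    rintro x _ rfl v w; rfl
  have h3 : ∀ v w, pullbackForm Ω σ u v w = pullbackForm Ω σ' (T u) (T' v) (T' w) := by
    intro v w
    rw [← hΓ.leafForm_pullback hU hσ hm hu, ← hΓ.leafForm_pullback hU' hσ' hm' hTu, h1]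
    exact h2 _ _ h.self_of_nhds _ _
  rw [hΓ.leafDensity_eq hU hσ hm hu, hΓ.leafDensity_eq hU' hσ' hm' hTu, ← abs_mul]
  congr 1
  have h4 := wedgePow_map r (pullbackForm Ω σ' (T u)) T'.toLinearMap
  rw [ContinuousLinearMap.det, ← h4]
  simp only [wedgePow, h3]
  rfl

/-- By dimension the immersion `t ∘ σ` reaches all of dt(ker ds), so ker ds is spanned by velocities
of `σ` and by ker ds ∩ ker dt. A vector in the radical of the pullback thus has velocity orthogonal
to ker ds, hence in ker dt, and the immersion kills it. -/
theorem IsSymplecticGroupoid.leafDensity_pos (hr : r = leafHalfDim P m) {u} (hu : u ∈ U)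
    (hinj : Function.Injective (modelDeriv (EuclideanSpace ℝ (Fin (2 * r))) E (Γ.tgt ∘ σ) u)) :
    0 < Γ.leafDensity P r σ u := by
  rw [hΓ.leafDensity_eq hU hσ hm hu, abs_pos]
  refine wedgePow_ne_zero _ (fun v w => twoFormBilin_skew Ω _ _ _) fun v hv => ?_
  have hd := mdifferentiableAt_of_contMDiffOn hU hu hσ
  have hc := modelDeriv_comp (mdifferentiableAt_of_isSubmersion Γ.isSubmersion_tgt (σ u)) hd
  have hks : ∀ v, modelDeriv (EuclideanSpace ℝ (Fin (2 * r))) F σ u v ∈ Γ.kerSrc (σ u) := fun v =>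
    modelDeriv_apply_of_mapsTo_fiber Γ.isSubmersion_src hU hσ hm hu v
  have hrange : LinearMap.range
      (modelDeriv (EuclideanSpace ℝ (Fin (2 * r))) E (Γ.tgt ∘ σ) u).toLinearMap =
      (Γ.kerSrc (σ u)).map (modelDeriv F E Γ.tgt (σ u)).toLinearMap := by
    refine Submodule.eq_of_le_of_finrank_eq ?_ ?_
    · rintro _ ⟨w, rfl⟩
      exact ⟨_, hks w, (DFunLike.congr_fun hc w).symm⟩
    · rw [LinearMap.finrank_range_of_inj hinj, hΓ.finrank_leaf, hΓ.leafHalfDim_tgt,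
        show Γ.src (σ u) = m from hm hu, hr]
      simp
  have hvt : modelDeriv (EuclideanSpace ℝ (Fin (2 * r))) F σ u v ∈ Γ.kerTgt (σ u) := by
    rw [← Γ.orthogonal_kerSrc hΓ.isMultiplicative hΓ.isSymplectic]
    intro z hz
    change twoFormBilin Ω (σ u) z _ = 0
    have h1 : modelDeriv F E Γ.tgt (σ u) z ∈
        LinearMap.range
          (modelDeriv (EuclideanSpace ℝ (Fin (2 * r))) E (Γ.tgt ∘ σ) u).toLinearMap := by
      rw [hrange]; exact ⟨z, hz, rfl⟩
    obtain ⟨w, hw⟩ := h1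
    have h2 : modelDeriv F E Γ.tgt (σ u) (modelDeriv (EuclideanSpace ℝ (Fin (2 * r))) F σ u w) =
        modelDeriv F E Γ.tgt (σ u) z :=
      (DFunLike.congr_fun hc w).symm.trans hw
    have h3 : z - modelDeriv (EuclideanSpace ℝ (Fin (2 * r))) F σ u w ∈ Γ.kerTgt (σ u) := by
      rw [kerTgt, LinearMap.mem_ker]
      change modelDeriv F E Γ.tgt (σ u) _ = 0
      rw [map_sub, h2, sub_self]
    have h4 := Γ.twoFormBilin_kerTgt_kerSrc hΓ.isMultiplicative h3 (hks v)
    rw [map_sub, LinearMap.sub_apply, sub_eq_zero] at h4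
    rw [h4, twoFormBilin_skew, neg_eq_zero]
    exact hv w
  apply hinj
  rw [map_zero]
  exact (DFunLike.congr_fun hc v).trans hvt

omit [FiniteDimensional ℝ E] hm in
theorem IsSymplecticGroupoid.contDiffOn_pullbackForm [IsManifold 𝓘(ℝ, F) ∞ G]
    (v w : EuclideanSpace ℝ (Fin (2 * r))) :
    ContDiffOn ℝ ∞ (fun u => pullbackForm Ω σ u v w) U := by
  intro u₀ hu₀
  set χ := extChartAt 𝓘(ℝ, F) (σ u₀) with hχ
  set U' := U ∩ σ ⁻¹' χ.source with hU'd
  have hU' : IsOpen U' :=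
    hσ.continuousOn.isOpen_inter_preimage hU (isOpen_extChartAt_source _)
  have hu₀' : u₀ ∈ U' := ⟨hu₀, mem_extChartAt_source _⟩
  have hτ : ContDiffOn ℝ ∞ (χ ∘ σ) U' := by
    rw [← contMDiffOn_iff_contDiffOn]
    exact (contMDiffOn_extChartAt (x := σ u₀)).comp (hσ.mono inter_subset_left)
      (fun u hu => by simpa [hχ] using hu.2)
  set c : F → F [⋀^Fin 2]→L[ℝ] ℝ := chartForm Ω (σ u₀) with hc
  have hcs : ContDiffOn ℝ ∞ c χ.target := hΓ.isSymplectic.smooth (σ u₀)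
  have hct : ContDiffOn ℝ ∞ (fun u => c (χ (σ u))) U' :=
    hcs.comp hτ (fun u hu => χ.map_source hu.2)
  have hfd : ∀ x : EuclideanSpace ℝ (Fin (2 * r)),
      ContDiffOn ℝ ∞ (fun u => fderiv ℝ (χ ∘ σ) u x) U' := fun x =>
    (hτ.fderiv_of_isOpen hU' (by simp)).clm_apply contDiffOn_const
  have key : ∀ u ∈ U', pullbackForm Ω σ u v w =
      c (χ (σ u)) ![fderiv ℝ (χ ∘ σ) u v, fderiv ℝ (χ ∘ σ) u w] := by
    intro u hu
    have hsymm : MDifferentiableAt 𝓘(ℝ, F) 𝓘(ℝ, F) χ.symm (χ (σ u)) :=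
      mdifferentiableAt_of_contMDiffOn (isOpen_extChartAt_target _) (χ.map_source hu.2)
        (contMDiffOn_extChartAt_symm _)
    have hτd : MDifferentiableAt 𝓘(ℝ, EuclideanSpace ℝ (Fin (2 * r))) 𝓘(ℝ, F) (χ ∘ σ) u :=
      mdifferentiableAt_of_contMDiffOn hU' hu hτ.contMDiffOn
    have h1 := modelDeriv_comp (f := χ.symm) (g := χ ∘ σ) hsymm hτd
    rw [modelDeriv_congr (f := χ.symm ∘ χ ∘ σ) (g := σ)
      (Filter.eventuallyEq_of_mem (hU'.mem_nhds hu)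
      (fun u hu => χ.left_inv hu.2)), modelDeriv_eq_fderiv] at h1
    have h2 : ∀ g : G, g = σ u → ∀ a b : F, twoFormBilin Ω (σ u) a b = twoFormBilin Ω g a b := by
      rintro _ rfl a b; rfl
    change twoFormBilin Ω (σ u) (modelDeriv (EuclideanSpace ℝ (Fin (2 * r))) F σ u v)
      (modelDeriv (EuclideanSpace ℝ (Fin (2 * r))) F σ u w) = _
    rw [h1, h2 (χ.symm (χ (σ u))) (χ.left_inv hu.2), twoFormBilin_apply, hc, chartForm]
    change _ = (Ω (χ.symm (χ (σ u)))) _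
    congr 1
    ext i
    fin_cases i <;> rfl
  refine ContDiffWithinAt.congr_of_eventuallyEq (f := fun u =>
    c (χ (σ u)) ![fderiv ℝ (χ ∘ σ) u v, fderiv ℝ (χ ∘ σ) u w]) ?_ ?_ (key u₀ hu₀')
  swap
  · filter_upwards [mem_nhdsWithin_of_mem_nhds (hU'.mem_nhds hu₀')] with u hu using key u hu
  -- Expansion in a basis of `F` makes the value a polynomial in smooth coefficient functions and
  -- smooth components of the two vectors.
  have hexp : ∀ (B : F [⋀^Fin 2]→L[ℝ] ℝ) (a b : F), B ![a, b] =
      ∑ i, ∑ j, (Module.finBasis ℝ F).repr a i * (Module.finBasis ℝ F).repr b j *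
        B ![Module.finBasis ℝ F i, Module.finBasis ℝ F j] := by
    intro B a b
    have h' : ∀ a b, B ![a, b] = twoFormBilin (G := F) (fun _ => B) 0 a b := fun _ _ => rfl
    simp only [h']
    conv_lhs => rw [← (Module.finBasis ℝ F).sum_repr a, ← (Module.finBasis ℝ F).sum_repr b]
    simp only [map_sum, map_smul, LinearMap.sum_apply, LinearMap.smul_apply, smul_eq_mul,
      Finset.mul_sum]
    rw [Finset.sum_comm]
    refine Finset.sum_congr rfl fun i _ => Finset.sum_congr rfl fun j _ => ?_
    ring
  refine ContDiffAt.contDiffWithinAt ?_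
  refine ContDiffOn.contDiffAt ?_ (hU'.mem_nhds hu₀')
  refine ContDiffOn.congr (f := fun u => ∑ i, ∑ j,
    (Module.finBasis ℝ F).repr (fderiv ℝ (χ ∘ σ) u v) i *
      (Module.finBasis ℝ F).repr (fderiv ℝ (χ ∘ σ) u w) j *
      c (χ (σ u)) ![Module.finBasis ℝ F i, Module.finBasis ℝ F j]) ?_ (fun u _ => hexp _ _ _)
  refine ContDiffOn.sum fun i _ => ContDiffOn.sum fun j _ => ?_
  have hrep : ∀ k, ContDiff ℝ ∞ (fun x : F => (Module.finBasis ℝ F).repr x k) := fun k =>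
    ((Module.finBasis ℝ F).coord k).toContinuousLinearMap.contDiff
  exact (((hrep i).comp_contDiffOn (hfd v)).mul ((hrep j).comp_contDiffOn (hfd w))).mul
    ((ContinuousAlternatingMap.apply ℝ F ℝ
      ![Module.finBasis ℝ F i, Module.finBasis ℝ F j]).contDiff.comp_contDiffOn hct)

/-- The absolute value does no harm because the wedge power never vanishes on an immersion. -/
theorem IsSymplecticGroupoid.contDiffOn_leafDensity [IsManifold 𝓘(ℝ, F) ∞ G]
    (hr : r = leafHalfDim P m)
    (hinj : ∀ u ∈ U, Function.Injective
      (modelDeriv (EuclideanSpace ℝ (Fin (2 * r))) E (Γ.tgt ∘ σ) u)) :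
    ContDiffOn ℝ ∞ (Γ.leafDensity P r σ) U := by
  have h1 : ContDiffOn ℝ ∞ (fun u => wedgePow r (fun x y => pullbackForm Ω σ u x y)
      (fun i => EuclideanSpace.single i (1 : ℝ))) U := by
    simp only [wedgePow]
    refine contDiffOn_const.mul (ContDiffOn.sum fun s _ => contDiffOn_const.mul
      (contDiffOn_prod fun i _ => hΓ.contDiffOn_pullbackForm hU hσ _ _))
  refine (h1.abs fun u hu => ?_).congr fun u hu => hΓ.leafDensity_eq hU hσ hm hu
  have := hΓ.leafDensity_pos hU hσ hm hr hu (hinj u hu)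
  rw [hΓ.leafDensity_eq hU hσ hm hu] at this
  exact abs_pos.1 this

end Density

end LieGroupoid

/-! ### Boxes in source fibers, sections over orbits, charts of isotropy groups -/

namespace LieGroupoid

variable {E F G M : Type*}
  [NormedAddCommGroup E] [NormedSpace ℝ E] [NormedAddCommGroup F] [NormedSpace ℝ F]
  [TopologicalSpace M] [ChartedSpace E M]
  [TopologicalSpace G] [ChartedSpace F G]

/-- A local section `sec` of the target map from an orbit to the source fiber of `m`, with a smooth
left inverse `base` of `t ∘ sec`. -/
structure OrbitSection (Γ : LieGroupoid E F G M) (m : M) (H : Type*) [NormedAddCommGroup H]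
    [NormedSpace ℝ H] where
  dom : Set H
  sec : H → G
  nhd : Set G
  base : M → H
  baseDom : Set M
  isOpen_dom : IsOpen dom
  isOpen_nhd : IsOpen nhd
  isOpen_baseDom : IsOpen baseDom
  smooth_sec : ContMDiffOn 𝓘(ℝ, H) 𝓘(ℝ, F) ∞ sec dom
  smooth_base : ContMDiffOn 𝓘(ℝ, E) 𝓘(ℝ, H) ∞ base baseDom
  mapsTo_sec : MapsTo sec dom (Γ.src ⁻¹' {m} ∩ nhd)
  tgt_mem : ∀ g ∈ Γ.src ⁻¹' {m} ∩ nhd, Γ.tgt g ∈ baseDom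
  base_mem : ∀ g ∈ Γ.src ⁻¹' {m} ∩ nhd, base (Γ.tgt g) ∈ dom
  tgt_sec_base : ∀ g ∈ Γ.src ⁻¹' {m} ∩ nhd, Γ.tgt (sec (base (Γ.tgt g))) = Γ.tgt g
  base_tgt_sec : ∀ a ∈ dom, base (Γ.tgt (sec a)) = a

variable {Γ : LieGroupoid E F G M} {Ω : ∀ g : G, TangentSpace 𝓘(ℝ, F) g [⋀^Fin 2]→L[ℝ] ℝ}
  {P : ∀ x : M, Cotangent E x →ₗ[ℝ] Cotangent E x →ₗ[ℝ] ℝ}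

section Box

variable [FiniteDimensional ℝ E] [FiniteDimensional ℝ F]

theorem IsSymplecticGroupoid.two_mul_leafHalfDim_le (hΓ : Γ.IsSymplecticGroupoid Ω P) (m : M) :
    2 * leafHalfDim P m ≤ Module.finrank ℝ F - Module.finrank ℝ E := by
  have h1 := hΓ.finrank_leaf (Γ.unit m)
  rw [Γ.tgt_unit] at h1
  have h2 := finrank_map_add_finrank_inf (Γ := Γ) (Γ.unit m)
  have h3 := Γ.finrank_kerSrc_add (Γ.unit m)
  omega

/-- The derivative of t on the source fiber has image dt(ker ds), of dimension 2r everywhere, so the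
constant rank theorem applies. The first coordinate is a smooth function of the target, defined on
an open subset of `M` and not only on the orbit. -/
theorem IsSymplecticGroupoid.exists_leafBox [IsManifold 𝓘(ℝ, E) ∞ M]
    (hΓ : Γ.IsSymplecticGroupoid Ω P) {m : M} {r n : ℕ}
    (hr : r = leafHalfDim P m) (hn : Module.finrank ℝ F - Module.finrank ℝ E = 2 * r + n)
    {g₀ : G} (hg₀ : Γ.src g₀ = m) :
    ∃ (c : SliceChart F (EuclideanSpace ℝ (Fin (2 * r)) × EuclideanSpace ℝ (Fin n))
      (Γ.src ⁻¹' {m})) (U₁ : Set (EuclideanSpace ℝ (Fin (2 * r))))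
      (U₂ : Set (EuclideanSpace ℝ (Fin n))) (p : M → EuclideanSpace ℝ (Fin (2 * r))) (V : Set M),
      g₀ ∈ c.nhd ∧ IsOpen U₁ ∧ IsOpen U₂ ∧ c.dom = U₁ ×ˢ U₂ ∧ IsOpen V ∧
      ContMDiffOn 𝓘(ℝ, E) 𝓘(ℝ, EuclideanSpace ℝ (Fin (2 * r))) ∞ p V ∧
      (∀ g ∈ Γ.src ⁻¹' {m} ∩ c.nhd, Γ.tgt g ∈ V ∧ (c.coord g).1 = p (Γ.tgt g)) ∧
      ∀ a ∈ U₁, ∀ b ∈ U₂, ∀ b' ∈ U₂, Γ.tgt (c.map (a, b)) = Γ.tgt (c.map (a, b')) := by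
  subst hg₀
  set H := EuclideanSpace ℝ (Fin (Module.finrank ℝ F - Module.finrank ℝ E)) with hH
  obtain ⟨c, hc⟩ := exists_sliceChart_of_isSubmersion Γ.isSubmersion_src g₀
  set χ := extChartAt 𝓘(ℝ, E) (Γ.tgt g₀) with hχ
  have htc : ContMDiffOn 𝓘(ℝ, H) 𝓘(ℝ, E) ∞ (Γ.tgt ∘ c.map) c.dom :=
    Γ.isSubmersion_tgt.contMDiff.comp_contMDiffOn c.smooth_map
  set W := c.dom ∩ (Γ.tgt ∘ c.map) ⁻¹' χ.source with hWd
  have hW : IsOpen W :=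
    htc.continuousOn.isOpen_inter_preimage c.isOpen_dom (isOpen_extChartAt_source _)
  have hcg := c.map_coord g₀ ⟨rfl, hc⟩
  have hw₀ : c.coord g₀ ∈ W := ⟨c.mapsTo_coord ⟨rfl, hc⟩, by
    rw [mem_preimage, Function.comp_apply, hcg]; exact mem_extChartAt_source _⟩
  set f : H → E := χ ∘ (Γ.tgt ∘ c.map) with hf
  have hfs : ContDiffOn ℝ ∞ f W := by
    rw [← contMDiffOn_iff_contDiffOn]
    exact (contMDiffOn_extChartAt (x := Γ.tgt g₀)).comp (htc.mono inter_subset_left)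
      (fun u hu => by simpa [hχ] using hu.2)
  have hrank : ∀ w ∈ W, Module.finrank ℝ (LinearMap.range (fderiv ℝ f w).toLinearMap)
      = 2 * r := by
    intro w hw
    have hχd : MDifferentiableAt 𝓘(ℝ, E) 𝓘(ℝ, E) χ ((Γ.tgt ∘ c.map) w) :=
      mdifferentiableAt_of_contMDiffOn (isOpen_extChartAt_source (I := 𝓘(ℝ, E)) (Γ.tgt g₀)) hw.2
        (by simpa [hχ] using contMDiffOn_extChartAt (I := 𝓘(ℝ, E)) (n := ∞) (x := Γ.tgt g₀))
    have hsymm : MDifferentiableAt 𝓘(ℝ, E) 𝓘(ℝ, E) χ.symm (χ ((Γ.tgt ∘ c.map) w)) :=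
      mdifferentiableAt_of_contMDiffOn (isOpen_extChartAt_target _) (χ.map_source hw.2)
        (contMDiffOn_extChartAt_symm _)
    have hinj : Function.Injective (modelDeriv E E χ ((Γ.tgt ∘ c.map) w)).toLinearMap := by
      have h1 := modelDeriv_comp hsymm hχd
      rw [modelDeriv_of_eqOn_id (f := χ.symm ∘ χ)
        (isOpen_extChartAt_source (I := 𝓘(ℝ, E)) (Γ.tgt g₀)) hw.2
        (fun y hy => χ.left_inv hy)] at h1
      exact Function.LeftInverse.injective
        (g := modelDeriv E E χ.symm (χ ((Γ.tgt ∘ c.map) w)))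
        (fun v => (DFunLike.congr_fun h1 v).symm)
    have h2 := modelDeriv_comp hχd (mdifferentiableAt_of_contMDiffOn c.isOpen_dom hw.1 htc)
    have h3 := modelDeriv_comp (mdifferentiableAt_of_isSubmersion Γ.isSubmersion_tgt (c.map w))
      (c.mdifferentiableAt_map hw.1)
    have h4 : LinearMap.range (fderiv ℝ f w).toLinearMap =
        ((Γ.kerSrc (c.map w)).map (modelDeriv F E Γ.tgt (c.map w)).toLinearMap).map
          (modelDeriv E E χ ((Γ.tgt ∘ c.map) w)).toLinearMap := by
      rw [← modelDeriv_eq_fderiv, h2, h3, kerSrc,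
        ← c.range_modelDeriv_map Γ.isSubmersion_src (by simp) hw.1]
      rw [← LinearMap.range_comp, ← LinearMap.range_comp]
      rfl
    rw [h4, ← (Submodule.equivMapOfInjective _ hinj _).finrank_eq, hΓ.finrank_leaf,
      hΓ.leafHalfDim_tgt, show Γ.src (c.map w) = Γ.src g₀ from (c.mapsTo_map hw.1).1, hr]
  obtain ⟨p, e, U₁, U₂, hU₁, hU₂, hes, hw₀e, het, hesm, hesm', hp, hcon⟩ :=
    exists_coordinates_of_constant_rank hW hw₀ hfs (n := n) (by simpa [hH] using hn) hrank
  -- The coordinate map is continuous only along the fiber, so the preimage of the box is relatively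
  -- open and has to be written as the trace of an open set of arrows.
  obtain ⟨N, hN, hNe⟩ := continuousOn_iff'.1 c.smooth_coord.continuousOn e.source e.open_source
  have hNiff : ∀ g ∈ Γ.src ⁻¹' {Γ.src g₀} ∩ c.nhd, g ∈ N ↔ c.coord g ∈ e.source := fun g hg => by
    have := Set.ext_iff.1 hNe g
    simp only [mem_inter_iff, mem_preimage] at this hg
    tauto
  refine ⟨c.trans e (fun w hw => (hes hw).1) hesm hesm' N hN hNiff, U₁, U₂, p ∘ χ, χ.source,
    ⟨hc, (hNiff g₀ ⟨rfl, hc⟩).2 hw₀e⟩, hU₁, hU₂, het, isOpen_extChartAt_source _, ?_, ?_, ?_⟩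
  · exact p.contDiff.contMDiff.comp_contMDiffOn
      (by simpa [hχ] using contMDiffOn_extChartAt (I := 𝓘(ℝ, E)) (n := ∞) (x := Γ.tgt g₀))
  · rintro g ⟨hg, hgc, hgN⟩
    have h1 := (hNiff g ⟨hg, hgc⟩).1 hgN
    have h2 := c.map_coord g ⟨hg, hgc⟩
    refine ⟨?_, ?_⟩
    · have := (hes h1).2
      rwa [mem_preimage, Function.comp_apply, h2] at this
    · change (e (c.coord g)).1 = p (χ (Γ.tgt g))
      rw [hp _ h1, hf]
      simp only [Function.comp, h2]
  · intro a ha b hb b' hb'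
    have hmem : ∀ b ∈ U₂, e.symm (a, b) ∈ W := fun b hb => hes (e.map_target (by
      rw [het]; exact ⟨ha, hb⟩))
    exact χ.injOn (hmem b hb).2 (hmem b' hb').2 (hcon a ha b hb b' hb')

/-- A horizontal slice of the box, with second coordinate frozen at that of `g₀`. Its image under t
is the image of the whole box. -/
theorem IsSymplecticGroupoid.exists_orbitSection [IsManifold 𝓘(ℝ, E) ∞ M]
    (hΓ : Γ.IsSymplecticGroupoid Ω P) {m : M} {r : ℕ}
    (hr : r = leafHalfDim P m) {g₀ : G} (hg₀ : Γ.src g₀ = m) :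
    ∃ s : Γ.OrbitSection m (EuclideanSpace ℝ (Fin (2 * r))), g₀ ∈ s.nhd := by
  have hle := hΓ.two_mul_leafHalfDim_le m
  rw [← hr] at hle
  obtain ⟨c, U₁, U₂, p, V, hg, hU₁, hU₂, hdom, hV, hp, hcp, hcon⟩ :=
    hΓ.exists_leafBox hr (Nat.add_sub_of_le hle).symm hg₀
  have hg0 := c.mapsTo_coord ⟨hg₀, hg⟩
  rw [hdom] at hg0
  set b₀ := (c.coord g₀).2 with hb₀
  have hmem : ∀ a ∈ U₁, (a, b₀) ∈ c.dom := fun a ha => by rw [hdom]; exact ⟨ha, hg0.2⟩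
  have key : ∀ g ∈ Γ.src ⁻¹' {m} ∩ c.nhd, p (Γ.tgt g) ∈ U₁ ∧
      Γ.tgt (c.map (p (Γ.tgt g), b₀)) = Γ.tgt g := by
    intro g hg
    have h1 := c.mapsTo_coord hg
    rw [hdom] at h1
    rw [← (hcp g hg).2]
    refine ⟨h1.1, ?_⟩
    rw [hcon _ h1.1 b₀ hg0.2 (c.coord g).2 h1.2, Prod.mk.eta, c.map_coord g hg]
  exact ⟨{
    dom := U₁
    sec := fun a => c.map (a, b₀)
    nhd := c.nhd
    base := p
    baseDom := V
    isOpen_dom := hU₁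
    isOpen_nhd := c.isOpen_nhd
    isOpen_baseDom := hV
    smooth_sec := c.smooth_map.comp
      (contDiff_id.prodMk contDiff_const).contMDiff.contMDiffOn (fun a ha => hmem a ha)
    smooth_base := hp
    mapsTo_sec := fun a ha => c.mapsTo_map (hmem a ha)
    tgt_mem := fun g hg => (hcp g hg).1
    base_mem := fun g hg => (key g hg).1
    tgt_sec_base := fun g hg => (key g hg).2
    base_tgt_sec := fun a ha => by
      rw [← (hcp _ (c.mapsTo_map (hmem a ha))).2, c.coord_map _ (hmem a ha)] }, hg⟩

/-- The vertical slice of the box through the unit. The first coordinate is a function of the target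
and the target is a function of the first coordinate, so this slice is exactly the part of the
isotropy group inside the box. -/
theorem IsSymplecticGroupoid.exists_isotropyChart [IsManifold 𝓘(ℝ, E) ∞ M]
    (hΓ : Γ.IsSymplecticGroupoid Ω P) {m : M} {r n : ℕ}
    (hr : r = leafHalfDim P m) (hn : Module.finrank ℝ F - Module.finrank ℝ E = 2 * r + n) :
    ∃ c : SliceChart F (EuclideanSpace ℝ (Fin n)) {g : G | Γ.src g = m ∧ Γ.tgt g = m},
      Γ.unit m ∈ c.nhd := by
  obtain ⟨c, U₁, U₂, p, V, hg, hU₁, hU₂, hdom, hV, hp, hcp, hcon⟩ :=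
    hΓ.exists_leafBox hr hn (Γ.src_unit m)
  have hg0 := c.mapsTo_coord ⟨Γ.src_unit m, hg⟩
  have ha₀ : (c.coord (Γ.unit m)).1 = p m := by
    rw [(hcp _ ⟨Γ.src_unit m, hg⟩).2, Γ.tgt_unit]
  rw [hdom] at hg0
  have hpU : p m ∈ U₁ := ha₀ ▸ hg0.1
  have hmem : ∀ b ∈ U₂, (p m, b) ∈ c.dom := fun b hb => by rw [hdom]; exact ⟨hpU, hb⟩
  have hK : ∀ g, g ∈ {g : G | Γ.src g = m ∧ Γ.tgt g = m} ∩ c.nhd →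
      g ∈ Γ.src ⁻¹' {m} ∩ c.nhd := fun g hg => ⟨hg.1.1, hg.2⟩
  have hcoord : ∀ g ∈ {g : G | Γ.src g = m ∧ Γ.tgt g = m} ∩ c.nhd,
      c.coord g = (p m, (c.coord g).2) := fun g hg => by
    refine Prod.ext ?_ rfl
    rw [(hcp g (hK g hg)).2, hg.1.2]
  exact ⟨{
    dom := U₂
    map := fun b => c.map (p m, b)
    nhd := c.nhd
    coord := fun g => (c.coord g).2
    isOpen_dom := hU₂
    isOpen_nhd := c.isOpen_nhd
    smooth_map := c.smooth_map.comp
      (contDiff_const.prodMk contDiff_id).contMDiff.contMDiffOn (fun b hb => hmem b hb)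
    smooth_coord := contDiff_snd.contMDiff.comp_contMDiffOn (c.smooth_coord.mono hK)
    mapsTo_map := fun b hb => by
      have h1 := c.mapsTo_map (hmem b hb)
      refine ⟨⟨h1.1, ?_⟩, h1.2⟩
      rw [hcon _ hpU b hb _ hg0.2, ← ha₀, Prod.mk.eta, c.map_coord _ ⟨Γ.src_unit m, hg⟩,
        Γ.tgt_unit]
    mapsTo_coord := fun g hg => by
      have h1 := c.mapsTo_coord (hK g hg)
      rw [hdom] at h1
      exact h1.2
    coord_map := fun b hb => by rw [c.coord_map _ (hmem b hb)]
    map_coord := fun g hg => by rw [← hcoord g hg, c.map_coord g (hK g hg)] }, hg⟩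

end Box

end LieGroupoid

/-! ### Gluing measures from densities in parametrizations -/

section Glue

variable {H X : Type*} [NormedAddCommGroup H] [NormedSpace ℝ H] [FiniteDimensional ℝ H]
  [MeasurableSpace H] [BorelSpace H]
  [TopologicalSpace X] [T2Space X] [MeasurableSpace X] [BorelSpace X]

theorem measurableSet_inter_preimage_of_continuousOn {A Y : Type*} [TopologicalSpace A]
    [MeasurableSpace A] [OpensMeasurableSpace A] [TopologicalSpace Y] [MeasurableSpace Y]
    [BorelSpace Y] {U : Set A} (hU : MeasurableSet U) {f : A → Y} (hf : ContinuousOn f U)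
    {B : Set Y} (hB : MeasurableSet B) : MeasurableSet (U ∩ f ⁻¹' B) := by
  have h1 : MeasurableSet (U.domRestrict f ⁻¹' B) :=
    (continuousOn_iff_continuous_domRestrict.1 hf).measurable hB
  have h2 := hU.subtype_image h1
  convert h2 using 1
  ext x
  simp only [mem_inter_iff, mem_preimage, mem_image, Subtype.exists, exists_and_right,
    exists_eq_right]
  exact ⟨fun h => ⟨h.1, h.2⟩, fun ⟨h1, h2⟩ => ⟨h1, h2⟩⟩

/-- In the injective parametrization `f` of a part of `X` by `U`, the measure `ν` has density `D`
with respect to `vol`. -/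
def HasDensity (ν : Measure X) (vol : Measure H) (U : Set H) (f : H → X) (D : H → ℝ≥0∞) : Prop :=
  ∀ A ⊆ U, MeasurableSet A → ν (f '' A) = ∫⁻ u in A, D u ∂vol

omit [FiniteDimensional ℝ H] [NormedSpace ℝ H] [BorelSpace H] [T2Space X] [BorelSpace X]
  [TopologicalSpace X] [NormedAddCommGroup H] in
theorem HasDensity.mono {ν : Measure X} {vol : Measure H} {U V : Set H} {f : H → X}
    {D : H → ℝ≥0∞} (h : HasDensity ν vol U f D) (hVU : V ⊆ U) : HasDensity ν vol V f D :=
  fun A hA hAm => h A (hA.trans hVU) hAm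

omit [NormedSpace ℝ H] [FiniteDimensional ℝ H] [T2Space X] in
theorem HasDensity.aemeasurable_withDensity {vol : Measure H} {U : Set H} {f : H → X}
    (hU : MeasurableSet U) (hf : ContinuousOn f U) (D : H → ℝ≥0∞) :
    AEMeasurable f ((vol.restrict U).withDensity D) :=
  (hf.aemeasurable hU).mono_ac (withDensity_absolutelyContinuous _ _)

omit [NormedSpace ℝ H] [FiniteDimensional ℝ H] [T2Space X] in
-- Passes from values on images of sets to a pushforward of measures, so that integrals over the
-- parametrized part can be computed.
theorem HasDensity.restrict_image {ν : Measure X} {vol : Measure H} {U : Set H} {f : H → X}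
    {D : H → ℝ≥0∞} (h : HasDensity ν vol U f D) (hU : MeasurableSet U) (hf : ContinuousOn f U) :
    ν.restrict (f '' U) = ((vol.restrict U).withDensity D).map f := by
  ext B hB
  rw [Measure.restrict_apply hB,
    Measure.map_apply_of_aemeasurable (HasDensity.aemeasurable_withDensity hU hf D) hB]
  have hA := measurableSet_inter_preimage_of_continuousOn hU hf hB
  have h1 : B ∩ f '' U = f '' (U ∩ f ⁻¹' B) := by
    rw [inter_comm, image_inter_preimage]
  rw [h1, h _ inter_subset_left hA]
  have hnull : NullMeasurableSet (f ⁻¹' B) (vol.restrict U) :=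
    (hf.aemeasurable hU).nullMeasurable hB
  rw [withDensity_apply₀ _ hnull, Measure.restrict_restrict₀ hnull, inter_comm]

omit [NormedSpace ℝ H] [FiniteDimensional ℝ H] [T2Space X] in
theorem HasDensity.setLIntegral_image {ν : Measure X} {vol : Measure H} {U : Set H} {f : H → X}
    {D : H → ℝ≥0∞} (h : HasDensity ν vol U f D) (hU : MeasurableSet U) (hf : ContinuousOn f U)
    (hD : AEMeasurable D (vol.restrict U)) {g : X → ℝ≥0∞} (hg : Measurable g) :
    ∫⁻ x in f '' U, g x ∂ν = ∫⁻ u in U, D u * g (f u) ∂vol := by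
  rw [h.restrict_image hU hf,
    lintegral_map' hg.aemeasurable (HasDensity.aemeasurable_withDensity hU hf D)]
  exact lintegral_withDensity_eq_lintegral_mul₀ hD (hg.comp_aemeasurable (hf.aemeasurable hU))

/-- Two parametrizations with their densities, related by a change of variables. -/
def DensitiesCompatible (U V : Set H) (f g : H → X) (D D' : H → ℝ≥0∞) : Prop :=
  ∃ (T : H → H) (T' : H → H →L[ℝ] H), ∀ u ∈ U, f u ∈ g '' V →
    T u ∈ V ∧ g (T u) = f u ∧ HasFDerivAt T (T' u) u ∧ D u = ENNReal.ofReal |(T' u).det| * D' (T u)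

omit [TopologicalSpace X] [T2Space X] [MeasurableSpace X] [BorelSpace X] in
-- The change of variables formula for the transition map, which is injective because both
-- parametrizations are.
theorem DensitiesCompatible.setLIntegral_eq {vol : Measure H} [vol.IsAddHaarMeasure] {U V : Set H}
    {f g : H → X} {D D' : H → ℝ≥0∞} (h : DensitiesCompatible U V f g D D')
    (hf : InjOn f U) (hg : InjOn g V) {A : Set H} (hA : A ⊆ U) (hAm : MeasurableSet A)
    (hfg : f '' A ⊆ g '' V) :
    ∫⁻ u in A, D u ∂vol = ∫⁻ u in V ∩ g ⁻¹' (f '' A), D' u ∂vol := by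
  obtain ⟨T, T', hT⟩ := h
  have hA' : ∀ u ∈ A, T u ∈ V ∧ g (T u) = f u ∧ HasFDerivAt T (T' u) u ∧
    D u = ENNReal.ofReal |(T' u).det| * D' (T u) := fun u hu => hT u (hA hu) (hfg ⟨u, hu, rfl⟩)
  have himg : V ∩ g ⁻¹' (f '' A) = T '' A := by
    ext v
    constructor
    · rintro ⟨hv, u, hu, huv⟩
      exact ⟨u, hu, hg (hA' u hu).1 hv ((hA' u hu).2.1.trans huv)⟩
    · rintro ⟨u, hu, rfl⟩
      exact ⟨(hA' u hu).1, u, hu, (hA' u hu).2.1.symm⟩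
  have hTinj : InjOn T A := fun u hu v hv huv => hf (hA hu) (hA hv) (by
    rw [← (hA' u hu).2.1, huv, (hA' v hv).2.1])
  rw [himg, lintegral_image_eq_lintegral_abs_det_fderiv_mul vol hAm
    (fun u hu => (hA' u hu).2.2.1.hasFDerivWithinAt) hTinj]
  exact setLIntegral_congr_fun hAm (fun u hu => (hA' u hu).2.2.2)

variable {ι : Type*} {U : ι → Set H} {f : ι → H → X} {c : Set ι}

omit [BorelSpace H] [FiniteDimensional ℝ H] [NormedSpace ℝ H] [T2Space X] [BorelSpace X]
  [MeasurableSpace H] [TopologicalSpace X] [MeasurableSpace X] [NormedAddCommGroup H] in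
theorem iUnion_image_eq_disjointed [Nonempty ι] {e : ℕ → ι} (he : c = range e)
    (hcov : ⋃ i ∈ c, f i '' U i = ⋃ i, f i '' U i) :
    ⋃ n, disjointed (fun n => f (e n) '' U (e n)) n = ⋃ i, f i '' U i := by
  rw [iUnion_disjointed, ← hcov, he]
  simp

/-- Countably many images cover; made disjoint, they cut every Borel set into pieces, each the image
of a Borel set under one parametrization. -/
theorem measure_ext_of_parametrizations (hU : ∀ i, MeasurableSet (U i))
    (hf : ∀ i, ContinuousOn (f i) (U i)) (hinj : ∀ i, InjOn (f i) (U i))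
    (hc : c.Countable) (hcov : ⋃ i ∈ c, f i '' U i = ⋃ i, f i '' U i) {ν₁ ν₂ : Measure X}
    (h₁ : ν₁ (⋃ i, f i '' U i)ᶜ = 0) (h₂ : ν₂ (⋃ i, f i '' U i)ᶜ = 0)
    (h : ∀ i ∈ c, ∀ A ⊆ U i, MeasurableSet A → ν₁ (f i '' A) = ν₂ (f i '' A)) : ν₁ = ν₂ := by
  rcases c.eq_empty_or_nonempty with rfl | hne
  · simp only [mem_empty_iff_false, iUnion_of_empty, iUnion_empty] at hcov
    rw [← hcov, compl_empty] at h₁ h₂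
    rw [Measure.measure_univ_eq_zero.1 h₁, Measure.measure_univ_eq_zero.1 h₂]
  obtain ⟨e, he⟩ := hc.exists_eq_range hne
  have : Nonempty ι := ⟨e 0⟩
  have hcov' := iUnion_image_eq_disjointed he hcov
  set B := disjointed (fun n => f (e n) '' U (e n)) with hB
  have himg : ∀ i, MeasurableSet (f i '' U i) := fun i =>
    (hU i).image_of_continuousOn_injOn (hf i) (hinj i)
  have hBm : ∀ n, MeasurableSet (B n) := MeasurableSet.disjointed fun n => himg _
  have hS : MeasurableSet (⋃ i, f i '' U i) := by
    rw [← hcov']; exact MeasurableSet.iUnion hBm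
  ext s hs
  have hpiece : ∀ n, ν₁ (s ∩ B n) = ν₂ (s ∩ B n) := by
    intro n
    have hsub : s ∩ B n ⊆ f (e n) '' U (e n) := inter_subset_right.trans (disjointed_subset _ _)
    have h1 : s ∩ B n = f (e n) '' (U (e n) ∩ f (e n) ⁻¹' (s ∩ B n)) := by
      rw [image_inter_preimage, inter_eq_right.2 hsub]
    rw [h1]
    exact h _ (he ▸ mem_range_self n) _ inter_subset_left
      (measurableSet_inter_preimage_of_continuousOn (hU _) (hf _) (hs.inter (hBm n)))
  have hsum : ∀ ν : Measure X, ν (⋃ i, f i '' U i)ᶜ = 0 → ν s = ∑' n, ν (s ∩ B n) := by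
    intro ν hν
    have h0 : ν (s \ ⋃ i, f i '' U i) = 0 := measure_mono_null (fun x hx => hx.2) hν
    rw [← measure_inter_add_sdiff s hS, h0, add_zero, ← hcov', inter_iUnion, measure_iUnion]
    · exact fun i j hij => (disjoint_disjointed _ hij).mono inter_subset_right inter_subset_right
    · exact fun n => hs.inter (hBm n)
  rw [hsum ν₁ h₁, hsum ν₂ h₂]
  exact tsum_congr hpiece

/-- On each piece of a disjoint countable cover use the pushforward of one chosen density and add
up. The family may be uncountable: compatibility with the countably many chosen members already
gives the right density in every parametrization. -/
theorem exists_measure_of_compatible_densities (vol : Measure H) [vol.IsAddHaarMeasure]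
    (hU : ∀ i, MeasurableSet (U i))
    (hf : ∀ i, ContinuousOn (f i) (U i)) (hinj : ∀ i, InjOn (f i) (U i))
    (hc : c.Countable) (hcov : ⋃ i ∈ c, f i '' U i = ⋃ i, f i '' U i) (D : ι → H → ℝ≥0∞)
    (hD : ∀ i, ∀ j ∈ c, DensitiesCompatible (U i) (U j) (f i) (f j) (D i) (D j)) :
    ∃ ν : Measure X, ν (⋃ i, f i '' U i)ᶜ = 0 ∧ ∀ i, HasDensity ν vol (U i) (f i) (D i) := by
  rcases c.eq_empty_or_nonempty with rfl | hne
  · simp only [mem_empty_iff_false, iUnion_of_empty, iUnion_empty] at hcov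
    refine ⟨0, by simp, fun i A hA _ => ?_⟩
    have h1 : f i '' U i = ∅ := by
      rw [eq_empty_iff_forall_notMem]
      intro x hx
      have := mem_iUnion_of_mem (s := fun i => f i '' U i) i hx
      rwa [← hcov] at this
    rw [image_eq_empty] at h1
    rw [h1, subset_empty_iff] at hA
    simp [hA]
  obtain ⟨e, he⟩ := hc.exists_eq_range hne
  have : Nonempty ι := ⟨e 0⟩
  have hcov' := iUnion_image_eq_disjointed he hcov
  set B := disjointed (fun n => f (e n) '' U (e n)) with hB
  have himg : ∀ i, MeasurableSet (f i '' U i) := fun i =>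
    (hU i).image_of_continuousOn_injOn (hf i) (hinj i)
  have hBm : ∀ n, MeasurableSet (B n) := MeasurableSet.disjointed fun n => himg _
  set μ : ι → Measure X := fun i => ((vol.restrict (U i)).withDensity (D i)).map (f i) with hμ
  have hfm : ∀ i, AEMeasurable (f i) (vol.restrict (U i)) := fun i => (hf i).aemeasurable (hU i)
  have hμapp : ∀ i (s : Set X), MeasurableSet s →
      μ i s = ∫⁻ u in U i ∩ f i ⁻¹' s, D i u ∂vol := by
    intro i s hs
    have hnull : NullMeasurableSet (f i ⁻¹' s) (vol.restrict (U i)) := (hfm i).nullMeasurable hs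
    rw [hμ]
    simp only
    rw [Measure.map_apply_of_aemeasurable
      ((hfm i).mono_ac (withDensity_absolutelyContinuous _ _)) hs, withDensity_apply₀ _ hnull,
      Measure.restrict_restrict₀ hnull, inter_comm]
  refine ⟨Measure.sum fun n => (μ (e n)).restrict (B n), ?_, fun i A hA hAm => ?_⟩
  · rw [← hcov', Measure.sum_apply _ (MeasurableSet.iUnion hBm).compl]
    refine ENNReal.tsum_eq_zero.2 fun n => ?_
    rw [Measure.restrict_apply (MeasurableSet.iUnion hBm).compl]
    convert measure_empty (μ := μ (e n))
    rw [← disjoint_iff_inter_eq_empty]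
    exact disjoint_compl_left.mono_right (subset_iUnion B n)
  · have hfA : MeasurableSet (f i '' A) :=
      hAm.image_of_continuousOn_injOn ((hf i).mono hA) ((hinj i).mono hA)
    rw [Measure.sum_apply _ hfA]
    set An : ℕ → Set H := fun n => A ∩ f i ⁻¹' (B n) with hAn
    have hAnm : ∀ n, MeasurableSet (An n) := fun n =>
      measurableSet_inter_preimage_of_continuousOn hAm ((hf i).mono hA) (hBm n)
    have hAU : ⋃ n, An n = A := by
      rw [hAn, ← inter_iUnion, ← preimage_iUnion, hcov', inter_eq_left]
      exact fun u hu => mem_iUnion_of_mem i ⟨u, hA hu, rfl⟩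
    have hpiece : ∀ n, (μ (e n)).restrict (B n) (f i '' A) = ∫⁻ u in An n, D i u ∂vol := by
      intro n
      have h1 : f i '' A ∩ B n = f i '' An n := (image_inter_preimage _ _ _).symm
      rw [Measure.restrict_apply hfA, hμapp _ _ (hfA.inter (hBm n)), h1]
      refine ((hD i (e n) (he ▸ mem_range_self n)).setLIntegral_eq (hinj i) (hinj (e n))
        (inter_subset_left.trans hA)
        (hAnm n) ?_).symm
      rw [← h1]
      exact inter_subset_right.trans (disjointed_subset _ _)
    simp only [hpiece]
    rw [← lintegral_iUnion hAnm, hAU]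
    exact fun i j hij => ((disjoint_disjointed _ hij).preimage _).mono inter_subset_right
      inter_subset_right

end Glue

/-! ### Existence and uniqueness of the symplectic volume of an orbit -/

namespace LieGroupoid

variable {E F G M : Type*}
  [NormedAddCommGroup E] [NormedSpace ℝ E] [NormedAddCommGroup F] [NormedSpace ℝ F]
  [TopologicalSpace M] [ChartedSpace E M]
  [TopologicalSpace G] [ChartedSpace F G]
  {Γ : LieGroupoid E F G M} {Ω : ∀ g : G, TangentSpace 𝓘(ℝ, F) g [⋀^Fin 2]→L[ℝ] ℝ}
  {P : ∀ x : M, Cotangent E x →ₗ[ℝ] Cotangent E x →ₗ[ℝ] ℝ}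

variable (Γ) in
/-- The orbit of `m`. -/
def orbit (m : M) : Set M := Γ.tgt '' (Γ.src ⁻¹' {m})

theorem OrbitSection.isParametrization {m : M} {k : ℕ}
    (s : Γ.OrbitSection m (EuclideanSpace ℝ (Fin k))) :
    IsParametrization (H := E) s.dom (Γ.tgt ∘ s.sec) where
  isOpen := s.isOpen_dom
  smooth := Γ.isSubmersion_tgt.contMDiff.comp_contMDiffOn s.smooth_sec
  injOn := fun a ha b hb h => by
    rw [← s.base_tgt_sec a ha, ← s.base_tgt_sec b hb]
    exact congrArg s.base h
  immersion := fun u hu => by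
    have h1 := mdifferentiableAt_of_contMDiffOn s.isOpen_baseDom
      (s.tgt_mem _ (s.mapsTo_sec hu)) s.smooth_base
    have h2 := mdifferentiableAt_of_contMDiffOn s.isOpen_dom hu
      (Γ.isSubmersion_tgt.contMDiff.comp_contMDiffOn s.smooth_sec)
    have h3 := modelDeriv_comp (f := s.base) (g := Γ.tgt ∘ s.sec) h1 h2
    rw [modelDeriv_of_eqOn_id (f := s.base ∘ Γ.tgt ∘ s.sec) s.isOpen_dom hu s.base_tgt_sec] at h3
    exact Function.LeftInverse.injective
      (g := modelDeriv E (EuclideanSpace ℝ (Fin k)) s.base (Γ.tgt (s.sec u)))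
      (fun v => (DFunLike.congr_fun h3 v).symm)

theorem OrbitSection.image_tgt_sec_subset {m : M} {H : Type*} [NormedAddCommGroup H]
    [NormedSpace ℝ H] (s : Γ.OrbitSection m H) : (Γ.tgt ∘ s.sec) '' s.dom ⊆ Γ.orbit m := by
  rintro _ ⟨a, ha, rfl⟩
  exact ⟨s.sec a, (s.mapsTo_sec ha).1, rfl⟩

theorem orbit_eq_iUnion {m : M} {H : Type*} [NormedAddCommGroup H] [NormedSpace ℝ H]
    {s : ℕ → Γ.OrbitSection m H} (hs : Γ.src ⁻¹' {m} ⊆ ⋃ n, (s n).nhd) :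
    ⋃ n, (Γ.tgt ∘ (s n).sec) '' (s n).dom = Γ.orbit m := by
  refine (iUnion_subset fun n => (s n).image_tgt_sec_subset).antisymm ?_
  rintro _ ⟨g, hg, rfl⟩
  obtain ⟨n, hn⟩ := mem_iUnion.1 (hs hg)
  exact mem_iUnion.2 ⟨n, _, (s n).base_mem g ⟨hg, hn⟩, (s n).tgt_sec_base g ⟨hg, hn⟩⟩

/-- Near a point of an orbit, the orbit is the image of the section through any preimage. -/
theorem OrbitSection.exists_nhds {m : M} {H H' : Type*} [NormedAddCommGroup H] [NormedSpace ℝ H]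
    [NormedAddCommGroup H'] [NormedSpace ℝ H']
    (s : Γ.OrbitSection m H) {U : Set H'} (hU : IsOpen U) {σ : H' → G}
    (hσ : ContMDiffOn 𝓘(ℝ, H') 𝓘(ℝ, F) ∞ σ U) (hm : MapsTo σ U (Γ.src ⁻¹' {m})) {u : H'}
    (hu : u ∈ U) (h : Γ.tgt (σ u) ∈ (Γ.tgt ∘ s.sec) '' s.dom) :
    ∃ V ⊆ U, IsOpen V ∧ u ∈ V ∧ ∀ u' ∈ V, Γ.tgt (σ u') ∈ s.baseDom ∧
      s.base (Γ.tgt (σ u')) ∈ s.dom ∧ Γ.tgt (s.sec (s.base (Γ.tgt (σ u')))) = Γ.tgt (σ u') := by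
  obtain ⟨v, hv, hvu⟩ := h
  have hvu' : Γ.tgt (s.sec v) = Γ.tgt (σ u) := hvu
  have hsv := s.mapsTo_sec hv
  have hc0 : Γ.src (Γ.inv (σ u)) = Γ.tgt (s.sec v) := (Γ.src_inv _).trans hvu'.symm
  -- The arrows `σ u` and `s.sec v` may lie far apart in the source fiber. Right translation by this
  -- isotropy element moves the first to the second without changing targets, hence into the open
  -- set where the section is controlled.
  set k := Γ.mul (Γ.inv (σ u)) (s.sec v) with hk
  have hkt : Γ.tgt k = m := by rw [hk, Γ.tgt_mul _ _ hc0, Γ.tgt_inv]; exact hm hu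
  have hks : Γ.src k = m := by rw [hk, Γ.src_mul _ _ hc0]; exact hsv.1
  have hcomp : ∀ u' ∈ U, Γ.src (σ u') = Γ.tgt k := fun u' hu' => (hm hu').trans hkt.symm
  have h1 := Γ.contMDiffOn_mul_comp hσ (contMDiffOn_const (c := k)) hcomp
  refine ⟨U ∩ (fun u' => Γ.mul (σ u') k) ⁻¹' s.nhd, inter_subset_left,
    h1.continuousOn.isOpen_inter_preimage hU s.isOpen_nhd, ⟨hu, ?_⟩, fun u' hu' => ?_⟩
  · rw [mem_preimage, hk, Γ.mul_inv_mul_cancel' hvu'.symm]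
    exact hsv.2
  · have h2 : Γ.mul (σ u') k ∈ Γ.src ⁻¹' {m} ∩ s.nhd :=
      ⟨(Γ.src_mul _ _ (hcomp u' hu'.1)).trans hks, hu'.2⟩
    rw [← Γ.tgt_mul _ _ (hcomp u' hu'.1)]
    exact ⟨s.tgt_mem _ h2, s.base_mem _ h2, s.tgt_sec_base _ h2⟩

section Volume

variable [FiniteDimensional ℝ E] [FiniteDimensional ℝ F]

theorem IsSymplecticGroupoid.exists_orbitSection_cover [IsManifold 𝓘(ℝ, E) ∞ M]
    [SecondCountableTopology G]
    (hΓ : Γ.IsSymplecticGroupoid Ω P) {m : M} {r : ℕ} (hr : r = leafHalfDim P m) :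
    ∃ s : ℕ → Γ.OrbitSection m (EuclideanSpace ℝ (Fin (2 * r))),
      Γ.src ⁻¹' {m} ⊆ ⋃ n, (s n).nhd := by
  obtain ⟨s₀, -⟩ := hΓ.exists_orbitSection hr (Γ.src_unit m)
  have : Nonempty (Γ.OrbitSection m (EuclideanSpace ℝ (Fin (2 * r)))) := ⟨s₀⟩
  choose! t ht using fun (g : G) (hg : Γ.src g = m) => hΓ.exists_orbitSection hr hg
  obtain ⟨c, hcS, hc, hcov⟩ := TopologicalSpace.countable_cover_nhdsWithin
    (s := Γ.src ⁻¹' {m}) (f := fun g => (t g).nhd)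
    (fun g hg => mem_nhdsWithin_of_mem_nhds ((t g).isOpen_nhd.mem_nhds (ht g hg)))
  have hne : c.Nonempty := by
    have := hcov (Γ.src_unit m)
    obtain ⟨g, hg, -⟩ := mem_iUnion₂.1 this
    exact ⟨g, hg⟩
  obtain ⟨e, rfl⟩ := hc.exists_eq_range hne
  exact ⟨fun n => t (e n), hcov.trans (by simp)⟩

/-- The transition map is `base ∘ t ∘ σ`. It is smooth near any common point because nearby points
of the parametrization stay on the same sheet of the orbit as the section. -/
theorem IsSymplecticGroupoid.densitiesCompatible_orbitSection (hΓ : Γ.IsSymplecticGroupoid Ω P)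
    {m : M} {r : ℕ} {U : Set (EuclideanSpace ℝ (Fin (2 * r)))} (hU : IsOpen U)
    {σ : EuclideanSpace ℝ (Fin (2 * r)) → G}
    (hσ : ContMDiffOn 𝓘(ℝ, EuclideanSpace ℝ (Fin (2 * r))) 𝓘(ℝ, F) ∞ σ U)
    (hm : MapsTo σ U (Γ.src ⁻¹' {m})) (s : Γ.OrbitSection m (EuclideanSpace ℝ (Fin (2 * r)))) :
    DensitiesCompatible U s.dom (Γ.tgt ∘ σ) (Γ.tgt ∘ s.sec)
      (fun u => ENNReal.ofReal (Γ.leafDensity P r σ u))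
      (fun u => ENNReal.ofReal (Γ.leafDensity P r s.sec u)) := by
  refine ⟨s.base ∘ Γ.tgt ∘ σ, fun u => fderiv ℝ (s.base ∘ Γ.tgt ∘ σ) u, fun u hu h => ?_⟩
  obtain ⟨V, hVU, hV, huV, hVs⟩ := s.exists_nhds hU hσ hm hu h
  obtain ⟨-, h2, h3⟩ := hVs u huV
  have hsm : ContDiffOn ℝ ∞ (s.base ∘ Γ.tgt ∘ σ) V := by
    rw [← contMDiffOn_iff_contDiffOn]
    exact s.smooth_base.comp (Γ.isSubmersion_tgt.contMDiff.comp_contMDiffOn (hσ.mono hVU))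
      (fun u' hu' => (hVs u' hu').1)
  have hd : HasFDerivAt (s.base ∘ Γ.tgt ∘ σ) (fderiv ℝ (s.base ∘ Γ.tgt ∘ σ) u) u :=
    ((hsm.contDiffAt (hV.mem_nhds huV)).differentiableAt (by simp)).hasFDerivAt
  refine ⟨h2, h3, hd, ?_⟩
  simp only
  rw [hΓ.leafDensity_transition hU hσ hm s.isOpen_dom s.smooth_sec
    (fun a ha => (s.mapsTo_sec ha).1) hu hd h2
    (Filter.eventuallyEq_of_mem (hV.mem_nhds huV) (fun u' hu' => (hVs u' hu').2.2.symm)),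
    ENNReal.ofReal_mul (abs_nonneg _)]

variable (Γ P) in
/-- `IsLeafVolume` with an explicit half dimension of the leaves. -/
def IsLeafVolumeOfDim [MeasurableSpace M] (r : ℕ) (m : M) (lam : Measure M) : Prop :=
  lam (Γ.orbit m)ᶜ = 0 ∧ ∀ (U : Set (EuclideanSpace ℝ (Fin (2 * r))))
    (σ : EuclideanSpace ℝ (Fin (2 * r)) → G),
    ContMDiffOn 𝓘(ℝ, EuclideanSpace ℝ (Fin (2 * r))) 𝓘(ℝ, F) ∞ σ U →
    MapsTo σ U (Γ.src ⁻¹' {m}) → IsParametrization (H := E) U (Γ.tgt ∘ σ) →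
    HasDensity lam volume U (Γ.tgt ∘ σ) (fun u => ENNReal.ofReal (Γ.leafDensity P r σ u))

omit [FiniteDimensional ℝ E] [FiniteDimensional ℝ F] in
theorem isLeafVolume_iff [MeasurableSpace M] {m : M} {lam : Measure M} :
    Γ.IsLeafVolume P m lam ↔ Γ.IsLeafVolumeOfDim P (leafHalfDim P m) m lam :=
  ⟨fun h => ⟨h.1, h.2⟩, fun h => ⟨h.1, h.2⟩⟩

omit [FiniteDimensional ℝ E] [FiniteDimensional ℝ F] in
theorem OrbitSection.hasDensity [MeasurableSpace M] {m : M} {r : ℕ} {lam : Measure M}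
    (h : Γ.IsLeafVolumeOfDim P r m lam)
    (s : Γ.OrbitSection m (EuclideanSpace ℝ (Fin (2 * r)))) :
    HasDensity lam volume s.dom (Γ.tgt ∘ s.sec)
      (fun u => ENNReal.ofReal (Γ.leafDensity P r s.sec u)) :=
  h.2 _ _ s.smooth_sec (fun _ ha => (s.mapsTo_sec ha).1) s.isParametrization

variable [MeasurableSpace M] [BorelSpace M] [T2Space M] [IsManifold 𝓘(ℝ, E) ∞ M]
  [SecondCountableTopology G]

theorem IsSymplecticGroupoid.measurableSet_orbit (hΓ : Γ.IsSymplecticGroupoid Ω P) (m : M) :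
    MeasurableSet (Γ.orbit m) := by
  obtain ⟨s, hs⟩ := hΓ.exists_orbitSection_cover (m := m) rfl
  rw [← orbit_eq_iUnion hs]
  exact MeasurableSet.iUnion fun n => (s n).isOpen_dom.measurableSet.image_of_continuousOn_injOn
    (s n).isParametrization.smooth.continuousOn (s n).isParametrization.injOn

theorem IsSymplecticGroupoid.isLeafVolumeOfDim_unique (hΓ : Γ.IsSymplecticGroupoid Ω P) {m : M}
    {r : ℕ} (hr : r = leafHalfDim P m) {lam lam' : Measure M} (h : Γ.IsLeafVolumeOfDim P r m lam)
    (h' : Γ.IsLeafVolumeOfDim P r m lam') : lam = lam' := by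
  obtain ⟨s, hs⟩ := hΓ.exists_orbitSection_cover (m := m) hr
  have hO := orbit_eq_iUnion hs
  refine measure_ext_of_parametrizations (U := fun n => (s n).dom)
    (f := fun n => Γ.tgt ∘ (s n).sec) (c := univ)
    (fun n => (s n).isOpen_dom.measurableSet)
    (fun n => (s n).isParametrization.smooth.continuousOn)
    (fun n => (s n).isParametrization.injOn) countable_univ (by simp) ?_ ?_ ?_
  · rw [hO]; exact h.1
  · rw [hO]; exact h'.1
  · intro n _ A hA hAm
    rw [(s n).hasDensity h A hA hAm, (s n).hasDensity h' A hA hAm]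

theorem IsSymplecticGroupoid.exists_isLeafVolumeOfDim (hΓ : Γ.IsSymplecticGroupoid Ω P) {m : M}
    {r : ℕ} (hr : r = leafHalfDim P m) : ∃ lam : Measure M, Γ.IsLeafVolumeOfDim P r m lam := by
  obtain ⟨s, hs⟩ := hΓ.exists_orbitSection_cover (m := m) hr
  have hO := orbit_eq_iUnion hs
  -- All parametrizations are glued at once, so that the volume formula holds in each; the orbit
  -- sections supply the countable cover.
  let ι := {p : Set (EuclideanSpace ℝ (Fin (2 * r))) × (EuclideanSpace ℝ (Fin (2 * r)) → G) //
    ContMDiffOn 𝓘(ℝ, EuclideanSpace ℝ (Fin (2 * r))) 𝓘(ℝ, F) ∞ p.2 p.1 ∧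
    MapsTo p.2 p.1 (Γ.src ⁻¹' {m}) ∧ IsParametrization (H := E) p.1 (Γ.tgt ∘ p.2)}
  let e : ℕ → ι := fun n => ⟨((s n).dom, (s n).sec), (s n).smooth_sec,
    fun a ha => ((s n).mapsTo_sec ha).1, (s n).isParametrization⟩
  have hsub : ∀ i : ι, (Γ.tgt ∘ i.1.2) '' i.1.1 ⊆ Γ.orbit m := by
    rintro i _ ⟨a, ha, rfl⟩
    exact ⟨i.1.2 a, i.2.2.1 ha, rfl⟩
  have hO' : ⋃ i : ι, (Γ.tgt ∘ i.1.2) '' i.1.1 = Γ.orbit m := by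
    refine (iUnion_subset hsub).antisymm ?_
    rw [← hO]
    exact iUnion_subset fun n => subset_iUnion (fun i : ι => (Γ.tgt ∘ i.1.2) '' i.1.1) (e n)
  obtain ⟨lam, h1, h2⟩ := exists_measure_of_compatible_densities (ι := ι)
    (U := fun i => i.1.1) (f := fun i => Γ.tgt ∘ i.1.2) (c := range e)
    (volume : Measure (EuclideanSpace ℝ (Fin (2 * r))))
    (fun i => i.2.2.2.isOpen.measurableSet) (fun i => i.2.2.2.smooth.continuousOn)
    (fun i => i.2.2.2.injOn) (countable_range e) (by
      rw [hO', ← hO, biUnion_range]) (fun i u => ENNReal.ofReal (Γ.leafDensity P r i.1.2 u))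
    (by
      rintro i _ ⟨n, rfl⟩
      exact hΓ.densitiesCompatible_orbitSection i.2.2.2.isOpen i.2.1 i.2.2.1 (s n))
  exact ⟨lam, by rw [← hO']; exact h1, fun U σ hσ hm hp => h2 ⟨(U, σ), hσ, hm, hp⟩⟩

end Volume

end LieGroupoid

/-! ### Determinants, and normalized Haar measure on compact groups -/

section Det

variable {H : Type*} [NormedAddCommGroup H] [NormedSpace ℝ H] [FiniteDimensional ℝ H]

theorem contDiff_continuousLinearMap_det : ContDiff ℝ ∞ (fun L : H →L[ℝ] H => L.det) := by
  let b := Module.finBasis ℝ H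
  have h : (fun L : H →L[ℝ] H => L.det) = fun L : H →L[ℝ] H =>
      ∑ σ : Equiv.Perm (Fin (Module.finrank ℝ H)), ((Equiv.Perm.sign σ : ℤ) : ℝ) *
        ∏ i, (LinearMap.toContinuousLinearMap (b.coord (σ i))) (L (b i)) := by
    funext L
    rw [ContinuousLinearMap.det, ← LinearMap.det_toMatrix b, Matrix.det_apply']
    simp [LinearMap.toMatrix_apply]
  rw [h]
  refine ContDiff.sum fun σ _ => contDiff_const.mul (contDiff_prod fun i _ => ?_)
  exact ContinuousLinearMap.contDiff _ |>.comp (ContinuousLinearMap.apply ℝ H (b i)).contDiff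

end Det

section HaarProbability

variable {K K' : Type*} [Group K] [TopologicalSpace K] [IsTopologicalGroup K] [CompactSpace K]
  [SecondCountableTopology K] [MeasurableSpace K] [BorelSpace K]
  [Group K'] [TopologicalSpace K'] [IsTopologicalGroup K'] [CompactSpace K']
  [SecondCountableTopology K'] [MeasurableSpace K'] [BorelSpace K']

omit [SecondCountableTopology K] in
instance isProbabilityMeasure_haarMeasure_top :
    IsProbabilityMeasure (Measure.haarMeasure (⊤ : TopologicalSpace.PositiveCompacts K)) :=
  ⟨by simpa using Measure.haarMeasure_self (K₀ := (⊤ : TopologicalSpace.PositiveCompacts K))⟩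

theorem eq_smul_haarMeasure_top (μ : Measure K) [IsFiniteMeasure μ] [μ.IsMulLeftInvariant] :
    μ = μ univ • Measure.haarMeasure ⊤ := by
  simpa using Measure.haarMeasure_unique μ (⊤ : TopologicalSpace.PositiveCompacts K)

omit [SecondCountableTopology K] in
theorem map_haarMeasure_top_of_mulEquiv (e : K ≃* K') (he : Continuous e) :
    (Measure.haarMeasure (⊤ : TopologicalSpace.PositiveCompacts K)).map e =
      Measure.haarMeasure ⊤ := by
  have : IsProbabilityMeasure ((Measure.haarMeasure
      (⊤ : TopologicalSpace.PositiveCompacts K)).map e) :=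
    Measure.isProbabilityMeasure_map he.measurable.aemeasurable
  have := isMulLeftInvariant_map (μ := Measure.haarMeasure
    (⊤ : TopologicalSpace.PositiveCompacts K)) e.toMonoidHom.toMulHom he.measurable e.surjective
  have h : ((Measure.haarMeasure (⊤ : TopologicalSpace.PositiveCompacts K)).map e) = _ :=
    @eq_smul_haarMeasure_top _ _ _ _ _ _ _ _ _ _ this
  rw [h]
  simp

/-- Right translations commute with left translations, so the image is again a left invariant
probability measure, and there is only one. -/
theorem map_mul_right_haarMeasure_top (k : K) :
    (Measure.haarMeasure (⊤ : TopologicalSpace.PositiveCompacts K)).map (· * k) =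
      Measure.haarMeasure ⊤ := by
  have hm : Measurable (fun x : K => x * k) := (continuous_mul_const k).measurable
  have : IsProbabilityMeasure ((Measure.haarMeasure
      (⊤ : TopologicalSpace.PositiveCompacts K)).map (· * k)) :=
    Measure.isProbabilityMeasure_map hm.aemeasurable
  have : ((Measure.haarMeasure
      (⊤ : TopologicalSpace.PositiveCompacts K)).map (· * k)).IsMulLeftInvariant := by
    refine ⟨fun g => ?_⟩
    have hg : Measurable (fun x : K => g * x) := (continuous_const_mul g).measurable
    rw [Measure.map_map hg hm]
    have h1 : (fun x : K => g * x) ∘ (fun x => x * k) = (fun x => x * k) ∘ fun x => g * x := by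
      funext x; simp [mul_assoc]
    rw [h1, ← Measure.map_map hm hg, map_mul_left_eq_self]
  rw [eq_smul_haarMeasure_top (Measure.map _ _)]
  simp

/-- Inversion turns left translations into right translations, which also preserve the measure by
compactness. -/
theorem map_inv_haarMeasure_top :
    (Measure.haarMeasure (⊤ : TopologicalSpace.PositiveCompacts K)).map (·⁻¹) =
      Measure.haarMeasure ⊤ := by
  have hm : Measurable (fun x : K => x⁻¹) := continuous_inv.measurable
  have : IsProbabilityMeasure ((Measure.haarMeasure
      (⊤ : TopologicalSpace.PositiveCompacts K)).map (·⁻¹)) :=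
    Measure.isProbabilityMeasure_map hm.aemeasurable
  have : ((Measure.haarMeasure
      (⊤ : TopologicalSpace.PositiveCompacts K)).map (·⁻¹)).IsMulLeftInvariant := by
    refine ⟨fun g => ?_⟩
    have hg : Measurable (fun x : K => g * x) := (continuous_const_mul g).measurable
    have hg' : Measurable (fun x : K => x * g⁻¹) := (continuous_mul_const _).measurable
    rw [Measure.map_map hg hm]
    have h1 : (fun x : K => g * x) ∘ (fun x => x⁻¹) = (fun x => x⁻¹) ∘ fun x => x * g⁻¹ := by
      funext x; simp
    rw [h1, ← Measure.map_map hm hg', map_mul_right_haarMeasure_top]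
  rw [eq_smul_haarMeasure_top (Measure.map _ _)]
  simp

end HaarProbability

/-! ### Haar measure has a smooth density in a chart at the identity -/

section GroupChart

variable {K H : Type*} [Group K] [TopologicalSpace K] [IsTopologicalGroup K] [CompactSpace K]
  [T2Space K] [SecondCountableTopology K] [MeasurableSpace K] [BorelSpace K]
  [NormedAddCommGroup H] [NormedSpace ℝ H] [FiniteDimensional ℝ H] [MeasurableSpace H]
  [BorelSpace H]

/-- A chart of a compact group around the identity, in which the group operations are smooth. -/
structure GroupChart (K H : Type*) [Group K] [TopologicalSpace K] [NormedAddCommGroup H]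
    [NormedSpace ℝ H] where
  dom : Set H
  map : H → K
  nhd : Set K
  coord : K → H
  isOpen_dom : IsOpen dom
  isOpen_nhd : IsOpen nhd
  continuousOn_map : ContinuousOn map dom
  continuousOn_coord : ContinuousOn coord nhd
  mapsTo_map : MapsTo map dom nhd
  mapsTo_coord : MapsTo coord nhd dom
  coord_map : ∀ v ∈ dom, coord (map v) = v
  map_coord : ∀ k ∈ nhd, map (coord k) = k
  one_mem : 1 ∈ nhd
  smooth_translate : ∀ k, ContDiffOn ℝ ∞ (fun v => coord (k * map v))
    (dom ∩ (fun v => k * map v) ⁻¹' nhd)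
  smooth_div : ContDiffOn ℝ ∞ (fun p : H × H => coord ((map p.1)⁻¹ * map p.2))
    (dom ×ˢ dom ∩ (fun p : H × H => (map p.1)⁻¹ * map p.2) ⁻¹' nhd)

namespace GroupChart

/-- The Jacobian determinant at the identity of left translation by the inverse. -/
def density (c : GroupChart K H) (v : H) : ℝ :=
  |(fderiv ℝ (fun w => c.coord ((c.map v)⁻¹ * c.map w)) v).det|

variable (c : GroupChart K H)

omit [IsTopologicalGroup K] [CompactSpace K] [T2Space K] [SecondCountableTopology K]
  [MeasurableSpace K] [BorelSpace K] [FiniteDimensional ℝ H] [MeasurableSpace H] [BorelSpace H] in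
theorem injOn_map : InjOn c.map c.dom := fun a ha b hb h => by
  rw [← c.coord_map a ha, h, c.coord_map b hb]

omit [CompactSpace K] [T2Space K] [SecondCountableTopology K] [MeasurableSpace K] [BorelSpace K]
  [FiniteDimensional ℝ H] [MeasurableSpace H] [BorelSpace H] in
theorem isOpen_translate (k : K) : IsOpen (c.dom ∩ (fun v => k * c.map v) ⁻¹' c.nhd) :=
  (c.continuousOn_map.const_mul k).isOpen_inter_preimage c.isOpen_dom c.isOpen_nhd

omit [CompactSpace K] [T2Space K] [SecondCountableTopology K] [MeasurableSpace K] [BorelSpace K]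
  [FiniteDimensional ℝ H] [MeasurableSpace H] [BorelSpace H] in
theorem differentiableAt_translate (k : K) {v : H} (hv : v ∈ c.dom) (hk : k * c.map v ∈ c.nhd) :
    DifferentiableAt ℝ (fun v => c.coord (k * c.map v)) v :=
  ((c.smooth_translate k).contDiffAt ((c.isOpen_translate k).mem_nhds ⟨hv, hk⟩)).differentiableAt
    (by simp)

omit [CompactSpace K] [T2Space K] [SecondCountableTopology K] [MeasurableSpace K] [BorelSpace K]
  [FiniteDimensional ℝ H] [MeasurableSpace H] [BorelSpace H] in
-- Left translation by the inverse and by the element itself are mutually inverse in coordinates, so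
-- the determinants multiply to 1.
theorem density_pos {v : H} (hv : v ∈ c.dom) : 0 < c.density v := by
  have h1 : (c.map v)⁻¹ * c.map v ∈ c.nhd := by rw [inv_mul_cancel]; exact c.one_mem
  have hd := c.differentiableAt_translate _ hv h1
  have h2 : c.map v * c.map (c.coord 1) ∈ c.nhd := by
    rw [c.map_coord 1 c.one_mem, mul_one]; exact c.mapsTo_map hv
  have h0 : (fun w => c.coord ((c.map v)⁻¹ * c.map w)) v = c.coord 1 := by simp
  have hd' := c.differentiableAt_translate (c.map v) (c.mapsTo_coord c.one_mem) h2
  rw [← h0] at hd'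
  have hcomp := fderiv_comp v hd' hd
  have hid : (fun w => c.coord (c.map v * c.map w)) ∘ (fun w => c.coord ((c.map v)⁻¹ * c.map w))
      =ᶠ[𝓝 v] id := by
    filter_upwards [(c.isOpen_translate (c.map v)⁻¹).mem_nhds ⟨hv, h1⟩] with w hw
    simp only [Function.comp]
    rw [c.map_coord _ hw.2, mul_inv_cancel_left, c.coord_map _ hw.1, id]
  rw [hid.fderiv_eq, fderiv_id] at hcomp
  rw [density, abs_pos]
  intro h
  have h3 := congrArg ContinuousLinearMap.det hcomp
  have h4 : ∀ A B : H →L[ℝ] H, (A.comp B).det = A.det * B.det := fun A B =>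
    LinearMap.det_comp A.toLinearMap B.toLinearMap
  rw [h4, h, mul_zero] at h3
  have h5 : (ContinuousLinearMap.id ℝ H).det = 1 := LinearMap.det_id
  rw [h5] at h3
  exact one_ne_zero h3

omit [CompactSpace K] [T2Space K] [SecondCountableTopology K] [MeasurableSpace K] [BorelSpace K]
  [MeasurableSpace H] [BorelSpace H] in
-- The Jacobian is a partial derivative, on the diagonal, of the jointly smooth map (v, w) ↦ v⁻¹w.
theorem contDiffOn_density : ContDiffOn ℝ ∞ c.density c.dom := by
  have hop : IsOpen (c.dom ×ˢ c.dom ∩ (fun p : H × H => (c.map p.1)⁻¹ * c.map p.2) ⁻¹' c.nhd) := by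
    refine ContinuousOn.isOpen_inter_preimage ?_ (c.isOpen_dom.prod c.isOpen_dom) c.isOpen_nhd
    exact ((c.continuousOn_map.comp continuousOn_fst (fun p hp => hp.1)).inv).mul
      (c.continuousOn_map.comp continuousOn_snd (fun p hp => hp.2))
  have hdiag : ∀ v ∈ c.dom, ((v, v) : H × H) ∈
      (c.dom ×ˢ c.dom ∩ (fun p : H × H => (c.map p.1)⁻¹ * c.map p.2) ⁻¹' c.nhd) := fun v hv =>
    ⟨⟨hv, hv⟩, by simpa using c.one_mem⟩
  have h1 := c.smooth_div.fderiv_of_isOpen (m := ∞) hop (by simp)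
  have h2 : ContDiffOn ℝ ∞ (fun v => (fderiv ℝ (fun p : H × H =>
      c.coord ((c.map p.1)⁻¹ * c.map p.2)) (v, v)).comp (ContinuousLinearMap.inr ℝ H H)) c.dom :=
    (h1.comp (contDiffOn_id.prodMk contDiffOn_id) hdiag).clm_comp contDiffOn_const
  have h3 : ∀ v ∈ c.dom, fderiv ℝ (fun w => c.coord ((c.map v)⁻¹ * c.map w)) v =
      (fderiv ℝ (fun p : H × H => c.coord ((c.map p.1)⁻¹ * c.map p.2)) (v, v)).comp
        (ContinuousLinearMap.inr ℝ H H) := fun v hv => by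
    have hd := ((c.smooth_div.contDiffAt (hop.mem_nhds (hdiag v hv))).differentiableAt
      (by simp)).hasFDerivAt
    have hin : HasFDerivAt (fun w : H => (v, w)) (ContinuousLinearMap.inr ℝ H H) v :=
      hasFDerivAt_prodMk_right v v
    exact (HasFDerivAt.comp v hd hin).fderiv
  refine ((contDiff_continuousLinearMap_det.comp_contDiffOn (h2.congr h3)).abs fun v hv => ?_)
  exact abs_pos.1 (c.density_pos hv)

omit [CompactSpace K] [T2Space K] [SecondCountableTopology K] [MeasurableSpace K] [BorelSpace K]
  [FiniteDimensional ℝ H] [MeasurableSpace H] [BorelSpace H] in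
-- Left invariance of the density, by the chain rule: if j⁻¹k takes v to w, then translation by v⁻¹
-- is translation by j⁻¹k followed by translation by w⁻¹.
theorem densitiesCompatible_translate (k j : K) :
    DensitiesCompatible c.dom c.dom (fun v => k * c.map v) (fun v => j * c.map v)
      (fun v => ENNReal.ofReal (c.density v)) (fun v => ENNReal.ofReal (c.density v)) := by
  refine ⟨fun v => c.coord (j⁻¹ * k * c.map v), fun v => fderiv ℝ
    (fun v => c.coord (j⁻¹ * k * c.map v)) v, fun v hv ⟨w, hw, hwv⟩ => ?_⟩
  have hwv' : j⁻¹ * k * c.map v = c.map w := by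
    have : j * c.map w = k * c.map v := hwv
    rw [mul_assoc, ← this, inv_mul_cancel_left]
  have hN : j⁻¹ * k * c.map v ∈ c.nhd := hwv' ▸ c.mapsTo_map hw
  have hd := c.differentiableAt_translate _ hv hN
  refine ⟨c.mapsTo_coord hN, by simp only [c.map_coord _ hN]; group, hd.hasFDerivAt, ?_⟩
  rw [← ENNReal.ofReal_mul (abs_nonneg _)]
  simp only [density]
  rw [← abs_mul, mul_comm]
  have hTv : c.coord (j⁻¹ * k * c.map v) = w := by rw [hwv', c.coord_map w hw]
  have hw1 : (c.map w)⁻¹ * c.map w ∈ c.nhd := by rw [inv_mul_cancel]; exact c.one_mem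
  have hd2 := c.differentiableAt_translate _ hw hw1
  rw [← hTv] at hd2
  have hcomp := fderiv_comp v hd2 hd
  rw [hTv] at hcomp
  have heq : (fun u => c.coord ((c.map v)⁻¹ * c.map u)) =ᶠ[𝓝 v]
      (fun u => c.coord ((c.map w)⁻¹ * c.map u)) ∘ fun u => c.coord (j⁻¹ * k * c.map u) := by
    filter_upwards [(c.isOpen_translate (j⁻¹ * k)).mem_nhds ⟨hv, hN⟩] with u hu
    simp only [Function.comp]
    rw [c.map_coord _ hu.2, ← hwv']
    congr 1
    group
  rw [heq.fderiv_eq, hTv]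
  have h4 : ∀ A B : H →L[ℝ] H, (A.comp B).det = A.det * B.det := fun A B =>
    LinearMap.det_comp A.toLinearMap B.toLinearMap
  rw [← h4, ← hcomp]

omit [IsTopologicalGroup K] [CompactSpace K] [T2Space K] [SecondCountableTopology K]
  [MeasurableSpace K] [BorelSpace K] [FiniteDimensional ℝ H] [MeasurableSpace H] [BorelSpace H] in
theorem isOpen_image_map {V : Set H} (hV : IsOpen V) (hVd : V ⊆ c.dom) : IsOpen (c.map '' V) := by
  have h : c.map '' V = c.nhd ∩ c.coord ⁻¹' V := by
    ext k
    constructor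
    · rintro ⟨v, hv, rfl⟩
      exact ⟨c.mapsTo_map (hVd hv), by rw [mem_preimage, c.coord_map v (hVd hv)]; exact hv⟩
    · rintro ⟨hk, hkV⟩
      exact ⟨_, hkV, c.map_coord k hk⟩
  rw [h]
  exact c.continuousOn_coord.isOpen_inter_preimage c.isOpen_nhd hV

/-- All left translates of the chart carry the same compatible density, so it glues to a measure on
the group. Left translation permutes these parametrizations, whence invariance. -/
theorem exists_leftInvariant (vol : Measure H) [vol.IsAddHaarMeasure] :
    ∃ ν : Measure K, IsFiniteMeasure ν ∧ ν.IsMulLeftInvariant ∧ ν univ ≠ 0 ∧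
      HasDensity ν vol c.dom c.map (fun v => ENNReal.ofReal (c.density v)) := by
  have hcov : ⋃ k : K, (fun v => k * c.map v) '' c.dom = univ := by
    refine eq_univ_of_forall fun x => mem_iUnion.2 ⟨x, c.coord 1, c.mapsTo_coord c.one_mem, ?_⟩
    simp only [c.map_coord 1 c.one_mem, mul_one]
  have hopen : ∀ V ⊆ c.dom, IsOpen V → ∀ k : K, IsOpen ((fun v => k * c.map v) '' V) := by
    intro V hVd hV k
    have := (Homeomorph.mulLeft k).isOpenMap _ (c.isOpen_image_map hV hVd)
    rwa [image_image] at this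
  have hcont : ∀ k : K, ContinuousOn (fun v => k * c.map v) c.dom := fun k =>
    c.continuousOn_map.const_mul k
  have hinj : ∀ k : K, InjOn (fun v => k * c.map v) c.dom := fun k a ha b hb h =>
    c.injOn_map ha hb (mul_left_cancel h)
  obtain ⟨t, ht, htc⟩ := TopologicalSpace.isOpen_iUnion_countable
    (fun k : K => (fun v => k * c.map v) '' c.dom) (hopen _ subset_rfl c.isOpen_dom)
  obtain ⟨ν, hν0, hν⟩ := exists_measure_of_compatible_densities (ι := K) (X := K)
    (U := fun _ => c.dom) (f := fun k v => k * c.map v) (c := t) vol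
    (fun _ => c.isOpen_dom.measurableSet) hcont hinj ht htc
    (fun _ v => ENNReal.ofReal (c.density v)) (fun k j _ => c.densitiesCompatible_translate k j)
  have hinv : ν.IsMulLeftInvariant := by
    refine ⟨fun g => ?_⟩
    refine measure_ext_of_parametrizations (ι := K) (U := fun _ => c.dom)
      (f := fun k v => k * c.map v) (c := t) (fun _ => c.isOpen_dom.measurableSet) hcont hinj
      ht htc ?_ hν0 fun k _ A hA hAm => ?_
    · rw [hcov]; simp
    · have hmeas : MeasurableSet ((fun v => k * c.map v) '' A) :=
        hAm.image_of_continuousOn_injOn ((hcont k).mono hA) ((hinj k).mono hA)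
      rw [Measure.map_apply (continuous_const_mul g).measurable hmeas, hν k A hA hAm,
        ← hν (g⁻¹ * k) A hA hAm]
      congr 1
      ext x
      simp only [mem_preimage, mem_image]
      refine exists_congr fun v => and_congr_right fun _ => ?_
      rw [mul_assoc, inv_mul_eq_iff_eq_mul]
  have hbase : HasDensity ν vol c.dom c.map (fun v => ENNReal.ofReal (c.density v)) := by
    have := hν 1
    simpa using this
  have h0 := c.mapsTo_coord c.one_mem
  -- A small ball where the density is bounded. Finitely many translates of its image cover the
  -- compact group, so the total mass is finite.
  have hpre : ∃ V ⊆ c.dom, IsOpen V ∧ c.coord 1 ∈ V ∧ ν (c.map '' V) ≠ ⊤ ∧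
      ν (c.map '' V) ≠ 0 := by
    have hc := (c.contDiffOn_density.continuousOn).continuousAt (c.isOpen_dom.mem_nhds h0)
    have h1 : ∀ᶠ v in 𝓝 (c.coord 1), v ∈ c.dom ∧ c.density v < c.density (c.coord 1) + 1 :=
      (c.isOpen_dom.eventually_mem h0).and (hc.eventually_lt_const (by linarith))
    obtain ⟨ε, hε, hball⟩ := Metric.eventually_nhds_iff_ball.1 h1
    refine ⟨Metric.ball (c.coord 1) ε, fun v hv => (hball v hv).1, Metric.isOpen_ball,
      Metric.mem_ball_self hε, ?_, ?_⟩
    · rw [hbase _ (fun v hv => (hball v hv).1) Metric.isOpen_ball.measurableSet]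
      refine ne_top_of_le_ne_top ?_ (setLIntegral_mono measurable_const
        (g := fun _ => ENNReal.ofReal (c.density (c.coord 1) + 1))
        fun v hv => ENNReal.ofReal_le_ofReal (hball v hv).2.le)
      rw [setLIntegral_const]
      exact ENNReal.mul_ne_top ENNReal.ofReal_ne_top Metric.isBounded_ball.measure_lt_top.ne
    · rw [hbase _ (fun v hv => (hball v hv).1) Metric.isOpen_ball.measurableSet]
      have hm : AEMeasurable (fun v => ENNReal.ofReal (c.density v))
          (vol.restrict (Metric.ball (c.coord 1) ε)) :=
        ((c.contDiffOn_density.continuousOn.mono fun v hv =>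
          (hball v hv).1).aemeasurable Metric.isOpen_ball.measurableSet).ennreal_ofReal
      rw [Ne, lintegral_eq_zero_iff' hm]
      intro hz
      have h2 : ∀ᵐ v ∂(vol.restrict (Metric.ball (c.coord 1) ε)), False := by
        filter_upwards [hz, ae_restrict_mem Metric.isOpen_ball.measurableSet] with v hv hvb
        rw [Pi.zero_apply, ENNReal.ofReal_eq_zero] at hv
        exact hv.not_gt (c.density_pos (hball v hvb).1)
      rw [Filter.eventually_false_iff_eq_bot, ae_eq_bot, Measure.restrict_eq_zero] at h2
      exact (Metric.measure_ball_pos vol (c.coord 1) hε).ne' h2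
  obtain ⟨V, hVd, hV, h1V, hfin, hne⟩ := hpre
  refine ⟨ν, ⟨?_⟩, hinv, fun h => hne (measure_mono_null (subset_univ _) h), hbase⟩
  obtain ⟨T, hT⟩ := isCompact_univ.elim_finite_subcover
    (fun k : K => (fun v => k * c.map v) '' V) (hopen V hVd hV) fun x _ =>
      mem_iUnion.2 ⟨x, c.coord 1, h1V, by simp only [c.map_coord 1 c.one_mem, mul_one]⟩
  refine (measure_mono hT).trans_lt ((measure_biUnion_finset_le _ _).trans_lt ?_)
  refine ENNReal.sum_lt_top.2 fun k _ => ?_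
  rw [hν k V hVd hV.measurableSet, ← hbase V hVd hV.measurableSet]
  exact hfin.lt_top

theorem exists_haar_density (vol : Measure H) [vol.IsAddHaarMeasure] :
    ∃ ρ : H → ℝ, ContDiffOn ℝ ∞ ρ c.dom ∧ (∀ v ∈ c.dom, 0 < ρ v) ∧
      HasDensity (Measure.haarMeasure (⊤ : TopologicalSpace.PositiveCompacts K)) vol c.dom c.map
        (fun v => ENNReal.ofReal (ρ v)) := by
  obtain ⟨ν, hfin, hinv, hne, hν⟩ := c.exists_leftInvariant vol
  have htop := measure_ne_top ν univ
  have h1 := eq_smul_haarMeasure_top ν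
  have hpos : 0 < (ν univ).toReal := ENNReal.toReal_pos hne htop
  refine ⟨fun v => (ν univ).toReal⁻¹ * c.density v, contDiffOn_const.mul c.contDiffOn_density,
    fun v hv => mul_pos (inv_pos.2 hpos) (c.density_pos hv), fun A hA hAm => ?_⟩
  have h2 : Measure.haarMeasure (⊤ : TopologicalSpace.PositiveCompacts K) = (ν univ)⁻¹ • ν := by
    rw [h1, smul_smul]
    simp [ENNReal.inv_mul_cancel hne htop]
  rw [h2, Measure.smul_apply, hν A hA hAm, smul_eq_mul, ← lintegral_const_mul'' _
    (((c.contDiffOn_density.continuousOn.mono hA).aemeasurable hAm).ennreal_ofReal)]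
  refine lintegral_congr fun v => ?_
  rw [ENNReal.ofReal_mul (inv_nonneg.2 hpos.le), ENNReal.ofReal_inv_of_pos hpos,
    ENNReal.ofReal_toReal htop]

end GroupChart

end GroupChart

namespace LieGroupoid

variable {E F G M : Type*}
  [NormedAddCommGroup E] [NormedSpace ℝ E] [NormedAddCommGroup F] [NormedSpace ℝ F]
  [TopologicalSpace M] [ChartedSpace E M]
  [TopologicalSpace G] [ChartedSpace F G]
  {Γ : LieGroupoid E F G M} {Ω : ∀ g : G, TangentSpace 𝓘(ℝ, F) g [⋀^Fin 2]→L[ℝ] ℝ}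
  {P : ∀ x : M, Cotangent E x →ₗ[ℝ] Cotangent E x →ₗ[ℝ] ℝ}

/-! ### Isotropy groups and their translates -/

section Isotropy

instance [T2Space G] (x : M) : T2Space (Γ.Isotropy x) :=
  inferInstanceAs (T2Space {g : G // Γ.src g = x ∧ Γ.tgt g = x})

instance [SecondCountableTopology G] (x : M) : SecondCountableTopology (Γ.Isotropy x) :=
  TopologicalSpace.Subtype.secondCountableTopology {g : G | Γ.src g = x ∧ Γ.tgt g = x}

theorem Isotropy.isInducing_val (x : M) : Topology.IsInducing (fun k : Γ.Isotropy x => k.1) :=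
  Topology.IsInducing.subtypeVal

theorem Isotropy.continuous_val (x : M) : Continuous (fun k : Γ.Isotropy x => k.1) :=
  (Isotropy.isInducing_val x).continuous

theorem Isotropy.coe_mul {x : M} (a b : Γ.Isotropy x) : (a * b).1 = Γ.mul a.1 b.1 := rfl

theorem Isotropy.coe_inv {x : M} (a : Γ.Isotropy x) : (a⁻¹).1 = Γ.inv a.1 := rfl

theorem continuousOn_mul_comp {A : Type*} [TopologicalSpace A] {U : Set A} {c₁ c₂ : A → G}
    (h₁ : ContinuousOn c₁ U) (h₂ : ContinuousOn c₂ U)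
    (h : ∀ u ∈ U, Γ.src (c₁ u) = Γ.tgt (c₂ u)) :
    ContinuousOn (fun u => Γ.mul (c₁ u) (c₂ u)) U :=
  Γ.contMDiffOn_mul.continuousOn.comp (h₁.prodMk h₂) h

theorem continuous_mul_comp {A : Type*} [TopologicalSpace A] {c₁ c₂ : A → G}
    (h₁ : Continuous c₁) (h₂ : Continuous c₂) (h : ∀ u, Γ.src (c₁ u) = Γ.tgt (c₂ u)) :
    Continuous (fun u => Γ.mul (c₁ u) (c₂ u)) :=
  continuousOn_univ.1 (Γ.continuousOn_mul_comp h₁.continuousOn h₂.continuousOn fun u _ => h u)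

theorem continuous_mul_isotropy {g : G} {x : M} (hg : Γ.src g = x) :
    Continuous (fun k : Γ.Isotropy x => Γ.mul g k.1) :=
  Γ.continuous_mul_comp continuous_const (Isotropy.continuous_val x) fun k => hg.trans k.2.2.symm

theorem continuous_isotropy_mul {g : G} {x : M} (hg : Γ.tgt g = x) :
    Continuous (fun k : Γ.Isotropy x => Γ.mul k.1 g) :=
  Γ.continuous_mul_comp (Isotropy.continuous_val x) continuous_const fun k => k.2.1.trans hg.symm

/-- The element `g⁻¹ h` of the isotropy group, for `g` and `h` with the same endpoints. -/
def isotropyDiv (m : M) (g h : G) (hg : Γ.src g = m) (hh : Γ.src h = m) (ht : Γ.tgt g = Γ.tgt h) :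
    Γ.Isotropy m :=
  ⟨Γ.mul (Γ.inv g) h, (Γ.src_mul _ _ ((Γ.src_inv g).trans ht)).trans hh,
    (Γ.tgt_mul _ _ ((Γ.src_inv g).trans ht)).trans ((Γ.tgt_inv g).trans hg)⟩

theorem mul_isotropyDiv {m : M} {g h : G} (hg : Γ.src g = m) (hh : Γ.src h = m)
    (ht : Γ.tgt g = Γ.tgt h) : Γ.mul g (Γ.isotropyDiv m g h hg hh ht).1 = h :=
  Γ.mul_inv_mul_cancel' ht

theorem src_mul_isotropy {m : M} {g : G} (hg : Γ.src g = m) (k : Γ.Isotropy m) :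
    Γ.src (Γ.mul g k.1) = m :=
  (Γ.src_mul _ _ (hg.trans k.2.2.symm)).trans k.2.1

theorem tgt_mul_isotropy {m : M} {g : G} (hg : Γ.src g = m) (k : Γ.Isotropy m) :
    Γ.tgt (Γ.mul g k.1) = Γ.tgt g :=
  Γ.tgt_mul _ _ (hg.trans k.2.2.symm)

theorem mul_assoc_isotropy {m : M} {g : G} (hg : Γ.src g = m) (k l : Γ.Isotropy m) :
    Γ.mul (Γ.mul g k.1) l.1 = Γ.mul g (k * l).1 :=
  Γ.mul_assoc _ _ _ (hg.trans k.2.2.symm) (k.2.1.trans l.2.2.symm)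

variable (Γ) in
/-- Conjugation by an arrow. -/
def conj (g : G) : Γ.Isotropy (Γ.src g) ≃* Γ.Isotropy (Γ.tgt g) where
  toFun k := ⟨Γ.mul (Γ.mul g k.1) (Γ.inv g), by
    have h : Γ.src (Γ.mul g k.1) = Γ.tgt (Γ.inv g) := by rw [Γ.src_mul_isotropy rfl, Γ.tgt_inv]
    rw [Γ.src_mul _ _ h, Γ.tgt_mul _ _ h, Γ.src_inv, Γ.tgt_mul_isotropy rfl]
    exact ⟨rfl, rfl⟩⟩
  invFun k := ⟨Γ.mul (Γ.inv g) (Γ.mul k.1 g), by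
    have h1 : Γ.src k.1 = Γ.tgt g := k.2.1
    have h : Γ.src (Γ.inv g) = Γ.tgt (Γ.mul k.1 g) := by
      rw [Γ.tgt_mul _ _ h1, Γ.src_inv, k.2.2]
    rw [Γ.src_mul _ _ h, Γ.tgt_mul _ _ h, Γ.tgt_inv, Γ.src_mul _ _ h1]
    exact ⟨rfl, rfl⟩⟩
  left_inv k := Subtype.ext (by
    have h : Γ.src (Γ.mul g k.1) = Γ.src g := Γ.src_mul_isotropy rfl k
    change Γ.mul (Γ.inv g) (Γ.mul (Γ.mul (Γ.mul g k.1) (Γ.inv g)) g) = k.1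
    rw [Γ.mul_inv_mul_cancel h, Γ.inv_mul_mul_cancel k.2.2.symm])
  right_inv k := Subtype.ext (by
    have h1 : Γ.src k.1 = Γ.tgt g := k.2.1
    change Γ.mul (Γ.mul g (Γ.mul (Γ.inv g) (Γ.mul k.1 g))) (Γ.inv g) = k.1
    rw [Γ.mul_inv_mul_cancel' (by rw [Γ.tgt_mul _ _ h1, k.2.2]), Γ.mul_mul_inv_cancel h1])
  map_mul' k l := Subtype.ext (by
    change Γ.mul (Γ.mul g (k * l).1) (Γ.inv g) =
      Γ.mul (Γ.mul (Γ.mul g k.1) (Γ.inv g)) (Γ.mul (Γ.mul g l.1) (Γ.inv g))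
    have hk : Γ.src (Γ.mul g k.1) = Γ.src g := Γ.src_mul_isotropy rfl k
    have hl : Γ.src (Γ.mul g l.1) = Γ.src g := Γ.src_mul_isotropy rfl l
    have hlt : Γ.tgt (Γ.mul g l.1) = Γ.tgt g := Γ.tgt_mul_isotropy rfl l
    rw [← Γ.mul_assoc (Γ.mul (Γ.mul g k.1) (Γ.inv g)) (Γ.mul g l.1) (Γ.inv g),
      ← Γ.mul_assoc (Γ.mul (Γ.mul g k.1) (Γ.inv g)) g l.1, Γ.mul_inv_mul_cancel hk,
      Γ.mul_assoc_isotropy rfl]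
    · rw [Γ.src_mul _ _ (hk.trans (Γ.tgt_inv g).symm), Γ.src_inv]
    · exact l.2.2.symm
    · rw [Γ.src_mul _ _ (hk.trans (Γ.tgt_inv g).symm), Γ.src_inv, hlt]
    · rw [hl, Γ.tgt_inv])

theorem conj_mul (g : G) (k : Γ.Isotropy (Γ.src g)) :
    Γ.mul (Γ.conj g k).1 g = Γ.mul g k.1 :=
  Γ.mul_inv_mul_cancel (Γ.src_mul_isotropy rfl k)

theorem continuous_conj (g : G) : Continuous (Γ.conj g) :=
  (Γ.continuous_mul_comp (Γ.continuous_mul_isotropy rfl) continuous_const fun k => by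
    rw [Γ.src_mul_isotropy rfl, Γ.tgt_inv]).subtype_mk _

end Isotropy

/-! ### The measures on the fibers of the target map -/

section FiberMeasure

variable [SecondCountableTopology G] [MeasurableSpace G] [BorelSpace G]
  [∀ x, CompactSpace (Γ.Isotropy x)]

instance (x : M) : IsProbabilityMeasure (Γ.normalizedHaar x) :=
  inferInstanceAs (IsProbabilityMeasure
    (Measure.haarMeasure (⊤ : TopologicalSpace.PositiveCompacts (Γ.Isotropy x))))

instance (x : M) : (Γ.normalizedHaar x).IsMulLeftInvariant :=
  inferInstanceAs (Measure.IsMulLeftInvariant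
    (Measure.haarMeasure (⊤ : TopologicalSpace.PositiveCompacts (Γ.Isotropy x))))

/-- Conjugation by g identifies the two isotropy groups, preserves normalized Haar measure, and
satisfies (gkg⁻¹)g = gk. This replaces a group varying with x by the fixed group at m. -/
theorem map_normalizedHaar_tgt {m x : M} {g : G} (hg : Γ.src g = m) (hx : Γ.tgt g = x) :
    (Γ.normalizedHaar x).map (fun k => Γ.mul k.1 g) =
      (Γ.normalizedHaar m).map (fun k => Γ.mul g k.1) := by
  subst hg hx
  have h1 : Γ.normalizedHaar (Γ.tgt g) = (Γ.normalizedHaar (Γ.src g)).map (Γ.conj g) :=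
    (map_haarMeasure_top_of_mulEquiv (Γ.conj g) (Γ.continuous_conj g)).symm
  rw [h1, Measure.map_map (Γ.continuous_isotropy_mul rfl).measurable
    (Γ.continuous_conj g).measurable]
  congr 1
  funext k
  exact Γ.conj_mul g k

omit [SecondCountableTopology G] in
-- Two choices differ by the isotropy element g⁻¹h, absorbed by left invariance.
theorem map_normalizedHaar_congr {m : M} {g h : G} (hg : Γ.src g = m) (hh : Γ.src h = m)
    (ht : Γ.tgt g = Γ.tgt h) : (Γ.normalizedHaar m).map (fun k => Γ.mul g k.1) =
      (Γ.normalizedHaar m).map (fun k => Γ.mul h k.1) := by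
  have h1 : (fun k : Γ.Isotropy m => Γ.mul h k.1) =
      (fun k : Γ.Isotropy m => Γ.mul g k.1) ∘ (fun k => Γ.isotropyDiv m g h hg hh ht * k) := by
    funext k
    simp only [Function.comp]
    rw [← Γ.mul_assoc_isotropy hg, Γ.mul_isotropyDiv]
  rw [h1, ← Measure.map_map (Γ.continuous_mul_isotropy hg).measurable
    (continuous_const_mul _).measurable, map_mul_left_eq_self]

variable [FiniteDimensional ℝ E] [FiniteDimensional ℝ F]
  [MeasurableSpace M] [BorelSpace M] [T2Space M] [IsManifold 𝓘(ℝ, E) ∞ M]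

omit [∀ x, CompactSpace (Γ.Isotropy x)] in
open Classical in
-- Countably many continuous local sections cover the orbit; they are used on disjoint Borel pieces,
-- with the unit at m as value off the orbit.
theorem IsSymplecticGroupoid.exists_measurable_section (hΓ : Γ.IsSymplecticGroupoid Ω P) (m : M) :
    ∃ τ : M → G, Measurable τ ∧ (∀ x, Γ.src (τ x) = m) ∧ ∀ x ∈ Γ.orbit m, Γ.tgt (τ x) = x := by
  obtain ⟨s, hs⟩ := hΓ.exists_orbitSection_cover (m := m) rfl
  have hO := orbit_eq_iUnion hs
  have hI : ∀ n, MeasurableSet ((Γ.tgt ∘ (s n).sec) '' (s n).dom) := fun n =>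
    (s n).isOpen_dom.measurableSet.image_of_continuousOn_injOn
      (s n).isParametrization.smooth.continuousOn (s n).isParametrization.injOn
  set t := disjointed fun n => (Γ.tgt ∘ (s n).sec) '' (s n).dom with htd
  have ht : ∀ n, MeasurableSet (t n) := MeasurableSet.disjointed hI
  have htI : ∀ n, t n ⊆ (Γ.tgt ∘ (s n).sec) '' (s n).dom := fun n => disjointed_subset _ n
  have hUt : ⋃ n, t n = Γ.orbit m := by rw [← hO, htd, iUnion_disjointed]
  have hb : ∀ n, ∀ x ∈ t n, x ∈ (s n).baseDom ∧ (s n).base x ∈ (s n).dom ∧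
      Γ.tgt ((s n).sec ((s n).base x)) = x := by
    intro n x hx
    obtain ⟨a, ha, rfl⟩ := htI n hx
    have h1 : (s n).base (Γ.tgt ((s n).sec a)) = a := (s n).base_tgt_sec a ha
    refine ⟨(s n).tgt_mem _ ((s n).mapsTo_sec ha), ?_, ?_⟩ <;> simp only [Function.comp, h1, ha]
  obtain ⟨f, hf, hft⟩ := exists_measurable_piecewise t ht
    (fun n => (t n).piecewise ((s n).sec ∘ (s n).base) (fun _ => Γ.unit m))
    (fun n => ContinuousOn.measurable_piecewise
      ((s n).smooth_sec.continuousOn.comp ((s n).smooth_base.continuousOn.mono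
        fun x hx => (hb n x hx).1) fun x hx => (hb n x hx).2.1) continuousOn_const (ht n))
    (fun i j hij x hx => (disjoint_left.1 (disjoint_disjointed _ hij) hx.1 hx.2).elim)
  have hfx : ∀ n, ∀ x ∈ t n, f x = (s n).sec ((s n).base x) := fun n x hx => by
    rw [hft n hx, piecewise_eq_of_mem _ _ _ hx]; rfl
  refine ⟨(Γ.orbit m).piecewise f fun _ => Γ.unit m,
    hf.piecewise (hΓ.measurableSet_orbit m) measurable_const, fun x => ?_, fun x hx => ?_⟩
  · by_cases hx : x ∈ Γ.orbit m
    · rw [piecewise_eq_of_mem _ _ _ hx]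
      rw [← hUt] at hx
      obtain ⟨n, hn⟩ := mem_iUnion.1 hx
      rw [hfx n x hn]
      exact ((s n).mapsTo_sec (hb n x hn).2.1).1
    · rw [piecewise_eq_of_notMem _ _ _ hx, Γ.src_unit]
  · rw [piecewise_eq_of_mem _ _ _ hx]
    rw [← hUt] at hx
    obtain ⟨n, hn⟩ := mem_iUnion.1 hx
    rw [hfx n x hn, (hb n x hn).2.2]

/-- With a Borel section in place of g, the map (x, k) ↦ τ(x)k is jointly measurable, so the Haar
measure of its slices is measurable in x. -/
theorem IsSymplecticGroupoid.exists_fiberMeasure (hΓ : Γ.IsSymplecticGroupoid Ω P) (m : M) :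
    ∃ κ : M → Measure G, Measurable κ ∧ ∀ g, Γ.src g = m →
      κ (Γ.tgt g) = (Γ.normalizedHaar m).map (fun k => Γ.mul g k.1) := by
  obtain ⟨τ, hτ, hτs, hτt⟩ := hΓ.exists_measurable_section m
  refine ⟨fun x => (Γ.normalizedHaar m).map (fun k => Γ.mul (τ x) k.1), ?_, fun g hg =>
    Γ.map_normalizedHaar_congr (hτs _) hg (hτt _ ⟨g, hg, rfl⟩)⟩
  refine Measure.measurable_of_measurable_coe _ fun A hA => ?_
  have hmul : Continuous (fun p : {g : G // Γ.src g = m} × Γ.Isotropy m =>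
      Γ.mul p.1.1 p.2.1) :=
    Γ.continuous_mul_comp (continuous_subtype_val.comp continuous_fst)
      ((Isotropy.continuous_val m).comp continuous_snd) fun p => p.1.2.trans p.2.2.2.symm
  have hmeas : Measurable (fun p : M × Γ.Isotropy m => Γ.mul (τ p.1) p.2.1) :=
    hmul.measurable.comp (((hτ.subtype_mk (h := hτs)).comp measurable_fst).prodMk measurable_snd)
  have h := measurable_measure_prodMk_left (ν := Γ.normalizedHaar m) (hmeas hA)
  convert h using 2 with x
  rw [Measure.map_apply (Γ.continuous_mul_isotropy (hτs x)).measurable hA]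
  rfl

end FiberMeasure

/-! ### Charts of isotropy groups and product charts of source fibers -/

section IsotropyChart

variable {H : Type*} [NormedAddCommGroup H] [NormedSpace ℝ H] {m : M}

open Classical in
/-- An arrow as an element of the isotropy group of `m` (`1` if it is not a loop at `m`). -/
def toIsotropy (m : M) (g : G) : Γ.Isotropy m :=
  if h : Γ.src g = m ∧ Γ.tgt g = m then ⟨g, h⟩ else 1

theorem coe_toIsotropy {g : G} (h : Γ.src g = m ∧ Γ.tgt g = m) :
    (Γ.toIsotropy m g).1 = g :=
  congrArg (fun k : Γ.Isotropy m => k.1) (dif_pos h)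

/-- A chart of the isotropy group around the unit. -/
def isotropyGroupChart (c : SliceChart F H {g : G | Γ.src g = m ∧ Γ.tgt g = m})
    (hc : Γ.unit m ∈ c.nhd) : GroupChart (Γ.Isotropy m) H where
  dom := c.dom
  map v := Γ.toIsotropy m (c.map v)
  nhd := (fun k => k.1) ⁻¹' c.nhd
  coord k := c.coord k.1
  isOpen_dom := c.isOpen_dom
  isOpen_nhd := c.isOpen_nhd.preimage (Isotropy.continuous_val m)
  continuousOn_map := by
    rw [(Isotropy.isInducing_val m).continuousOn_iff]
    exact c.smooth_map.continuousOn.congr fun v hv => Γ.coe_toIsotropy (c.mapsTo_map hv).1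
  continuousOn_coord := c.smooth_coord.continuousOn.comp (Isotropy.continuous_val m).continuousOn
    fun k hk => ⟨k.2, hk⟩
  mapsTo_map v hv := by
    rw [mem_preimage, Γ.coe_toIsotropy (c.mapsTo_map hv).1]
    exact (c.mapsTo_map hv).2
  mapsTo_coord k hk := c.mapsTo_coord ⟨k.2, hk⟩
  coord_map v hv := by
    rw [Γ.coe_toIsotropy (c.mapsTo_map hv).1, c.coord_map v hv]
  map_coord k hk := Subtype.ext (by
    rw [c.map_coord _ ⟨k.2, hk⟩]
    exact Γ.coe_toIsotropy k.2)
  one_mem := hc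
  smooth_translate k := by
    have hcomp : ∀ v ∈ c.dom, Γ.src k.1 = Γ.tgt (c.map v) := fun v hv =>
      k.2.1.trans (c.mapsTo_map hv).1.2.symm
    have h1 := Γ.contMDiffOn_mul_comp (contMDiffOn_const (c := k.1)) c.smooth_map hcomp
    have h2 := c.contDiffOn_coord_comp h1 fun v hv =>
      ⟨(Γ.src_mul _ _ (hcomp v hv)).trans (c.mapsTo_map hv).1.1,
        (Γ.tgt_mul _ _ (hcomp v hv)).trans k.2.2⟩
    have h3 : ∀ v ∈ c.dom, (k * Γ.toIsotropy m (c.map v)).1 = Γ.mul k.1 (c.map v) :=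
      fun v hv => by rw [Isotropy.coe_mul, Γ.coe_toIsotropy (c.mapsTo_map hv).1]
    refine (h2.mono fun v hv => ⟨hv.1, ?_⟩).congr fun v hv => congrArg c.coord (h3 v hv.1)
    rw [mem_preimage, ← h3 v hv.1]
    exact hv.2
  smooth_div := by
    have hfst : ContMDiffOn 𝓘(ℝ, H × H) 𝓘(ℝ, F) ∞ (fun p : H × H => c.map p.1)
        (c.dom ×ˢ c.dom) :=
      c.smooth_map.comp contDiff_fst.contMDiff.contMDiffOn fun p hp => hp.1
    have hsnd : ContMDiffOn 𝓘(ℝ, H × H) 𝓘(ℝ, F) ∞ (fun p : H × H => c.map p.2)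
        (c.dom ×ˢ c.dom) :=
      c.smooth_map.comp contDiff_snd.contMDiff.contMDiffOn fun p hp => hp.2
    have hcomp : ∀ p ∈ c.dom ×ˢ c.dom, Γ.src (Γ.inv (c.map p.1)) = Γ.tgt (c.map p.2) :=
      fun p hp => by
        rw [Γ.src_inv, (c.mapsTo_map hp.1).1.2, (c.mapsTo_map hp.2).1.2]
    have h1 := Γ.contMDiffOn_mul_comp (Γ.contMDiff_inv.comp_contMDiffOn hfst) hsnd hcomp
    have h2 := c.contDiffOn_coord_comp h1 fun p hp =>
      ⟨(Γ.src_mul _ _ (hcomp p hp)).trans (c.mapsTo_map hp.2).1.1,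
        (Γ.tgt_mul _ _ (hcomp p hp)).trans ((Γ.tgt_inv _).trans (c.mapsTo_map hp.1).1.1)⟩
    have h3 : ∀ p ∈ c.dom ×ˢ c.dom,
        ((Γ.toIsotropy m (c.map p.1))⁻¹ * Γ.toIsotropy m (c.map p.2)).1 =
        Γ.mul (Γ.inv (c.map p.1)) (c.map p.2) := fun p hp => by
      rw [Isotropy.coe_mul, Isotropy.coe_inv, Γ.coe_toIsotropy (c.mapsTo_map hp.1).1,
        Γ.coe_toIsotropy (c.mapsTo_map hp.2).1]
    refine (h2.mono fun p hp => ⟨hp.1, ?_⟩).congr fun p hp => congrArg c.coord (h3 p hp.1)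
    exact (congrArg (· ∈ c.nhd) (h3 p hp.1)).mp hp.2

theorem isotropyGroupChart_map_coe (c : SliceChart F H {g : G | Γ.src g = m ∧ Γ.tgt g = m})
    (hc : Γ.unit m ∈ c.nhd) {v : H} (hv : v ∈ c.dom) :
    ((isotropyGroupChart c hc).map v).1 = c.map v :=
  Γ.coe_toIsotropy (c.mapsTo_map hv).1

end IsotropyChart

section OrbitChart

variable {H H' : Type*} [NormedAddCommGroup H] [NormedSpace ℝ H] [NormedAddCommGroup H']
  [NormedSpace ℝ H'] {m : M}

/-- A local trivialization of the principal bundle over the orbit. The element `k` is chosen so that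
the translated section passes through `g₀`, which then corresponds to the unit. The inverse reads
`a` from the target and the group coordinate from (sec(a)k)⁻¹g. -/
theorem OrbitSection.exists_sliceChart (s : Γ.OrbitSection m H)
    (c : SliceChart F H' {g : G | Γ.src g = m ∧ Γ.tgt g = m}) (hc : Γ.unit m ∈ c.nhd) {g₀ : G}
    (hg₀ : g₀ ∈ Γ.src ⁻¹' {m} ∩ s.nhd) :
    ∃ (k : Γ.Isotropy m) (d : SliceChart F (H × H') (Γ.src ⁻¹' {m})), g₀ ∈ d.nhd ∧
      d.dom ⊆ s.dom ×ˢ c.dom ∧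
      d.map = fun p => Γ.mul (Γ.mul (s.sec p.1) k.1) (c.map p.2) := by
  have hsb := fun g hg => s.tgt_sec_base g hg
  have hss : ∀ a ∈ s.dom, Γ.src (s.sec a) = m := fun a ha => (s.mapsTo_sec ha).1
  set k := Γ.isotropyDiv m (s.sec (s.base (Γ.tgt g₀))) g₀ (hss _ (s.base_mem _ hg₀)) hg₀.1
    (hsb g₀ hg₀) with hk
  set σ : H → G := fun a => Γ.mul (s.sec a) k.1 with hσ
  have hσs : ∀ a ∈ s.dom, Γ.src (σ a) = m := fun a ha => Γ.src_mul_isotropy (hss a ha) k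
  have hσt : ∀ a ∈ s.dom, Γ.tgt (σ a) = Γ.tgt (s.sec a) := fun a ha =>
    Γ.tgt_mul_isotropy (hss a ha) k
  have hσsm : ContMDiffOn 𝓘(ℝ, H) 𝓘(ℝ, F) ∞ σ s.dom :=
    Γ.contMDiffOn_mul_comp s.smooth_sec contMDiffOn_const
      fun a ha => (hss a ha).trans k.2.2.symm
  have hσg₀ : σ (s.base (Γ.tgt g₀)) = g₀ := Γ.mul_isotropyDiv _ _ _
  set β : G → H := fun g => s.base (Γ.tgt g) with hβ
  have hβsm : ContMDiffOn 𝓘(ℝ, F) 𝓘(ℝ, H) ∞ β (Γ.src ⁻¹' {m} ∩ s.nhd) :=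
    s.smooth_base.comp Γ.isSubmersion_tgt.contMDiff.contMDiffOn s.tgt_mem
  set δ : G → G := fun g => Γ.mul (Γ.inv (σ (β g))) g with hδ
  have hδc : ∀ g ∈ Γ.src ⁻¹' {m} ∩ s.nhd, Γ.tgt (σ (β g)) = Γ.tgt g := fun g hg => by
    rw [hσt _ (s.base_mem g hg), hsb g hg]
  have hδc' : ∀ g ∈ Γ.src ⁻¹' {m} ∩ s.nhd, Γ.src (Γ.inv (σ (β g))) = Γ.tgt g := fun g hg =>
    (Γ.src_inv _).trans (hδc g hg)
  have hδsm : ContMDiffOn 𝓘(ℝ, F) 𝓘(ℝ, F) ∞ δ (Γ.src ⁻¹' {m} ∩ s.nhd) :=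
    Γ.contMDiffOn_mul_comp (Γ.contMDiff_inv.comp_contMDiffOn
      (hσsm.comp hβsm s.base_mem)) contMDiffOn_id hδc'
  have hδm : ∀ g ∈ Γ.src ⁻¹' {m} ∩ s.nhd, Γ.src (δ g) = m ∧ Γ.tgt (δ g) = m := fun g hg =>
    ⟨(Γ.src_mul _ _ (hδc' g hg)).trans hg.1, (Γ.tgt_mul _ _ (hδc' g hg)).trans
      ((Γ.tgt_inv _).trans (hσs _ (s.base_mem g hg)))⟩
  obtain ⟨N, hN, hNδ⟩ := continuousOn_iff'.1 hδsm.continuousOn c.nhd c.isOpen_nhd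
  have hNmem : ∀ g ∈ Γ.src ⁻¹' {m} ∩ s.nhd, g ∈ N ↔ δ g ∈ c.nhd := fun g hg => by
    have := Set.ext_iff.1 hNδ g
    simp only [mem_inter_iff, mem_preimage] at this hg
    tauto
  set Φ : H × H' → G := fun p => Γ.mul (σ p.1) (c.map p.2) with hΦ
  have hΦc : ∀ p ∈ s.dom ×ˢ c.dom, Γ.src (σ p.1) = Γ.tgt (c.map p.2) := fun p hp =>
    (hσs _ hp.1).trans (c.mapsTo_map hp.2).1.2.symm
  have hΦsm : ContMDiffOn 𝓘(ℝ, H × H') 𝓘(ℝ, F) ∞ Φ (s.dom ×ˢ c.dom) :=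
    Γ.contMDiffOn_mul_comp (hσsm.comp contDiff_fst.contMDiff.contMDiffOn fun p hp => hp.1)
      (c.smooth_map.comp contDiff_snd.contMDiff.contMDiffOn fun p hp => hp.2) hΦc
  have hΦs : ∀ p ∈ s.dom ×ˢ c.dom, Γ.src (Φ p) = m := fun p hp =>
    (Γ.src_mul _ _ (hΦc p hp)).trans (c.mapsTo_map hp.2).1.1
  have hΦβ : ∀ p ∈ s.dom ×ˢ c.dom, β (Φ p) = p.1 := fun p hp => by
    simp only [hβ, hΦ]
    rw [Γ.tgt_mul _ _ (hΦc p hp), hσt _ hp.1, s.base_tgt_sec _ hp.1]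
  have hΦδ : ∀ p ∈ s.dom ×ˢ c.dom, δ (Φ p) = c.map p.2 := fun p hp => by
    simp only [hδ]
    rw [hΦβ p hp]
    exact Γ.inv_mul_mul_cancel (hΦc p hp)
  have hback : ∀ g ∈ Γ.src ⁻¹' {m} ∩ (s.nhd ∩ N), Φ (β g, c.coord (δ g)) = g := fun g hg => by
    have hg' : g ∈ Γ.src ⁻¹' {m} ∩ s.nhd := ⟨hg.1, hg.2.1⟩
    simp only [hΦ]
    rw [c.map_coord _ ⟨hδm g hg', (hNmem g hg').1 hg.2.2⟩]
    exact Γ.mul_inv_mul_cancel' (hδc g hg')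
  have hcoord : ∀ g ∈ Γ.src ⁻¹' {m} ∩ (s.nhd ∩ N), (β g, c.coord (δ g)) ∈ s.dom ×ˢ c.dom :=
    fun g hg => by
      have hg' : g ∈ Γ.src ⁻¹' {m} ∩ s.nhd := ⟨hg.1, hg.2.1⟩
      exact ⟨s.base_mem g hg', c.mapsTo_coord ⟨hδm g hg', (hNmem g hg').1 hg.2.2⟩⟩
  have hcsm : ContMDiffOn 𝓘(ℝ, F) 𝓘(ℝ, H × H') ∞ (fun g => (β g, c.coord (δ g)))
      (Γ.src ⁻¹' {m} ∩ (s.nhd ∩ N)) := by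
    refine (hβsm.mono fun g hg => ⟨hg.1, hg.2.1⟩).prodMk_space ?_
    exact c.smooth_coord.comp (hδsm.mono fun g hg => ⟨hg.1, hg.2.1⟩) fun g hg =>
      ⟨hδm g ⟨hg.1, hg.2.1⟩, (hNmem g ⟨hg.1, hg.2.1⟩).1 hg.2.2⟩
  refine ⟨k, {
    dom := s.dom ×ˢ c.dom ∩ Φ ⁻¹' s.nhd
    map := Φ
    nhd := s.nhd ∩ N
    coord := fun g => (β g, c.coord (δ g))
    isOpen_dom := hΦsm.continuousOn.isOpen_inter_preimage (s.isOpen_dom.prod c.isOpen_dom)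
      s.isOpen_nhd
    isOpen_nhd := s.isOpen_nhd.inter hN
    smooth_map := hΦsm.mono inter_subset_left
    smooth_coord := hcsm
    mapsTo_map := fun p hp => ⟨hΦs p hp.1, hp.2, by
      rw [hNmem _ ⟨hΦs p hp.1, hp.2⟩, hΦδ p hp.1]
      exact (c.mapsTo_map hp.1.2).2⟩
    mapsTo_coord := fun g hg => ⟨hcoord g hg, by
      rw [mem_preimage, hback g hg]; exact hg.2.1⟩
    coord_map := fun p hp => by
      rw [hΦβ p hp.1, hΦδ p hp.1, c.coord_map _ hp.1.2]
    map_coord := hback }, ⟨hg₀.2, ?_⟩, inter_subset_left, rfl⟩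
  rw [hNmem g₀ hg₀]
  have : δ g₀ = Γ.unit m := by
    simp only [hδ, hβ]
    rw [hσg₀, Γ.inv_mul, hg₀.1]
  rwa [this]

end OrbitChart

end LieGroupoid

/-! ### Smooth positive densities: change of chart, uniqueness, patching -/

section SmoothDensity

variable {H H' X : Type*} [NormedAddCommGroup H] [NormedSpace ℝ H] [FiniteDimensional ℝ H]
  [MeasurableSpace H] [BorelSpace H]
  [NormedAddCommGroup H'] [NormedSpace ℝ H'] [MeasurableSpace H'] [BorelSpace H']
  [TopologicalSpace X] [T2Space X] [MeasurableSpace X] [BorelSpace X]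

/-- In the parametrization `f` of a part of `X` by `U`, the measure `μ` has a smooth positive
density. -/
def HasSmoothDensity (μ : Measure X) (vol : Measure H) (U : Set H) (f : H → X) : Prop :=
  ∃ ρ : H → ℝ, ContDiffOn ℝ ∞ ρ U ∧ (∀ u ∈ U, 0 < ρ u) ∧
    HasDensity μ vol U f (fun u => ENNReal.ofReal (ρ u))

variable {μ : Measure X} {vol : Measure H}

omit [FiniteDimensional ℝ H] [BorelSpace H] [TopologicalSpace X] [T2Space X] [BorelSpace X] in
theorem HasSmoothDensity.mono {U V : Set H} {f : H → X} (h : HasSmoothDensity μ vol U f)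
    (hVU : V ⊆ U) : HasSmoothDensity μ vol V f := by
  obtain ⟨ρ, h1, h2, h3⟩ := h
  exact ⟨ρ, h1.mono hVU, fun u hu => h2 u (hVU hu), h3.mono hVU⟩

omit [TopologicalSpace X] [T2Space X] [BorelSpace X] in
theorem HasSmoothDensity.comp_linearEquiv [vol.IsAddHaarMeasure] {U : Set H} {f : H → X}
    (h : HasSmoothDensity μ vol U f) (vol' : Measure H') [vol'.IsAddHaarMeasure] (e : H' ≃L[ℝ] H) :
    HasSmoothDensity μ vol' (e ⁻¹' U) (f ∘ e) := by
  obtain ⟨ρ, h1, h2, h3⟩ := h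
  have : (vol'.map e).IsAddHaarMeasure := e.isAddHaarMeasure_map vol'
  have hc := Measure.isAddLeftInvariant_eq_smul vol (vol'.map e)
  have hc0 := Measure.addHaarScalarFactor_pos_of_isAddHaarMeasure vol (vol'.map e)
  set c := Measure.addHaarScalarFactor vol (vol'.map e) with hcdef
  refine ⟨fun u => c * ρ (e u), contDiffOn_const.mul (h1.comp e.contDiff.contDiffOn fun _ hu => hu),
    fun u hu => mul_pos (NNReal.coe_pos.2 hc0) (h2 _ hu), fun A hA hAm => ?_⟩
  have hAe : e '' A ⊆ U := image_subset_iff.2 hA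
  have hemb : MeasurableEmbedding e := e.toHomeomorph.measurableEmbedding
  have hAem : MeasurableSet (e '' A) := hemb.measurableSet_image.2 hAm
  rw [image_comp, h3 _ hAe hAem, hc, Measure.restrict_smul, lintegral_smul_measure,
    hemb.restrict_map, hemb.lintegral_map, preimage_image_eq A e.injective,
    ENNReal.smul_def, smul_eq_mul, ← lintegral_const_mul' _ _ ENNReal.coe_ne_top]
  refine lintegral_congr fun u => ?_
  rw [ENNReal.ofReal_mul c.coe_nonneg, ENNReal.ofReal_coe_nnreal]

omit [T2Space X] [BorelSpace X] [TopologicalSpace X] in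
theorem HasSmoothDensity.of_transition [vol.IsAddHaarMeasure] {U V : Set H} {f g : H → X}
    (h : HasSmoothDensity μ vol V g) (hU : IsOpen U) (hf : InjOn f U) {T : H → H}
    (hT : ContDiffOn ℝ ∞ T U) (hTV : MapsTo T U V) (hgT : ∀ u ∈ U, g (T u) = f u)
    (hdet : ∀ u ∈ U, (fderiv ℝ T u).det ≠ 0) : HasSmoothDensity μ vol U f := by
  obtain ⟨ρ, h1, h2, h3⟩ := h
  refine ⟨fun u => |(fderiv ℝ T u).det| * ρ (T u), ?_, fun u hu =>
    mul_pos (abs_pos.2 (hdet u hu)) (h2 _ (hTV hu)), fun A hA hAm => ?_⟩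
  · exact ((contDiff_continuousLinearMap_det.comp_contDiffOn
      (hT.fderiv_of_isOpen (m := ∞) hU (by simp))).abs hdet).mul (h1.comp hT hTV)
  · have hTinj : InjOn T A := fun u hu v hv huv => hf (hA hu) (hA hv) (by
      rw [← hgT u (hA hu), huv, hgT v (hA hv)])
    have himg : f '' A = g '' (T '' A) := by
      rw [image_image]
      exact image_congr fun u hu => (hgT u (hA hu)).symm
    have hTm : MeasurableSet (T '' A) :=
      hAm.image_of_continuousOn_injOn (hT.continuousOn.mono hA) hTinj
    rw [himg, h3 _ (image_subset_iff.2 fun u hu => hTV (hA hu)) hTm,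
      lintegral_image_eq_lintegral_abs_det_fderiv_mul vol hAm (fun u hu =>
        ((hT.contDiffAt (hU.mem_nhds (hA hu))).differentiableAt
          (by simp)).hasFDerivAt.hasFDerivWithinAt) hTinj]
    exact setLIntegral_congr_fun hAm fun u hu => by
      rw [ENNReal.ofReal_mul (abs_nonneg _)]

omit [TopologicalSpace X] [T2Space X] [BorelSpace X] in
-- Densities of one measure agree almost everywhere, and continuous functions that agree almost
-- everywhere on an open set agree on it, as Haar measure charges nonempty open sets.
theorem HasDensity.eqOn_of_continuousOn [vol.IsAddHaarMeasure] {W : Set H} {f : H → X}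
    {ρ ρ' : H → ℝ} (hW : IsOpen W)
    (h : HasDensity μ vol W f fun u => ENNReal.ofReal (ρ u))
    (h' : HasDensity μ vol W f fun u => ENNReal.ofReal (ρ' u))
    (hρ : ContinuousOn ρ W) (hρ' : ContinuousOn ρ' W) (hpos : ∀ u ∈ W, 0 < ρ u)
    (hpos' : ∀ u ∈ W, 0 < ρ' u) : EqOn ρ ρ' W := by
  have h1 : (fun u => ENNReal.ofReal (ρ u)) =ᵐ[vol.restrict W] fun u => ENNReal.ofReal (ρ' u) := by
    refine ae_eq_of_forall_setLIntegral_eq_of_sigmaFinite₀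
      (hρ.aemeasurable hW.measurableSet).ennreal_ofReal
      (hρ'.aemeasurable hW.measurableSet).ennreal_ofReal fun s hs _ => ?_
    rw [Measure.restrict_restrict hs, ← h _ inter_subset_right (hs.inter hW.measurableSet),
      ← h' _ inter_subset_right (hs.inter hW.measurableSet)]
  have h2 := Measure.eqOn_open_of_ae_eq h1 hW (ENNReal.continuous_ofReal.comp_continuousOn hρ)
    (ENNReal.continuous_ofReal.comp_continuousOn hρ')
  exact fun u hu => (ENNReal.ofReal_eq_ofReal_iff (hpos u hu).le (hpos' u hu).le).1 (h2 hu)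

/-- Local densities agree on overlaps by uniqueness, hence define one smooth function; countable
additivity over a countable subcover gives the integral formula. -/
theorem HasSmoothDensity.of_local [vol.IsAddHaarMeasure] {U : Set H} {f : H → X} (hU : IsOpen U)
    (hf : ContinuousOn f U) (hinj : InjOn f U)
    (h : ∀ u ∈ U, ∃ V ⊆ U, IsOpen V ∧ u ∈ V ∧ HasSmoothDensity μ vol V f) :
    HasSmoothDensity μ vol U f := by
  have h' : ∀ u : U, ∃ V ⊆ U, IsOpen V ∧ u.1 ∈ V ∧ HasSmoothDensity μ vol V f := fun u => h _ u.2
  choose V hVU hV huV ρ hρs hρp hρd using h'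
  have heq : ∀ u v : U, ∀ w ∈ V u ∩ V v, ρ u w = ρ v w := fun u v =>
    HasDensity.eqOn_of_continuousOn ((hV u).inter (hV v)) ((hρd u).mono inter_subset_left)
      ((hρd v).mono inter_subset_right) ((hρs u).continuousOn.mono inter_subset_left)
      ((hρs v).continuousOn.mono inter_subset_right) (fun w hw => hρp u w hw.1)
      fun w hw => hρp v w hw.2
  classical
  let R : H → ℝ := fun w => if hw : w ∈ U then ρ ⟨w, hw⟩ w else 0
  have hR : ∀ u : U, ∀ w ∈ V u, R w = ρ u w := fun u w hw => by
    simp only [R, dif_pos (hVU u hw)]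
    exact heq _ _ _ ⟨huV _, hw⟩
  refine ⟨R, fun u hu => ?_, fun u hu => ?_, fun A hA hAm => ?_⟩
  · have h1 := (hρs ⟨u, hu⟩).contDiffAt ((hV ⟨u, hu⟩).mem_nhds (huV ⟨u, hu⟩))
    exact (h1.congr_of_eventuallyEq (Filter.eventuallyEq_of_mem
      ((hV ⟨u, hu⟩).mem_nhds (huV ⟨u, hu⟩)) (hR ⟨u, hu⟩))).contDiffWithinAt
  · rw [hR ⟨u, hu⟩ u (huV _)]
    exact hρp _ _ (huV ⟨u, hu⟩)
  · rcases U.eq_empty_or_nonempty with rfl | ⟨u₀, hu₀⟩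
    · rw [subset_empty_iff.1 hA]; simp
    have : Nonempty U := ⟨⟨u₀, hu₀⟩⟩
    obtain ⟨t, ht, htU⟩ := TopologicalSpace.isOpen_iUnion_countable V hV
    have hVU' : ⋃ u, V u = U :=
      (iUnion_subset hVU).antisymm fun u hu => mem_iUnion.2 ⟨⟨u, hu⟩, huV _⟩
    have htne : t.Nonempty := by
      have : u₀ ∈ ⋃ u ∈ t, V u := by rw [htU, hVU']; exact hu₀
      obtain ⟨u, hu, -⟩ := mem_iUnion₂.1 this
      exact ⟨u, hu⟩
    obtain ⟨e, rfl⟩ := ht.exists_eq_range htne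
    set B := disjointed fun n => V (e n) with hB
    have hBm : ∀ n, MeasurableSet (B n) := MeasurableSet.disjointed fun n => (hV _).measurableSet
    have hBU : ⋃ n, B n = U := by
      rw [hB, iUnion_disjointed, ← hVU', ← htU, biUnion_range]
    have hBV : ∀ n, B n ⊆ V (e n) := fun n => disjointed_subset _ n
    have hAB : ⋃ n, A ∩ B n = A := by rw [← inter_iUnion, hBU, inter_eq_left.2 hA]
    have hdis : Pairwise (Function.onFun Disjoint fun n => A ∩ B n) := fun i j hij =>
      (disjoint_disjointed _ hij).mono inter_subset_right inter_subset_right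
    have hm : ∀ n, MeasurableSet (A ∩ B n) := fun n => hAm.inter (hBm n)
    have hsub : ∀ n, A ∩ B n ⊆ U := fun n => inter_subset_left.trans hA
    rw [← hAB, image_iUnion, measure_iUnion, lintegral_iUnion hm hdis]
    · refine tsum_congr fun n => ?_
      rw [hρd (e n) _ (inter_subset_right.trans (hBV n)) (hm n)]
      exact setLIntegral_congr_fun (hm n) fun w hw => by rw [hR (e n) w (hBV n hw.2)]
    · rintro i j hij
      refine disjoint_left.2 ?_
      rintro _ ⟨u, hu, rfl⟩ ⟨v, hv, hvu⟩
      rw [hinj (hsub j hv) (hsub i hu) hvu] at hv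
      exact disjoint_left.1 (hdis hij) hu hv
    · exact fun n => (hm n).image_of_continuousOn_injOn (hf.mono (hsub n)) (hinj.mono (hsub n))

end SmoothDensity

section Charts

variable {F X : Type*} [NormedAddCommGroup F] [NormedSpace ℝ F]
  [TopologicalSpace X] [ChartedSpace F X] [T2Space X] [MeasurableSpace X] [BorelSpace X]

/-- Near each point an arbitrary parametrization factors through a chart. Its immersion property and
equality of dimensions make the transition map have nonzero Jacobian. -/
theorem isSmoothMeasureOn_of_sliceCharts {k : ℕ} {S : Set X} {μ : Measure X} (h0 : μ Sᶜ = 0)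
    (h : ∀ g ∈ S, ∃ c : SliceChart F (EuclideanSpace ℝ (Fin k)) S, g ∈ c.nhd ∧
      HasSmoothDensity μ volume c.dom c.map) : IsSmoothMeasureOn F k S μ where
  concentrated := h0
  density U φ hφ hS := by
    refine HasSmoothDensity.of_local hφ.isOpen hφ.smooth.continuousOn hφ.injOn fun u hu => ?_
    obtain ⟨c, hc, hd⟩ := h _ (hS hu)
    have hop := c.isOpen_preimage_nhd hφ.isOpen hφ.smooth.continuousOn
    have hT := c.contDiffOn_coord_comp hφ.smooth hS
    refine ⟨U ∩ φ ⁻¹' c.nhd, inter_subset_left, hop, ⟨hu, hc⟩, hd.of_transition hop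
      (hφ.injOn.mono inter_subset_left) hT (fun v hv => c.mapsTo_coord ⟨hS hv.1, hv.2⟩)
      (fun v hv => c.map_coord _ ⟨hS hv.1, hv.2⟩) fun v hv => ?_⟩
    have hTd : DifferentiableAt ℝ (c.coord ∘ φ) v :=
      (hT.contDiffAt (hop.mem_nhds hv)).differentiableAt (by simp)
    have h1 := modelDeriv_comp (f := c.map) (g := c.coord ∘ φ)
      (c.mdifferentiableAt_map (c.mapsTo_coord ⟨hS hv.1, hv.2⟩)) hTd.mdifferentiableAt
    rw [modelDeriv_congr (f := c.map ∘ c.coord ∘ φ) (g := φ)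
      (Filter.eventuallyEq_of_mem (hop.mem_nhds hv) fun w hw => c.map_coord _ ⟨hS hw.1, hw.2⟩),
      modelDeriv_eq_fderiv] at h1
    have hinj : Function.Injective (fderiv ℝ (c.coord ∘ φ) v) := by
      intro a b hab
      refine hφ.immersion v hv.1 ?_
      have h2 : ∀ a, modelDeriv (EuclideanSpace ℝ (Fin k)) F φ v a = _ := DFunLike.congr_fun h1
      exact (h2 a).trans ((congrArg _ hab).trans (h2 b).symm)
    have hunit : IsUnit (fderiv ℝ (c.coord ∘ φ) v).toLinearMap :=
      (LinearMap.isUnit_iff_ker_eq_bot _).2 (LinearMap.ker_eq_bot.2 hinj)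
    exact (hunit.map LinearMap.det).ne_zero

end Charts

section Product

variable {H H' : Type*} [NormedAddCommGroup H] [NormedSpace ℝ H] [FiniteDimensional ℝ H]
  [MeasurableSpace H] [BorelSpace H] [NormedAddCommGroup H'] [NormedSpace ℝ H']
  [FiniteDimensional ℝ H'] [MeasurableSpace H'] [BorelSpace H']

omit [NormedSpace ℝ H] [FiniteDimensional ℝ H] in
theorem setLIntegral_prod_mul (vol : Measure H) (vol' : Measure H') [SFinite vol]
    [SFinite vol'] {U : Set H} {V : Set H'} (hU : IsOpen U) {D : H → ℝ} {R : H' → ℝ}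
    (hD : ContinuousOn D U) (hR : ContinuousOn R V) {A : Set (H × H')} (hA : A ⊆ U ×ˢ V)
    (hAm : MeasurableSet A) :
    ∫⁻ p in A, ENNReal.ofReal (D p.1) * ENNReal.ofReal (R p.2) ∂(vol.prod vol') =
      ∫⁻ u in U, ENNReal.ofReal (D u) *
        ∫⁻ v in Prod.mk u ⁻¹' A, ENNReal.ofReal (R v) ∂vol' ∂vol := by
  have hm : AEMeasurable (fun p : H × H' => ENNReal.ofReal (D p.1) * ENNReal.ofReal (R p.2))
      ((vol.prod vol').restrict A) :=
    ((hD.comp continuousOn_fst fun p hp => (hA hp).1).aemeasurable hAm).ennreal_ofReal.mul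
      ((hR.comp continuousOn_snd fun p hp => (hA hp).2).aemeasurable hAm).ennreal_ofReal
  rw [← lintegral_indicator hAm, lintegral_prod _ ((aemeasurable_indicator_iff hAm).2 hm),
    ← lintegral_indicator hU.measurableSet]
  refine lintegral_congr fun u => ?_
  have hAu : MeasurableSet (Prod.mk u ⁻¹' A) := measurable_prodMk_left hAm
  have h1 : ∀ v, A.indicator (fun p : H × H' => ENNReal.ofReal (D p.1) * ENNReal.ofReal (R p.2))
      (u, v) = (Prod.mk u ⁻¹' A).indicator
        (fun v => ENNReal.ofReal (D u) * ENNReal.ofReal (R v)) v := fun v => rfl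
  simp only [h1]
  rw [lintegral_indicator hAu, lintegral_const_mul' _ _ ENNReal.ofReal_ne_top]
  by_cases hu : u ∈ U
  · rw [indicator_of_mem hu]
  · have : Prod.mk u ⁻¹' A = ∅ := eq_empty_iff_forall_notMem.2 fun v hv => hu (hA hv).1
    simp [this, hu]

end Product

/-! ### The assembled measure: uniqueness, right invariance, smooth density -/

namespace LieGroupoid

variable {E F G M : Type*}
  [NormedAddCommGroup E] [NormedSpace ℝ E] [NormedAddCommGroup F] [NormedSpace ℝ F]
  [TopologicalSpace M] [ChartedSpace E M]
  [TopologicalSpace G] [ChartedSpace F G]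
  {Γ : LieGroupoid E F G M} {Ω : ∀ g : G, TangentSpace 𝓘(ℝ, F) g [⋀^Fin 2]→L[ℝ] ℝ}
  {P : ∀ x : M, Cotangent E x →ₗ[ℝ] Cotangent E x →ₗ[ℝ] ℝ}

section Translate

theorem orbit_tgt (g : G) : Γ.orbit (Γ.tgt g) = Γ.orbit (Γ.src g) := by
  ext x
  constructor
  · rintro ⟨h, hh, rfl⟩
    exact ⟨Γ.mul h g, Γ.src_mul _ _ hh, Γ.tgt_mul _ _ hh⟩
  · rintro ⟨h, hh, rfl⟩
    have hc : Γ.src h = Γ.tgt (Γ.inv g) := Eq.trans hh (Γ.tgt_inv g).symm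
    exact ⟨Γ.mul h (Γ.inv g), (Γ.src_mul _ _ hc).trans (Γ.src_inv g), Γ.tgt_mul _ _ hc⟩

open Classical in
-- The volume formula depends only on `t ∘ σ`, and right translation by g⁻¹ moves `σ` to the source
-- fiber of t(g) without changing `t ∘ σ`.
theorem IsLeafVolumeOfDim.translate [MeasurableSpace M] {r : ℕ} {g : G} {lam : Measure M}
    (h : Γ.IsLeafVolumeOfDim P r (Γ.tgt g) lam) : Γ.IsLeafVolumeOfDim P r (Γ.src g) lam := by
  refine ⟨Γ.orbit_tgt g ▸ h.1, fun U σ hσ hm hp => ?_⟩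
  have hc : ∀ u ∈ U, Γ.src (σ u) = Γ.tgt (Γ.inv g) := fun u hu =>
    Eq.trans (hm hu) (Γ.tgt_inv g).symm
  -- Off `U` the product need not be composable; keeping `σ` there makes `t ∘ σ'` and `t ∘ σ` equal
  -- as functions.
  set σ' := U.piecewise (fun u => Γ.mul (σ u) (Γ.inv g)) σ with hσ'
  have hσU : ∀ u ∈ U, σ' u = Γ.mul (σ u) (Γ.inv g) := fun u hu => piecewise_eq_of_mem _ _ _ hu
  have ht : ∀ u, Γ.tgt (σ' u) = Γ.tgt (σ u) := fun u => by
    by_cases hu : u ∈ U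
    · rw [hσU u hu, Γ.tgt_mul _ _ (hc u hu)]
    · rw [hσ', piecewise_eq_of_notMem _ _ _ hu]
  have ht' : Γ.tgt ∘ σ' = Γ.tgt ∘ σ := funext ht
  have hd : Γ.leafDensity P r σ' = Γ.leafDensity P r σ :=
    congrArg (fun (f : EuclideanSpace ℝ (Fin (2 * r)) → M) u =>
      |wedgePow r (leafForm P (f u)) (fun i =>
        mfderiv 𝓘(ℝ, EuclideanSpace ℝ (Fin (2 * r))) 𝓘(ℝ, E) f u
          (EuclideanSpace.single i (1 : ℝ)))|) ht'
  have := h.2 U σ' ((Γ.contMDiffOn_mul_comp hσ contMDiffOn_const hc).congr hσU)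
    (fun u hu => by
      change Γ.src (σ' u) = Γ.tgt g
      rw [hσU u hu, Γ.src_mul _ _ (hc u hu), Γ.src_inv]) (ht' ▸ hp)
  rwa [ht', hd] at this

end Translate

section Assembled

variable [MeasurableSpace G] [BorelSpace G] [MeasurableSpace M]
  [∀ x, CompactSpace (Γ.Isotropy x)]

variable (Γ P) in
/-- The measure `μ` on the source fiber of `m` is assembled from the symplectic volume `lam` of the
orbit of `m` and the translates `κ` of the normalized Haar measure of the isotropy group of `m`. -/
structure IsAssembledFrom (r : ℕ) (m : M) (lam : Measure M) (κ : M → Measure G)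
    (μ : Measure G) : Prop where
  leafVolume : Γ.IsLeafVolumeOfDim P r m lam
  fiber : ∀ g, Γ.src g = m → κ (Γ.tgt g) = (Γ.normalizedHaar m).map (fun k => Γ.mul g k.1)
  disintegration : ∀ A, MeasurableSet A →
    AEMeasurable (fun x => κ x A) lam ∧ μ A = ∫⁻ x, κ x A ∂lam

theorem isRightAssembled_iff [SecondCountableTopology G] {μ : M → Measure G} :
    Γ.IsRightAssembled P μ ↔
      ∀ m, ∃ lam κ, Γ.IsAssembledFrom P (leafHalfDim P m) m lam κ (μ m) := by
  refine forall_congr' fun m => exists_congr fun lam => exists_congr fun κ => ?_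
  constructor
  · rintro ⟨h1, h2, h3⟩
    exact ⟨isLeafVolume_iff.1 h1, fun g hg => (h2 g hg).trans (Γ.map_normalizedHaar_tgt hg rfl),
      h3⟩
  · rintro ⟨h1, h2, h3⟩
    exact ⟨isLeafVolume_iff.2 h1,
      fun g hg => (h2 g hg).trans (Γ.map_normalizedHaar_tgt hg rfl).symm, h3⟩

variable {r : ℕ} {m : M} {lam : Measure M} {κ : M → Measure G} {μ : Measure G}

theorem IsAssembledFrom.ae_mem_orbit (h : Γ.IsAssembledFrom P r m lam κ μ) :
    ∀ᵐ x ∂lam, x ∈ Γ.orbit m :=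
  h.leafVolume.1

theorem IsAssembledFrom.fiber_apply (h : Γ.IsAssembledFrom P r m lam κ μ) {g : G}
    (hg : Γ.src g = m) {A : Set G} (hA : MeasurableSet A) :
    κ (Γ.tgt g) A = Γ.normalizedHaar m {k | Γ.mul g k.1 ∈ A} := by
  rw [h.fiber g hg, Measure.map_apply (Γ.continuous_mul_isotropy hg).measurable hA]
  rfl

theorem IsAssembledFrom.fiber_apply' [SecondCountableTopology G]
    (h : Γ.IsAssembledFrom P r m lam κ μ) {g : G} {x : M}
    (hg : Γ.src g = m) (hx : Γ.tgt g = x) {A : Set G} (hA : MeasurableSet A) :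
    κ x A = Γ.normalizedHaar x {k | Γ.mul k.1 g ∈ A} := by
  have h1 := h.fiber g hg
  rw [← Γ.map_normalizedHaar_tgt hg hx, hx] at h1
  rw [h1, Measure.map_apply (Γ.continuous_isotropy_mul hx).measurable hA]
  rfl

theorem IsAssembledFrom.measure_compl_fiber [T2Space M] [SecondCountableTopology G]
    (h : Γ.IsAssembledFrom P r m lam κ μ) : μ (Γ.src ⁻¹' {m})ᶜ = 0 := by
  have hS : MeasurableSet (Γ.src ⁻¹' {m})ᶜ :=
    (isClosed_singleton.preimage Γ.isSubmersion_src.contMDiff.continuous).measurableSet.compl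
  rw [(h.disintegration _ hS).2]
  refine (lintegral_congr_ae (g := fun _ => 0) ?_).trans lintegral_zero
  filter_upwards [h.ae_mem_orbit] with x hx
  obtain ⟨g, hg, rfl⟩ := hx
  rw [h.fiber_apply hg hS]
  convert measure_empty (μ := Γ.normalizedHaar m)
  exact eq_empty_iff_forall_notMem.2 fun k hk => hk (Γ.src_mul_isotropy hg k)

variable [FiniteDimensional ℝ E] [FiniteDimensional ℝ F]
  [BorelSpace M] [T2Space M] [IsManifold 𝓘(ℝ, E) ∞ M]
  [SecondCountableTopology G]

theorem IsSymplecticGroupoid.exists_isAssembledFrom (hΓ : Γ.IsSymplecticGroupoid Ω P)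
    (hr : r = leafHalfDim P m) :
    ∃ lam κ μ, Measurable κ ∧ Γ.IsAssembledFrom P r m lam κ μ := by
  obtain ⟨lam, hlam⟩ := hΓ.exists_isLeafVolumeOfDim hr
  obtain ⟨κ, hκ, hκf⟩ := hΓ.exists_fiberMeasure m
  exact ⟨lam, κ, lam.bind κ, hκ, hlam, hκf, fun A hA =>
    ⟨((Measure.measurable_coe hA).comp hκ).aemeasurable,
      Measure.bind_apply hA hκ.aemeasurable⟩⟩

/-- The fiber measures are prescribed only over the orbit, which suffices because the leaf volume is
concentrated there. -/
theorem IsSymplecticGroupoid.isAssembledFrom_unique (hΓ : Γ.IsSymplecticGroupoid Ω P)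
    (hr : r = leafHalfDim P m) {lam' : Measure M} {κ' : M → Measure G} {μ' : Measure G}
    (h : Γ.IsAssembledFrom P r m lam κ μ) (h' : Γ.IsAssembledFrom P r m lam' κ' μ') : μ = μ' := by
  have hlam := hΓ.isLeafVolumeOfDim_unique hr h.leafVolume h'.leafVolume
  subst hlam
  ext A hA
  rw [(h.disintegration A hA).2, (h'.disintegration A hA).2]
  refine lintegral_congr_ae ?_
  filter_upwards [h.ae_mem_orbit] with x hx
  obtain ⟨g, hg, rfl⟩ := hx
  rw [h.fiber_apply hg hA, h'.fiber_apply hg hA]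

/-- The leaf volumes at s(g) and t(g) coincide by uniqueness. Over a common point x, associativity
k(ag) = (ka)g matches the fiber measures; here their description through the group at x is the
convenient one. -/
theorem IsSymplecticGroupoid.isAssembledFrom_translate (hΓ : Γ.IsSymplecticGroupoid Ω P) {g : G}
    (hr : r = leafHalfDim P (Γ.src g)) {lam' : Measure M} {κ' : M → Measure G} {μ' : Measure G}
    (h : Γ.IsAssembledFrom P r (Γ.src g) lam κ μ)
    (h' : Γ.IsAssembledFrom P r (Γ.tgt g) lam' κ' μ') {A : Set G} (hA : MeasurableSet A) :
    μ' {h | Γ.src h = Γ.tgt g ∧ Γ.mul h g ∈ A} = μ A := by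
  have hlam := hΓ.isLeafVolumeOfDim_unique hr h.leafVolume h'.leafVolume.translate
  subst hlam
  have hB : MeasurableSet {h | Γ.src h = Γ.tgt g ∧ Γ.mul h g ∈ A} :=
    measurableSet_inter_preimage_of_continuousOn (U := Γ.src ⁻¹' {Γ.tgt g})
      (isClosed_singleton.preimage Γ.isSubmersion_src.contMDiff.continuous).measurableSet
      (Γ.continuousOn_mul_comp (c₂ := fun _ => g) continuousOn_id continuousOn_const
        fun u hu => hu) hA
  rw [(h.disintegration A hA).2, (h'.disintegration _ hB).2]
  refine lintegral_congr_ae ?_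
  filter_upwards [h'.ae_mem_orbit] with x hx
  obtain ⟨a, ha, rfl⟩ := hx
  rw [h.fiber_apply' (g := Γ.mul a g) (Γ.src_mul _ _ ha) (Γ.tgt_mul _ _ ha) hA,
    h'.fiber_apply' ha rfl hB]
  congr 1
  ext k
  have hk : Γ.src k.1 = Γ.tgt a := k.2.1
  simp only [mem_ofPred_eq]
  rw [Γ.src_mul _ _ hk, Γ.mul_assoc _ _ _ hk ha]
  exact and_iff_right ha

variable [T2Space G] [IsManifold 𝓘(ℝ, F) ∞ G]

omit [FiniteDimensional ℝ E] [FiniteDimensional ℝ F] [IsManifold 𝓘(ℝ, E) ∞ M]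
  [SecondCountableTopology G] [IsManifold 𝓘(ℝ, F) ∞ G] in
-- Over the point with coordinate `a`, the fiber measure of the image of `A` is the Haar measure of
-- the corresponding slice of `A`, by independence of the representative sec(a)k. Integrating
-- against the leaf density is Tonelli's theorem.
theorem IsAssembledFrom.hasDensity (h : Γ.IsAssembledFrom P r m lam κ μ) (hκ : Measurable κ)
    (s : Γ.OrbitSection m (EuclideanSpace ℝ (Fin (2 * r)))) {n : ℕ}
    (hD : ContinuousOn (Γ.leafDensity P r s.sec) s.dom)
    (c : SliceChart F (EuclideanSpace ℝ (Fin n)) {g | Γ.src g = m ∧ Γ.tgt g = m})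
    (hc : Γ.unit m ∈ c.nhd) {ρ : EuclideanSpace ℝ (Fin n) → ℝ} (hρ : ContinuousOn ρ c.dom)
    (hρd : HasDensity (Γ.normalizedHaar m) volume c.dom (isotropyGroupChart c hc).map
      (fun v => ENNReal.ofReal (ρ v))) (k : Γ.Isotropy m) :
    HasDensity μ ((volume : Measure (EuclideanSpace ℝ (Fin (2 * r)))).prod
      (volume : Measure (EuclideanSpace ℝ (Fin n)))) (s.dom ×ˢ c.dom)
      (fun p => Γ.mul (Γ.mul (s.sec p.1) k.1) (c.map p.2))
      (fun p => ENNReal.ofReal (Γ.leafDensity P r s.sec p.1 * ρ p.2)) := by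
  intro A hA hAm
  have hss : ∀ a ∈ s.dom, Γ.src (s.sec a) = m := fun a ha => (s.mapsTo_sec ha).1
  have hks : ∀ a ∈ s.dom, Γ.src (s.sec a) = Γ.tgt k.1 := fun a ha => (hss a ha).trans k.2.2.symm
  have hcc : ∀ p ∈ s.dom ×ˢ c.dom, Γ.src (Γ.mul (s.sec p.1) k.1) = Γ.tgt (c.map p.2) :=
    fun p hp => (Γ.src_mul_isotropy (hss _ hp.1) k).trans (c.mapsTo_map hp.2).1.2.symm
  set Φ : EuclideanSpace ℝ (Fin (2 * r)) × EuclideanSpace ℝ (Fin n) → G :=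
    fun p => Γ.mul (Γ.mul (s.sec p.1) k.1) (c.map p.2) with hΦ
  have hΦt : ∀ p ∈ s.dom ×ˢ c.dom, Γ.tgt (Φ p) = Γ.tgt (s.sec p.1) := fun p hp =>
    (Γ.tgt_mul _ _ (hcc p hp)).trans (Γ.tgt_mul _ _ (hks _ hp.1))
  have hfst : ∀ p ∈ s.dom ×ˢ c.dom, ∀ a ∈ s.dom, Γ.tgt (Φ p) = Γ.tgt (s.sec a) → p.1 = a :=
    fun p hp a ha e => by
      rw [hΦt p hp] at e
      rw [← s.base_tgt_sec p.1 hp.1, e, s.base_tgt_sec a ha]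
  have hsnd : ∀ a ∈ s.dom, ∀ v ∈ c.dom, ∀ w ∈ c.dom, Φ (a, v) = Φ (a, w) → v = w :=
    fun a ha v hv w hw e =>
      c.injOn_map hv hw (Γ.mul_left_cancel (hcc (a, v) ⟨ha, hv⟩) (hcc (a, w) ⟨ha, hw⟩) e)
  have hinj : InjOn Φ (s.dom ×ˢ c.dom) := by
    rintro ⟨a, v⟩ hp ⟨b, w⟩ hq e
    have hab : a = b := hfst _ hp b hq.1 (by rw [e, hΦt _ hq])
    subst hab
    rw [hsnd a hp.1 v hp.2 w hq.2 e]
  have hcont : ContinuousOn Φ (s.dom ×ˢ c.dom) :=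
    Γ.continuousOn_mul_comp (Γ.continuousOn_mul_comp
      (s.smooth_sec.continuousOn.comp continuousOn_fst fun p hp => hp.1) continuousOn_const
        fun p hp => hks _ hp.1)
      (c.smooth_map.continuousOn.comp continuousOn_snd fun p hp => hp.2) hcc
  have hΦA : MeasurableSet (Φ '' A) :=
    hAm.image_of_continuousOn_injOn (hcont.mono hA) (hinj.mono hA)
  have himg : MeasurableSet ((Γ.tgt ∘ s.sec) '' s.dom) :=
    s.isOpen_dom.measurableSet.image_of_continuousOn_injOn
      s.isParametrization.smooth.continuousOn s.isParametrization.injOn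
  have hfib : ∀ a ∈ s.dom, κ (Γ.tgt (s.sec a)) (Φ '' A) =
      ∫⁻ v in Prod.mk a ⁻¹' A, ENNReal.ofReal (ρ v) := by
    intro a ha
    refine Eq.trans ?_ (hρd (Prod.mk a ⁻¹' A) (fun v hv => (hA hv).2) (measurable_prodMk_left hAm))
    rw [← Γ.tgt_mul_isotropy (hss a ha) k, h.fiber_apply (Γ.src_mul_isotropy (hss a ha) k) hΦA]
    congr 1
    ext l
    constructor
    · rintro ⟨p, hp, e⟩
      have h1 : p.1 = a := hfst p (hA hp) a ha (by
        rw [e, Γ.tgt_mul_isotropy (Γ.src_mul_isotropy (hss a ha) k),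
          Γ.tgt_mul_isotropy (hss a ha) k])
      obtain ⟨b, v⟩ := p
      subst h1
      refine ⟨v, hp, Subtype.ext ?_⟩
      rw [isotropyGroupChart_map_coe c hc (hA hp).2]
      refine Γ.mul_left_cancel (hcc _ (hA hp)) ?_ e
      exact (Γ.src_mul_isotropy (hss _ ha) k).trans l.2.2.symm
    · rintro ⟨v, hv, rfl⟩
      refine ⟨(a, v), hv, ?_⟩
      rw [isotropyGroupChart_map_coe c hc (hA hv).2]
  -- The image meets only fibers over the section, so integration over the orbit reduces to the part
  -- that the section parametrizes.
  have hz : ∀ᵐ x ∂lam, κ x (Φ '' A) =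
      ((Γ.tgt ∘ s.sec) '' s.dom).indicator (fun x => κ x (Φ '' A)) x := by
    filter_upwards [h.ae_mem_orbit] with x hx
    by_cases hxs : x ∈ (Γ.tgt ∘ s.sec) '' s.dom
    · rw [indicator_of_mem hxs]
    · rw [indicator_of_notMem hxs]
      obtain ⟨g, hg, rfl⟩ := hx
      rw [h.fiber_apply hg hΦA]
      convert measure_empty (μ := Γ.normalizedHaar m)
      refine eq_empty_iff_forall_notMem.2 fun l hl => hxs ?_
      obtain ⟨p, hp, e⟩ := hl
      exact ⟨p.1, (hA hp).1, by
        rw [Function.comp_apply, ← hΦt p (hA hp), e, Γ.tgt_mul_isotropy hg]⟩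
  rw [(h.disintegration _ hΦA).2, lintegral_congr_ae hz, lintegral_indicator himg]
  refine ((s.hasDensity h.leafVolume).setLIntegral_image s.isOpen_dom.measurableSet
      s.isParametrization.smooth.continuousOn
      (hD.aemeasurable s.isOpen_dom.measurableSet).ennreal_ofReal
      ((Measure.measurable_coe hΦA).comp hκ)).trans ?_
  have hprod : ∀ p : EuclideanSpace ℝ (Fin (2 * r)) × EuclideanSpace ℝ (Fin n),
      ENNReal.ofReal (Γ.leafDensity P r s.sec p.1 * ρ p.2) =
      ENNReal.ofReal (Γ.leafDensity P r s.sec p.1) * ENNReal.ofReal (ρ p.2) := fun p =>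
    ENNReal.ofReal_mul (abs_nonneg _)
  simp only [hprod]
  rw [setLIntegral_prod_mul _ _ s.isOpen_dom hD hρ hA hAm]
  refine setLIntegral_congr_fun s.isOpen_dom.measurableSet fun a ha => ?_
  simp only [Function.comp]
  rw [hfib a ha]

theorem IsSymplecticGroupoid.exists_sliceChart_hasSmoothDensity
    (hΓ : Γ.IsSymplecticGroupoid Ω P) (hr : r = leafHalfDim P m)
    (h : Γ.IsAssembledFrom P r m lam κ μ) (hκ : Measurable κ) {g₀ : G} (hg₀ : Γ.src g₀ = m) :
    ∃ c : SliceChart F (EuclideanSpace ℝ (Fin (Module.finrank ℝ F - Module.finrank ℝ E)))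
      (Γ.src ⁻¹' {m}), g₀ ∈ c.nhd ∧ HasSmoothDensity μ volume c.dom c.map := by
  obtain ⟨n, hn⟩ := Nat.exists_eq_add_of_le (hr ▸ hΓ.two_mul_leafHalfDim_le m)
  obtain ⟨s, hs⟩ := hΓ.exists_orbitSection hr hg₀
  obtain ⟨c, hc⟩ := hΓ.exists_isotropyChart hr hn
  obtain ⟨k, d, hd, hdd, hdm⟩ := s.exists_sliceChart c hc ⟨hg₀, hs⟩
  obtain ⟨ρ, hρs, hρp, hρd⟩ := (isotropyGroupChart c hc).exists_haar_density volume
  have hms : MapsTo s.sec s.dom (Γ.src ⁻¹' {m}) := fun a ha => (s.mapsTo_sec ha).1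
  have hDs := hΓ.contDiffOn_leafDensity s.isOpen_dom s.smooth_sec hms hr
    s.isParametrization.immersion
  have hDp := fun u hu => hΓ.leafDensity_pos s.isOpen_dom s.smooth_sec hms hr hu
    (s.isParametrization.immersion u hu)
  have hdens : HasSmoothDensity μ ((volume : Measure (EuclideanSpace ℝ (Fin (2 * r)))).prod
      (volume : Measure (EuclideanSpace ℝ (Fin n)))) d.dom d.map := by
    refine HasSmoothDensity.mono ⟨fun p => Γ.leafDensity P r s.sec p.1 * ρ p.2, ?_, fun p hp =>
      mul_pos (hDp _ hp.1) (hρp _ hp.2), ?_⟩ hdd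
    · exact (hDs.comp contDiffOn_fst fun p hp => hp.1).mul
        (hρs.comp contDiffOn_snd fun p hp => hp.2)
    · rw [hdm]
      exact h.hasDensity hκ s hDs.continuousOn c hc hρs.continuousOn hρd k
  let e : EuclideanSpace ℝ (Fin (Module.finrank ℝ F - Module.finrank ℝ E)) ≃L[ℝ]
      EuclideanSpace ℝ (Fin (2 * r)) × EuclideanSpace ℝ (Fin n) :=
    ContinuousLinearEquiv.ofFinrankEq (by simp [hn])
  exact ⟨d.congr e, hd, hdens.comp_linearEquiv volume e⟩

theorem IsSymplecticGroupoid.isSmoothMeasureOn (hΓ : Γ.IsSymplecticGroupoid Ω P)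
    (hr : r = leafHalfDim P m) (h : Γ.IsAssembledFrom P r m lam κ μ) (hκ : Measurable κ) :
    IsSmoothMeasureOn F (Module.finrank ℝ F - Module.finrank ℝ E) (Γ.src ⁻¹' {m}) μ :=
  isSmoothMeasureOn_of_sliceCharts h.measure_compl_fiber fun _ hg =>
    hΓ.exists_sliceChart_hasSmoothDensity hr h hκ hg

end Assembled

end LieGroupoid

/-! ### Smooth dependence of integrals on parameters -/

section ParametricIntegral

variable {Q H : Type*} [NormedAddCommGroup Q] [NormedSpace ℝ Q] [NormedAddCommGroup H]
  [NormedSpace ℝ H] [FiniteDimensional ℝ H] [MeasurableSpace H] [BorelSpace H]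

open scoped Convolution in
-- The integral is the value at 0 of the convolution of the constant 1 with z ↦ g(w, −z), so
-- smoothness of parametric convolutions applies.
theorem contDiffOn_integral_of_compact_support {vol : Measure H} [vol.IsAddHaarMeasure]
    {g : Q → H → ℝ} {W : Set Q} {K : Set H} (hW : IsOpen W) (hK : IsCompact K)
    (hg0 : ∀ w ∈ W, ∀ y, y ∉ K → g w y = 0)
    (hg : ContDiffOn ℝ ∞ (fun p : Q × H => g p.1 p.2) (W ×ˢ univ)) :
    ContDiffOn ℝ ∞ (fun w => ∫ y, g w y ∂vol) W := by
  have h := contDiffOn_convolution_right_with_param_comp (μ := vol) (n := (⊤ : ℕ∞))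
    (ContinuousLinearMap.mul ℝ ℝ) (v := fun _ : Q => (0 : H)) (f := fun _ : H => (1 : ℝ))
    (g := fun w z => g w (-z)) (k := -K) contDiffOn_const hW hK.neg
    (fun w z hw hz => hg0 w hw _ fun h => hz h) (locallyIntegrable_const 1)
    (hg.comp (t := W ×ˢ univ) (g := fun p : Q × H => g p.1 p.2) (f := fun p : Q × H => (p.1, -p.2))
      (contDiff_fst.prodMk contDiff_snd.neg).contDiffOn fun p hp => ⟨hp.1, mem_univ _⟩)
  refine h.congr fun w _ => ?_
  simp [convolution]

end ParametricIntegral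

section Fiberwise

variable {F X H Q : Type*} [NormedAddCommGroup F] [NormedSpace ℝ F]
  [TopologicalSpace X] [ChartedSpace F X] [T2Space X] [MeasurableSpace X] [BorelSpace X]
  [NormedAddCommGroup H] [NormedSpace ℝ H] [FiniteDimensional ℝ H] [MeasurableSpace H]
  [BorelSpace H] [NormedAddCommGroup Q] [NormedSpace ℝ Q]
  {S : Set X} {μ : Measure X} {W : Set Q} {f : Q → X → ℝ} {C : Set X}

/-- In the chart the integrand is multiplied by the density and extended by 0. The extension is
smooth because its support lies in a compact subset of the chart domain, the same for all
parameters. -/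
theorem SliceChart.contDiffOn_integral (c : SliceChart F H S) {vol : Measure H}
    [vol.IsAddHaarMeasure] (hd : HasSmoothDensity μ vol c.dom c.map) (hW : IsOpen W)
    (hC : IsCompact C) (hCS : C ⊆ S ∩ c.nhd) (hf0 : ∀ w ∈ W, ∀ x, x ∉ C → f w x = 0)
    (hfc : ∀ w ∈ W, ContinuousOn (f w) S)
    (hf : ContDiffOn ℝ ∞ (fun p : Q × H => f p.1 (c.map p.2)) (W ×ˢ c.dom)) :
    (∀ w ∈ W, Integrable (f w) μ) ∧ ContDiffOn ℝ ∞ (fun w => ∫ x, f w x ∂μ) W := by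
  classical
  obtain ⟨ρ, hρs, hρp, hρd⟩ := hd
  set K := c.coord '' C with hKd
  have hK : IsCompact K := hC.image_of_continuousOn (c.smooth_coord.continuousOn.mono hCS)
  have hKdom : K ⊆ c.dom := image_subset_iff.2 fun x hx => c.mapsTo_coord (hCS hx)
  have hout : ∀ w ∈ W, ∀ y ∈ c.dom, y ∉ K → f w (c.map y) = 0 := fun w hw y hy hyK =>
    hf0 w hw _ fun h => hyK ⟨_, h, c.coord_map y hy⟩
  set g : Q → H → ℝ := fun w => c.dom.indicator fun y => ρ y * f w (c.map y) with hgd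
  have hg0 : ∀ w ∈ W, ∀ y, y ∉ K → g w y = 0 := fun w hw y hy => by
    by_cases hyd : y ∈ c.dom
    · simp only [hgd, indicator_of_mem hyd, hout w hw y hyd hy, mul_zero]
    · simp only [hgd, indicator_of_notMem hyd]
  have hg : ContDiffOn ℝ ∞ (fun p : Q × H => g p.1 p.2) (W ×ˢ univ) := by
    rintro ⟨w, y⟩ ⟨hw, -⟩
    by_cases hyd : y ∈ c.dom
    · have h1 : ContDiffOn ℝ ∞ (fun p : Q × H => ρ p.2 * f p.1 (c.map p.2)) (W ×ˢ c.dom) :=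
        (hρs.comp contDiffOn_snd fun p hp => hp.2).mul hf
      have hnhd : W ×ˢ c.dom ∈ 𝓝 (w, y) := (hW.prod c.isOpen_dom).mem_nhds ⟨hw, hyd⟩
      refine ((h1.contDiffAt hnhd).congr_of_eventuallyEq ?_).contDiffWithinAt
      exact Filter.eventuallyEq_of_mem hnhd fun p hp => indicator_of_mem hp.2 _
    · have hnhd : W ×ˢ Kᶜ ∈ 𝓝 (w, y) :=
        (hW.prod hK.isClosed.isOpen_compl).mem_nhds ⟨hw, fun h => hyd (hKdom h)⟩
      refine ((contDiffAt_const (c := (0 : ℝ))).congr_of_eventuallyEq ?_).contDiffWithinAt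
      exact Filter.eventuallyEq_of_mem hnhd fun p hp => hg0 _ hp.1 _ hp.2
  have himg : MeasurableSet (c.map '' c.dom) :=
    c.isOpen_dom.measurableSet.image_of_continuousOn_injOn c.smooth_map.continuousOn c.injOn_map
  have hsupp : ∀ w ∈ W, ∀ x, x ∉ c.map '' c.dom → f w x = 0 := fun w hw x hx =>
    hf0 w hw x fun h => hx ⟨c.coord x, c.mapsTo_coord (hCS h), c.map_coord x (hCS h)⟩
  have hres := hρd.restrict_image c.isOpen_dom.measurableSet c.smooth_map.continuousOn
  have hmap := HasDensity.aemeasurable_withDensity (vol := vol) c.isOpen_dom.measurableSet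
    c.smooth_map.continuousOn fun u => ENNReal.ofReal (ρ u)
  have hD : AEMeasurable (fun u => ENNReal.ofReal (ρ u)) (vol.restrict c.dom) :=
    (hρs.continuousOn.aemeasurable c.isOpen_dom.measurableSet).ennreal_ofReal
  have hfm : ∀ w ∈ W, AEStronglyMeasurable (f w)
      (((vol.restrict c.dom).withDensity fun u => ENNReal.ofReal (ρ u)).map c.map) := by
    intro w hw
    rw [← hres]
    refine ((hfc w hw).mono ?_).aestronglyMeasurable himg
    rintro _ ⟨y, hy, rfl⟩
    exact (c.mapsTo_map hy).1
  have hgc : ∀ w ∈ W, Continuous (g w) := fun w hw =>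
    continuousOn_univ.1 (hg.continuousOn.comp (f := fun y => (w, y)) (by fun_prop)
      fun y _ => ⟨hw, mem_univ _⟩)
  have hgeq : ∀ w, ∀ y ∈ c.dom, (ENNReal.ofReal (ρ y)).toReal • f w (c.map y) = g w y :=
    fun w y hy => by
      rw [ENNReal.toReal_ofReal (hρp y hy).le, smul_eq_mul]
      simp only [hgd, indicator_of_mem hy]
  have hgi : ∀ w ∈ W, Integrable (g w) vol := fun w hw =>
    (hgc w hw).integrable_of_hasCompactSupport (HasCompactSupport.intro hK (hg0 w hw))
  refine ⟨fun w hw => ?_, ?_⟩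
  · rw [← integrableOn_iff_integrable_of_support_subset (s := c.map '' c.dom)
      (fun x hx => by_contra fun h => hx (hsupp w hw x h)), IntegrableOn, hres,
      integrable_map_measure (hfm w hw) hmap,
      integrable_withDensity_iff_integrable_smul₀' hD (Filter.Eventually.of_forall fun _ =>
        ENNReal.ofReal_lt_top)]
    exact ((hgi w hw).integrableOn (s := c.dom)).congr_fun
      (fun y hy => (hgeq w y hy).symm) c.isOpen_dom.measurableSet
  · refine (contDiffOn_integral_of_compact_support (vol := vol) hW hK hg0 hg).congr fun w hw => ?_
    rw [← setIntegral_eq_integral_of_forall_compl_eq_zero (hsupp w hw), hres,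
      integral_map hmap (hfm w hw), integral_withDensity_eq_integral_toReal_smul₀ hD
        (Filter.Eventually.of_forall fun _ => ENNReal.ofReal_lt_top),
      setIntegral_congr_fun c.isOpen_dom.measurableSet (hgeq w)]
    exact setIntegral_eq_integral_of_forall_compl_eq_zero fun y hy => indicator_of_notMem hy _

/-- A partition of unity on the compact set, subordinate to finitely many charts, reduces to
integrands supported in one chart. -/
theorem contDiffOn_integral_of_sliceCharts [FiniteDimensional ℝ F] [IsManifold 𝓘(ℝ, F) ∞ X]
    [SecondCountableTopology X] {vol : Measure H} [vol.IsAddHaarMeasure]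
    (hS : ∀ x ∈ S, ∃ c : SliceChart F H S, x ∈ c.nhd ∧ HasSmoothDensity μ vol c.dom c.map)
    (hW : IsOpen W) (hC : IsCompact C) (hCS : C ⊆ S) (hf0 : ∀ w ∈ W, ∀ x, x ∉ C → f w x = 0)
    (hfc : ∀ w ∈ W, ContinuousOn (f w) S)
    (hf : ∀ c : SliceChart F H S,
      ContDiffOn ℝ ∞ (fun p : Q × H => f p.1 (c.map p.2)) (W ×ˢ c.dom)) :
    ContDiffOn ℝ ∞ (fun w => ∫ x, f w x ∂μ) W := by
  have hS' : ∀ x : C, ∃ c : SliceChart F H S, x.1 ∈ c.nhd ∧ HasSmoothDensity μ vol c.dom c.map :=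
    fun x => hS x (hCS x.2)
  choose c hc hd using hS'
  obtain ⟨t, ht⟩ := hC.elim_finite_subcover (fun x => (c x).nhd) (fun x => (c x).isOpen_nhd)
    fun x hx => mem_iUnion.2 ⟨⟨x, hx⟩, hc ⟨x, hx⟩⟩
  have : LocallyCompactSpace X := ChartedSpace.locallyCompactSpace F X
  obtain ⟨χ, hχ⟩ := SmoothPartitionOfUnity.exists_isSubordinate 𝓘(ℝ, F) hC.isClosed
    (fun x : t => (c x.1).nhd) (fun x => (c x.1).isOpen_nhd) (fun x hx => by
      obtain ⟨i, hi, hxi⟩ := mem_iUnion₂.1 (ht hx)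
      exact mem_iUnion.2 ⟨⟨i, hi⟩, hxi⟩)
  have key := fun i : t => (c i.1).contDiffOn_integral (C := C ∩ tsupport (χ i)) (μ := μ)
    (f := fun w x => χ i x * f w x) (hd i.1) hW (hC.inter_right (isClosed_tsupport _))
    (fun x hx => ⟨hCS hx.1, hχ i hx.2⟩)
    (fun w hw x hx => by
      by_cases hxC : x ∈ C
      · have : χ i x = 0 := image_eq_zero_of_notMem_tsupport fun h => hx ⟨hxC, h⟩
        rw [this, zero_mul]
      · rw [hf0 w hw x hxC, mul_zero])
    (fun w hw => (χ i).contMDiff.continuous.continuousOn.mul (hfc w hw))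
    (ContDiffOn.mul (by
      have h1 : ContDiffOn ℝ ∞ (fun y => χ i ((c i.1).map y)) (c i.1).dom := by
        rw [← contMDiffOn_iff_contDiffOn]
        exact (χ i).contMDiff.comp_contMDiffOn (c i.1).smooth_map
      exact h1.comp contDiffOn_snd fun p hp => hp.2) (hf (c i.1)))
  refine (ContDiffOn.sum (s := Finset.univ) fun i _ => (key i).2).congr fun w hw => ?_
  rw [← integral_finsetSum _ fun i _ => (key i).1 w hw]
  refine integral_congr_ae (Filter.Eventually.of_forall fun x => ?_)
  simp only [← Finset.sum_mul]
  by_cases hx : x ∈ C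
  · have h1 := χ.sum_eq_one hx
    rw [finsum_eq_sum_of_fintype] at h1
    rw [h1, one_mul]
  · rw [hf0 w hw x hx, mul_zero]

end Fiberwise

/-! ### Smoothness along the orbits -/

namespace LieGroupoid

variable {E F G M : Type*}
  [NormedAddCommGroup E] [NormedSpace ℝ E] [NormedAddCommGroup F] [NormedSpace ℝ F]
  [TopologicalSpace M] [ChartedSpace E M]
  [TopologicalSpace G] [ChartedSpace F G]
  {Γ : LieGroupoid E F G M} {Ω : ∀ g : G, TangentSpace 𝓘(ℝ, F) g [⋀^Fin 2]→L[ℝ] ℝ}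
  {P : ∀ x : M, Cotangent E x →ₗ[ℝ] Cotangent E x →ₗ[ℝ] ℝ}

theorem isClosed_srcFiber [T1Space M] (m : M) : IsClosed (Γ.src ⁻¹' {m}) :=
  isClosed_singleton.preimage Γ.isSubmersion_src.contMDiff.continuous

theorem continuousOn_mul_const (g : G) : ContinuousOn (fun h => Γ.mul h g)
    (Γ.src ⁻¹' {Γ.tgt g}) :=
  Γ.continuousOn_mul_comp (c₂ := fun _ => g) continuousOn_id continuousOn_const fun _ hu => hu

section Smooth

variable [MeasurableSpace G] [BorelSpace G] [T2Space M] {μ : M → Measure G}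

/-- Right invariance as a pushforward, so that it can be used under integrals. The restriction to
the source fiber is where h ↦ hg is defined and continuous. -/
theorem measure_tgt_eq_map
    (hinv : ∀ (g : G) (A : Set G), MeasurableSet A →
      μ (Γ.tgt g) {h | Γ.src h = Γ.tgt g ∧ Γ.mul h g ∈ A} = μ (Γ.src g) A) (g : G) :
    μ (Γ.src g) = ((μ (Γ.tgt g)).restrict (Γ.src ⁻¹' {Γ.tgt g})).map (fun h => Γ.mul h g) := by
  have hm := (Γ.isClosed_srcFiber (Γ.tgt g)).measurableSet
  have hae : AEMeasurable (fun h => Γ.mul h g)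
      ((μ (Γ.tgt g)).restrict (Γ.src ⁻¹' {Γ.tgt g})) :=
    (Γ.continuousOn_mul_const g).aemeasurable hm
  ext A hA
  rw [Measure.map_apply_of_aemeasurable hae hA, ← hinv g A hA,
    Measure.restrict_apply₀ (hae.nullMeasurable hA)]
  congr 1
  ext h
  exact and_comm

omit [MeasurableSpace G] [BorelSpace G] in
theorem isCompact_mul_of_continuousOn {Q : Type*} [TopologicalSpace Q] [T2Space Q] [T2Space G]
    {K : Set G} {L : Set Q} (hK : IsCompact K) (hL : IsCompact L) {φ : Q → G}
    (hφ : ContinuousOn φ L) :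
    IsCompact ((fun p : G × Q => Γ.mul p.1 (φ p.2)) ''
      {p | p ∈ K ×ˢ L ∧ Γ.src p.1 = Γ.tgt (φ p.2)}) := by
  have h2 : ContinuousOn (fun p : G × Q => φ p.2) (K ×ˢ L) :=
    hφ.comp continuousOn_snd fun p hp => hp.2
  have h3 : ContinuousOn (fun p : G × Q => (Γ.src p.1, Γ.tgt (φ p.2))) (K ×ˢ L) :=
    (Γ.isSubmersion_src.contMDiff.continuous.comp continuous_fst).continuousOn.prodMk
      (Γ.isSubmersion_tgt.contMDiff.continuous.comp_continuousOn h2)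
  have hc : IsCompact {p : G × Q | p ∈ K ×ˢ L ∧ Γ.src p.1 = Γ.tgt (φ p.2)} :=
    (hK.prod hL).of_isClosed_subset (h3.preimage_isClosed_of_isClosed
      (hK.prod hL).isClosed isClosed_diagonal) fun p hp => hp.1
  exact hc.image_of_continuousOn (Γ.continuousOn_mul_comp continuousOn_fst
    (h2.mono fun p hp => hp.1) fun p hp => hp.2)

variable [FiniteDimensional ℝ F] [T2Space G] [SecondCountableTopology G]
  [IsManifold 𝓘(ℝ, F) ∞ G]

/-- By invariance under g⁻¹, the integral of f against the measure at t(g) is the integral of h ↦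
f(hg⁻¹) over the source fiber of m. The parameter then sits in a smooth integrand, while measure and
domain are fixed. -/
theorem contMDiffOn_integral_tgt {n : ℕ} {m : M}
    (hinv : ∀ (g : G) (A : Set G), MeasurableSet A →
      μ (Γ.tgt g) {h | Γ.src h = Γ.tgt g ∧ Γ.mul h g ∈ A} = μ (Γ.src g) A)
    (hμ : ∀ g, Γ.src g = m → ∃ c : SliceChart F (EuclideanSpace ℝ (Fin n)) (Γ.src ⁻¹' {m}),
      g ∈ c.nhd ∧ HasSmoothDensity (μ m) volume c.dom c.map)
    {f : G → ℝ} (hf : ContMDiff 𝓘(ℝ, F) 𝓘(ℝ, ℝ) ∞ f) (hfc : HasCompactSupport f) :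
    ContMDiffOn 𝓘(ℝ, F) 𝓘(ℝ, ℝ) ∞ (fun g => ∫ h, f h ∂(μ (Γ.tgt g))) (Γ.src ⁻¹' {m}) := by
  set S := Γ.src ⁻¹' {m} with hSd
  have hSm : MeasurableSet S := (Γ.isClosed_srcFiber m).measurableSet
  have hcm : ∀ g ∈ S, Γ.tgt (Γ.inv g) = m := fun g hg => (Γ.tgt_inv g).trans hg
  have hint : ∀ g ∈ S, ∫ h, f h ∂(μ (Γ.tgt g)) =
      ∫ h, S.indicator (fun h => f (Γ.mul h (Γ.inv g))) h ∂(μ m) := by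
    intro g hg
    have hcont := Γ.continuousOn_mul_const (Γ.inv g)
    have h1 := Γ.measure_tgt_eq_map hinv (Γ.inv g)
    rw [hcm g hg] at h1 hcont
    rw [← Γ.src_inv g, h1, integral_map (hcont.aemeasurable hSm)
      hf.continuous.aestronglyMeasurable, integral_indicator hSm]
  intro g₀ hg₀
  obtain ⟨c, hc, -⟩ := hμ g₀ hg₀
  have hw₀ := c.mapsTo_coord ⟨hg₀, hc⟩
  -- The closed ball gives a compact set of parameters: whenever f(hg⁻¹) ≠ 0, the arrow h lies in
  -- the compact set of products of the support of f with the arrows g over this ball.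
  obtain ⟨ε, hε, hball⟩ := Metric.nhds_basis_closedBall.mem_iff.1 (c.isOpen_dom.mem_nhds hw₀)
  set W := Metric.ball (c.coord g₀) ε
  have hWc : W ⊆ Metric.closedBall (c.coord g₀) ε := Metric.ball_subset_closedBall
  have hWd : W ⊆ c.dom := hWc.trans hball
  have hcS : ∀ w ∈ c.dom, c.map w ∈ S := fun w hw => (c.mapsTo_map hw).1
  have hcomp : ∀ h ∈ S, ∀ w ∈ c.dom, Γ.src h = Γ.tgt (Γ.inv (c.map w)) := fun h hh w hw =>
    Eq.trans hh (hcm _ (hcS w hw)).symm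
  have hI : ContDiffOn ℝ ∞ (fun w => ∫ h, f h ∂(μ (Γ.tgt (c.map w)))) W := by
    refine (contDiffOn_integral_of_sliceCharts (S := S)
      (f := fun w => S.indicator (fun h => f (Γ.mul h (Γ.inv (c.map w))))) hμ Metric.isOpen_ball
      (Γ.isCompact_mul_of_continuousOn hfc (isCompact_closedBall (c.coord g₀) ε)
        (c.smooth_map.continuousOn.mono hball)) ?_ ?_ ?_ ?_).congr
      fun w hw => hint _ (hcS w (hWd hw))
    · rintro _ ⟨p, ⟨hp, hpc⟩, rfl⟩
      exact (Γ.src_mul _ _ hpc).trans (hcS _ (hball hp.2))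
    · intro w hw h hh
      by_contra hne
      have hhS : h ∈ S := mem_of_indicator_ne_zero hne
      rw [indicator_of_mem hhS] at hne
      have hc' := hcomp h hhS w (hWd hw)
      refine hh ⟨(Γ.mul h (Γ.inv (c.map w)), w), ⟨⟨subset_tsupport f hne, hWc hw⟩, ?_⟩, ?_⟩
      · exact (Γ.src_mul _ _ hc').trans (Γ.src_inv _)
      · exact Γ.mul_inv_mul_cancel (Eq.trans hhS (hcS w (hWd hw)).symm)
    · intro w hw
      refine ContinuousOn.congr ?_ fun h hh => indicator_of_mem hh _
      exact hf.continuous.comp_continuousOn (Γ.continuousOn_mul_comp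
        (c₂ := fun _ => Γ.inv (c.map w)) continuousOn_id continuousOn_const
        fun h hh => hcomp h hh w (hWd hw))
    · intro d
      have hdS : ∀ y ∈ d.dom, d.map y ∈ S := fun y hy => (d.mapsTo_map hy).1
      have h1 : ContMDiffOn 𝓘(ℝ, EuclideanSpace ℝ (Fin n) × EuclideanSpace ℝ (Fin n)) 𝓘(ℝ, F) ∞
          (fun p : EuclideanSpace ℝ (Fin n) × EuclideanSpace ℝ (Fin n) =>
            Γ.mul (d.map p.2) (Γ.inv (c.map p.1))) (W ×ˢ d.dom) := by
        refine Γ.contMDiffOn_mul_comp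
          (d.smooth_map.comp contDiff_snd.contMDiff.contMDiffOn fun p hp => hp.2)
          (Γ.contMDiff_inv.comp_contMDiffOn (c.smooth_map.comp
            contDiff_fst.contMDiff.contMDiffOn fun p hp => hWd hp.1)) ?_
        exact fun p hp => hcomp _ (hdS _ hp.2) _ (hWd hp.1)
      have h2 := hf.comp_contMDiffOn h1
      rw [contMDiffOn_iff_contDiffOn] at h2
      exact h2.congr fun p hp => indicator_of_mem (hdS _ hp.2) _
  have hIw := (hI.contDiffAt (Metric.isOpen_ball.mem_nhds (Metric.mem_ball_self hε))).contMDiffAt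
  have h3 := hIw.comp_contMDiffWithinAt g₀ (c.smooth_coord g₀ ⟨hg₀, hc⟩)
  have h4 := h3.congr (f₁ := fun g => ∫ h, f h ∂(μ (Γ.tgt g)))
    (fun g hg => by simp only [Function.comp, c.map_coord g hg])
    (by simp only [Function.comp, c.map_coord g₀ ⟨hg₀, hc⟩])
  exact h4.mono_of_mem_nhdsWithin (inter_mem_nhdsWithin _ (c.isOpen_nhd.mem_nhds hc))

end Smooth

end LieGroupoid

/-! ### Inversion and the left-handed statement -/

namespace LieGroupoid

variable {E F G M : Type*}
  [NormedAddCommGroup E] [NormedSpace ℝ E] [NormedAddCommGroup F] [NormedSpace ℝ F]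
  [TopologicalSpace M] [ChartedSpace E M]
  [TopologicalSpace G] [ChartedSpace F G]
  {Γ : LieGroupoid E F G M} {Ω : ∀ g : G, TangentSpace 𝓘(ℝ, F) g [⋀^Fin 2]→L[ℝ] ℝ}
  {P : ∀ x : M, Cotangent E x →ₗ[ℝ] Cotangent E x →ₗ[ℝ] ℝ}

section Inversion

variable (Γ) in
/-- Inversion as a homeomorphism. -/
def invHomeomorph : G ≃ₜ G where
  toFun := Γ.inv
  invFun := Γ.inv
  left_inv := Γ.inv_inv
  right_inv := Γ.inv_inv
  continuous_toFun := Γ.contMDiff_inv.continuous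
  continuous_invFun := Γ.contMDiff_inv.continuous

theorem image_inv (A : Set G) : Γ.inv '' A = Γ.inv ⁻¹' A :=
  Γ.invHomeomorph.toEquiv.image_eq_preimage_symm A

theorem _root_.SymplecticGroupoid.IsParametrization.inv {k : ℕ}
    {U : Set (EuclideanSpace ℝ (Fin k))} {φ : EuclideanSpace ℝ (Fin k) → G}
    (hφ : IsParametrization (H := F) U φ) : IsParametrization (H := F) U (Γ.inv ∘ φ) where
  isOpen := hφ.isOpen
  smooth := Γ.contMDiff_inv.comp_contMDiffOn hφ.smooth
  injOn := Γ.invHomeomorph.injective.injOn.comp hφ.injOn (mapsTo_univ _ _)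
  immersion u hu := by
    have hd : ∀ g, MDifferentiableAt 𝓘(ℝ, F) 𝓘(ℝ, F) Γ.inv g := fun g =>
      Γ.contMDiff_inv.mdifferentiable (by simp) g
    have h1 := modelDeriv_comp (f := Γ.inv) (g := φ) (hd _)
      (mdifferentiableAt_of_contMDiffOn hφ.isOpen hu hφ.smooth)
    have h2 := modelDeriv_comp (f := Γ.inv) (g := Γ.inv) (hd _) (hd (φ u))
    rw [modelDeriv_of_eqOn_id (f := Γ.inv ∘ Γ.inv) isOpen_univ
      (mem_univ _) fun g _ => Γ.inv_inv g] at h2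
    have h3 : Function.Injective (modelDeriv F F Γ.inv (φ u)) :=
      Function.LeftInverse.injective (g := modelDeriv F F Γ.inv (Γ.inv (φ u)))
        fun v => (DFunLike.congr_fun h2 v).symm
    have h4 : Function.Injective (modelDeriv (EuclideanSpace ℝ (Fin k)) F (Γ.inv ∘ φ) u) := by
      rw [h1]
      exact h3.comp (hφ.immersion u hu)
    exact h4

variable [MeasurableSpace G] [BorelSpace G]

theorem map_inv_apply (μ : Measure G) (A : Set G) : μ.map Γ.inv A = μ (Γ.inv ⁻¹' A) :=
  Γ.invHomeomorph.measurableEmbedding.map_apply μ A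

theorem map_inv_map_inv (μ : Measure G) : (μ.map Γ.inv).map Γ.inv = μ := by
  ext A _
  rw [Γ.map_inv_apply, Γ.map_inv_apply, ← preimage_comp]
  congr 1
  ext g
  simp [Γ.inv_inv]

theorem _root_.SymplecticGroupoid.IsSmoothMeasureOn.map_inv {k : ℕ} {x : M} {μ : Measure G}
    (h : IsSmoothMeasureOn F k (Γ.src ⁻¹' {x}) μ) :
    IsSmoothMeasureOn F k (Γ.tgt ⁻¹' {x}) (μ.map Γ.inv) where
  concentrated := by
    rw [Γ.map_inv_apply, ← h.concentrated]
    congr 1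
    ext g
    simp [Γ.tgt_inv]
  density U φ hφ hm := by
    obtain ⟨ρ, h1, h2, h3⟩ := h.density U (Γ.inv ∘ φ) hφ.inv fun u hu =>
      (Γ.src_inv _).trans (hm hu)
    refine ⟨ρ, h1, h2, fun A hA hAm => ?_⟩
    rw [Γ.map_inv_apply, ← Γ.image_inv, ← image_comp]
    exact h3 A hA hAm

theorem IsRightHaar.isLeftHaar_map_inv {μ : M → Measure G} (h : Γ.IsRightHaar μ) :
    Γ.IsLeftHaar (fun x => (μ x).map Γ.inv) where
  smoothMeasure x := (h.smoothMeasure x).map_inv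
  invariant g A hA := by
    have h1 := h.invariant (Γ.inv g) (Γ.inv ⁻¹' A) (Γ.contMDiff_inv.continuous.measurable hA)
    rw [Γ.tgt_inv, Γ.src_inv] at h1
    rw [Γ.map_inv_apply, Γ.map_inv_apply, ← h1]
    congr 1
    ext k
    simp only [mem_preimage, mem_ofPred_eq, Γ.tgt_inv]
    refine and_congr_right fun hk => ?_
    rw [Γ.inv_mul_rev (hk.trans (Γ.tgt_inv g).symm), Γ.inv_inv]
  smoothAlongOrbits f hf hfc m := by
    have h1 := h.smoothAlongOrbits (f ∘ Γ.inv) (hf.comp Γ.contMDiff_inv)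
      (hfc.comp_homeomorph Γ.invHomeomorph) m
    have h2 := h1.comp (s := Γ.tgt ⁻¹' {m}) Γ.contMDiff_inv.contMDiffOn
      fun g hg => (Γ.src_inv g).trans hg
    refine h2.congr fun g _ => ?_
    simp only [Function.comp, Γ.tgt_inv]
    exact Γ.invHomeomorph.measurableEmbedding.integral_map f

end Inversion

section Assembled

variable [MeasurableSpace G] [BorelSpace G] [MeasurableSpace M]
  [∀ x, CompactSpace (Γ.Isotropy x)] [SecondCountableTopology G]

omit [MeasurableSpace M] in
-- Since (g⁻¹k)⁻¹ = k⁻¹g, this is invariance of normalized Haar measure under inversion.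
theorem map_normalizedHaar_inv {x : M} {g : G} (hg : Γ.tgt g = x) :
    ((Γ.normalizedHaar x).map (fun k => Γ.mul (Γ.inv g) k.1)).map Γ.inv =
      (Γ.normalizedHaar x).map (fun k => Γ.mul k.1 g) := by
  have hinv : (Γ.normalizedHaar x).map (·⁻¹) = Γ.normalizedHaar x := map_inv_haarMeasure_top
  have hs : Γ.src (Γ.inv g) = x := (Γ.src_inv g).trans hg
  conv_rhs => rw [← hinv]
  rw [Measure.map_map (Γ.contMDiff_inv.continuous.measurable)
    (Γ.continuous_mul_isotropy hs).measurable,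
    Measure.map_map (Γ.continuous_isotropy_mul hg).measurable continuous_inv.measurable]
  congr 1
  funext k
  simp only [Function.comp]
  rw [Γ.inv_mul_rev (hs.trans k.2.2.symm), Γ.inv_inv, Isotropy.coe_inv]

/-- The leaf volume is the same measure in both constructions; only the fiber measures are inverted.
-/
theorem IsLeftAssembled.isRightAssembled_map_inv {ν : M → Measure G}
    (h : Γ.IsLeftAssembled P ν) : Γ.IsRightAssembled P (fun x => (ν x).map Γ.inv) := by
  intro m
  obtain ⟨lam, κ, h1, h2, h3⟩ := h m
  refine ⟨lam, fun x => (κ x).map Γ.inv, h1, fun g hg => ?_, fun A hA => ?_⟩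
  · have hx : ∀ x, Γ.src (Γ.inv g) = x →
        κ x = (Γ.normalizedHaar x).map (fun k => Γ.mul (Γ.inv g) k.1) := by
      rintro _ rfl
      exact h2 _ ((Γ.tgt_inv g).trans hg)
    rw [← Γ.map_normalizedHaar_inv rfl, ← hx _ (Γ.src_inv g)]
  · simp only [Γ.map_inv_apply]
    exact h3 _ (Γ.contMDiff_inv.continuous.measurable hA)

theorem IsRightAssembled.isLeftAssembled_map_inv {μ : M → Measure G}
    (h : Γ.IsRightAssembled P μ) : Γ.IsLeftAssembled P (fun x => (μ x).map Γ.inv) := by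
  intro m
  obtain ⟨lam, κ, h1, h2, h3⟩ := h m
  refine ⟨lam, fun x => (κ x).map Γ.inv, h1, fun g hg => ?_, fun A hA => ?_⟩
  · have hx : ∀ x, Γ.tgt (Γ.inv g) = x →
        κ x = (Γ.normalizedHaar x).map (fun k => Γ.mul k.1 (Γ.inv g)) := by
      rintro _ rfl
      exact h2 _ ((Γ.src_inv g).trans hg)
    change (κ (Γ.src g)).map Γ.inv = _
    rw [hx _ (Γ.tgt_inv g), ← Γ.map_normalizedHaar_inv (Γ.tgt_inv g), Γ.map_inv_map_inv,
      Γ.inv_inv]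
  · simp only [Γ.map_inv_apply]
    exact h3 _ (Γ.contMDiff_inv.continuous.measurable hA)

variable [FiniteDimensional ℝ E] [FiniteDimensional ℝ F]
  [BorelSpace M] [T2Space M] [IsManifold 𝓘(ℝ, E) ∞ M] [T2Space G] [IsManifold 𝓘(ℝ, F) ∞ G]

theorem IsSymplecticGroupoid.exists_isRightHaar (hΓ : Γ.IsSymplecticGroupoid Ω P) :
    ∃ μ : M → Measure G, Γ.IsRightHaar μ ∧ Γ.IsRightAssembled P μ ∧
      ∀ μ', Γ.IsRightAssembled P μ' → μ' = μ := by
  choose lam κ μ hκ h using fun m => hΓ.exists_isAssembledFrom (m := m) rfl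
  have hinv : ∀ (g : G) (A : Set G), MeasurableSet A →
      μ (Γ.tgt g) {h | Γ.src h = Γ.tgt g ∧ Γ.mul h g ∈ A} = μ (Γ.src g) A := fun g A hA => by
    have h' := h (Γ.tgt g)
    -- The leaf dimensions at the two ends of g agree only propositionally; rewriting puts both
    -- parametrizations in the same Euclidean space.
    rw [hΓ.leafHalfDim_tgt g] at h'
    exact hΓ.isAssembledFrom_translate rfl (h (Γ.src g)) h' hA
  refine ⟨μ, ⟨fun m => hΓ.isSmoothMeasureOn rfl (h m) (hκ m), hinv, fun f hf hfc m =>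
    Γ.contMDiffOn_integral_tgt hinv (fun g hg =>
      hΓ.exists_sliceChart_hasSmoothDensity rfl (h m) (hκ m) hg) hf hfc⟩,
    isRightAssembled_iff.2 fun m => ⟨lam m, κ m, h m⟩, fun μ' h' => funext fun m => ?_⟩
  obtain ⟨lam', κ', hm⟩ := isRightAssembled_iff.1 h' m
  exact hΓ.isAssembledFrom_unique rfl hm (h m)

/-- Inversion is an involution exchanging left and right assembled families, so existence and
uniqueness transfer from the right-handed case. -/
theorem IsSymplecticGroupoid.exists_isLeftHaar (hΓ : Γ.IsSymplecticGroupoid Ω P) :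
    ∃ ν : M → Measure G, Γ.IsLeftHaar ν ∧ Γ.IsLeftAssembled P ν ∧
      ∀ ν', Γ.IsLeftAssembled P ν' → ν' = ν := by
  obtain ⟨μ, h1, h2, h3⟩ := hΓ.exists_isRightHaar
  refine ⟨fun x => (μ x).map Γ.inv, h1.isLeftHaar_map_inv, h2.isLeftAssembled_map_inv,
    fun ν' h' => funext fun m => ?_⟩
  rw [← h3 _ h'.isRightAssembled_map_inv, Γ.map_inv_map_inv]

end Assembled

end LieGroupoid

end SymplecticGroupoid

end

theorem mainTheorem9 {E F G M : Type*}
    [NormedAddCommGroup E] [NormedSpace ℝ E] [FiniteDimensional ℝ E]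
    [NormedAddCommGroup F] [NormedSpace ℝ F] [FiniteDimensional ℝ F]
    [TopologicalSpace M] [ChartedSpace E M] [IsManifold 𝓘(ℝ, E) ∞ M]
    [T2Space M] [SecondCountableTopology M] [MeasurableSpace M] [BorelSpace M]
    [TopologicalSpace G] [ChartedSpace F G] [IsManifold 𝓘(ℝ, F) ∞ G]
    [T2Space G] [SecondCountableTopology G] [MeasurableSpace G] [BorelSpace G]
    (Γ : SymplecticGroupoid.LieGroupoid E F G M)
    (Ω : ∀ g : G, TangentSpace 𝓘(ℝ, F) g [⋀^Fin 2]→L[ℝ] ℝ)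
    (P : ∀ x : M, SymplecticGroupoid.Cotangent E x →ₗ[ℝ]
      SymplecticGroupoid.Cotangent E x →ₗ[ℝ] ℝ)
    (hΓ : Γ.IsSymplecticGroupoid Ω P)
    [∀ x, CompactSpace (Γ.Isotropy x)] :
    (∃ μ : M → Measure G, Γ.IsRightHaar μ ∧ Γ.IsRightAssembled P μ ∧
      ∀ μ', Γ.IsRightAssembled P μ' → μ' = μ) ∧
    (∃ ν : M → Measure G, Γ.IsLeftHaar ν ∧ Γ.IsLeftAssembled P ν ∧
      ∀ ν', Γ.IsLeftAssembled P ν' → ν' = ν) :=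
  ⟨hΓ.exists_isRightHaar, hΓ.exists_isLeftHaar⟩
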